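/- Let $d\ge 1$, let $\Omega\subset\mathbb R^d$ be a bounded open set with Lipschitz boundary, with surface measure $\sigma$ on $\partial\Omega$ and outward unit normal $n$ (defined $\sigma$-a.e.). Let $\varepsilon>0$, $\alpha,\kappa\ge 0$, $V\in C^2(\overline\Omega)$, $F=\nabla V$ in $\Omega$, and $f:\Omega\to\mathbb R$, $g:\partial\Omega\to\mathbb R$. Put $$c_V=\frac{\Delta V}{2\varepsilon}+\frac{|\nabla V|^2}{4\varepsilon^2}\ \text{ in }\Omega .$$ Classical solutions are functions in $C^2(\Omega)\cap C^1(\overline\Omega)$ that satisfy the equation at every point of $\Omega$ and the boundary condition at $\sigma$-almost every point of $\partial\Omega$. (1) Change of variable. Let $u=e^{V/(2\varepsilon)}z$ on $\overline\Omega$. Then $u\in C^2(\Omega)\cap C^1(\overline\Omega)$ if and only if $z$ is, and $u$ is a classical solution of $$-\varepsilon\Delta u+\nabla\cdot(Fu)=f\ \text{ in }\Omega,\qquad \alpha\,\nabla u\cdot n+\kappa u=g\ \text{ on }\partial\Omega$$ if and only if $z$ is a classical solution of $$-\Delta z+c_V z=\frac{e^{-V/(2\varepsilon)}}{\varepsilon}f\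 \text{ in }\Omega,\qquad \alpha\,\nabla z\cdot n+\Big(\kappa+\frac{\alpha}{2\varepsilon}\nabla V\cdot n\Big)z=e^{-V/(2\varepsilon)}g\ \text{ on }\partial\Omega .\qquad (\ast)$$ For $z\in C^2(\Omega)\cap C^1(\overline\Omega)$ the two equations are moreover equivalent at each single point of $\Omega$, and the two boundary conditions at each single point of $\partial\Omega$ (where $n(x)$ is read as $0$ at the exceptional points without normal). (2) Weak formulation. There is exactly one bounded linear trace operator $T:H^1(\Omega)\to L^2(\partial\Omega)$ that restricts every function of $H^1(\Omega)\cap C(\overline\Omega)$ to $\partial\Omega$. Assume from now on that $\alpha>0$, $f\in L^2(\Omega)$, $g\in L^2(\partial\Omega)$, and for $v,w\in H^1(\Omega)$, with boundary values in the sense of traces, let $$a(v,w)=\int_\Omega\nabla v\cdot\nabla w+\int_\Omega c_V\,vw+\int_{\partial\Omega}\Big(\frac\kappa\alpha+\frac1{2\varepsilon}\nabla V\cdot n\Big)vw\,d\sigma,$$ $$\ell(v)=\int_\Omega f\,\frac{e^{-V/(2\varepsilon)}}{\varepsilon}\,v+\int_{\partial\Omega}\frac1\alpha e^{-V/(2\varepsilon)}g\,v\,d\sigma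 .$$ Every $z\in C^2(\Omega)\cap C^1(\overline\Omega)$ defines exactly one element of $H^1(\Omega)$. If $z$ is a classical solution of $(\ast)$, then $a(z,v)=\ell(v)$ for all $v\in H^1(\Omega)$; the converse holds for such $z$ if $f$ is continuous in $\Omega$. (3) Energy formulation. Assume in addition that for some $a_0>0$ $$c_V\ge a_0\ \text{ in }\Omega,\qquad \frac\kappa\alpha+\frac1{2\varepsilon}\nabla V\cdot n\ge 0\ \ \sigma\text{-a.e. on }\partial\Omega .$$ Then $a$ is a continuous, symmetric and coercive bilinear form on $H^1(\Omega)$, and $\ell$ is a continuous linear form. There is exactly one $z\in H^1(\Omega)$ with $a(z,v)=\ell(v)$ for all $v\in H^1(\Omega)$, and this $z$ is the unique minimizer of $v\mapsto\tfrac12a(v,v)-\ell(v)$ over $H^1(\Omega)$. In particular, a classical solution of $(\ast)$ is this unique minimizer. -/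

import Mathlib

open MeasureTheory Set
open scoped ENNReal NNReal ContDiff Gradient Laplacian InnerProductSpace

noncomputable section

namespace RobinProblem

/-- The Euclidean space `ℝ^d`. -/
abbrev Euc (d : ℕ) : Type := EuclideanSpace ℝ (Fin d)

/-! ### Domains, surface measure and outward normal -/

/-- Bounded open sets with Lipschitz boundary: near each boundary point, in the direction of some
unit vector `e`, the set is the strict epigraph of a Lipschitz function of the component of `y`
orthogonal to `e`. -/
structure IsBoundedLipschitz {d : ℕ} (Ω : Set (Euc d)) : Prop where
  isOpen : IsOpen Ω
  isBounded : Bornology.IsBounded Ω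
  locallyEpigraph : ∀ x ∈ frontier Ω, ∃ (e : Euc d) (r : ℝ) (K : ℝ≥0) (γ : Euc d → ℝ),
    ‖e‖ = 1 ∧ 0 < r ∧ LipschitzWith K γ ∧
      ∀ y ∈ Metric.ball x r, y ∈ Ω ↔ γ (y - inner ℝ e y • e) < inner ℝ e y

/-- Lebesgue measure on `Ω`. -/
def bulk {d : ℕ} (Ω : Set (Euc d)) : Measure (Euc d) := volume.restrict Ω

/-- Surface measure on `∂Ω`: the `(d-1)`-dimensional Hausdorff measure, normalized so as to agree
with Lebesgue measure on hyperplanes (counting measure if `d = 1`). -/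
def surface {d : ℕ} (Ω : Set (Euc d)) : Measure (Euc d) :=
  (Measure.euclideanHausdorffMeasure (d - 1)).restrict (frontier Ω)

/-- `ν` is the outward unit normal to `Ω` at `x`: every open cone at `x` strictly inside the half
space `⟪y - x, ν⟫ < 0` lies in `Ω` near `x`, and every open cone at `x` strictly inside
`⟪y - x, ν⟫ > 0` avoids `Ω` near `x`. There is at most one such `ν`. -/
def IsOutwardNormal {d : ℕ} (Ω : Set (Euc d)) (x ν : Euc d) : Prop :=
  ‖ν‖ = 1 ∧ ∀ δ > 0, ∃ r > 0, ∀ y ∈ Metric.ball x r,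
    (inner ℝ (y - x) ν < -δ * ‖y - x‖ → y ∈ Ω) ∧ (δ * ‖y - x‖ < inner ℝ (y - x) ν → y ∉ Ω)

open Classical in
/-- The outward unit normal `n(x)`. On a Lipschitz boundary it exists at almost every point; the
value `0` is used at the exceptional points. -/
def outwardNormal {d : ℕ} (Ω : Set (Euc d)) (x : Euc d) : Euc d :=
  if h : ∃ ν, IsOutwardNormal Ω x ν then h.choose else 0

/-- `∇w · n` on `∂Ω`, where `∇w` is the gradient taken from the closure of `Ω`. -/
def normalDeriv {d : ℕ} (Ω : Set (Euc d)) (w : Euc d → ℝ) (x : Euc d) : ℝ :=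
  fderivWithin ℝ w (closure Ω) x (outwardNormal Ω x)

/-! ### The boundary value problems -/

/-- Divergence of a vector field. -/
def divergence {d : ℕ} (X : Euc d → Euc d) (x : Euc d) : ℝ :=
  ∑ i, (fderiv ℝ X x (EuclideanSpace.single i 1)) i

/-- `C²(Ω) ∩ C¹(closure Ω)`. -/
def IsC2C1 {d : ℕ} (Ω : Set (Euc d)) (w : Euc d → ℝ) : Prop :=
  ContDiffOn ℝ 2 w Ω ∧ ContDiffOn ℝ 1 w (closure Ω)

/-- `-ε Δu + ∇·(F u) = f` at `x`. -/
def ConvDiffAt {d : ℕ} (ε : ℝ) (F : Euc d → Euc d) (f u : Euc d → ℝ) (x : Euc d) : Prop :=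
  -ε * Δ u x + divergence (fun y => u y • F y) x = f x

/-- `α ∇u·n + κ u = g` at `x`. -/
def RobinAt {d : ℕ} (Ω : Set (Euc d)) (α κ : ℝ) (g u : Euc d → ℝ) (x : Euc d) : Prop :=
  α * normalDeriv Ω u x + κ * u x = g x

/-- `ΔV / (2ε) + |∇V|² / (4ε²)`. -/
def bulkCoeff {d : ℕ} (ε : ℝ) (V : Euc d → ℝ) (x : Euc d) : ℝ :=
  Δ V x / (2 * ε) + ‖∇ V x‖ ^ 2 / (4 * ε ^ 2)

/-- `-Δz + (ΔV / (2ε) + |∇V|² / (4ε²)) z = f e^{-V/(2ε)} / ε` at `x`. -/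
def SchrodingerAt {d : ℕ} (ε : ℝ) (V f z : Euc d → ℝ) (x : Euc d) : Prop :=
  -Δ z x + bulkCoeff ε V x * z x = f x * (Real.exp (-V x / (2 * ε)) / ε)

/-- `α ∇z·n + (κ + α/(2ε) ∇V·n) z = e^{-V/(2ε)} g` at `x`. -/
def ModifiedRobinAt {d : ℕ} (Ω : Set (Euc d)) (ε : ℝ) (V : Euc d → ℝ) (α κ : ℝ)
    (g z : Euc d → ℝ) (x : Euc d) : Prop :=
  α * normalDeriv Ω z x + (κ + α / (2 * ε) * normalDeriv Ω V x) * z x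
    = Real.exp (-V x / (2 * ε)) * g x

/-- Classical solutions of the convection-diffusion Robin problem. -/
structure SolvesConvDiff {d : ℕ} (Ω : Set (Euc d)) (ε : ℝ) (F : Euc d → Euc d) (α κ : ℝ)
    (f g u : Euc d → ℝ) : Prop where
  regular : IsC2C1 Ω u
  equation : ∀ x ∈ Ω, ConvDiffAt ε F f u x
  boundary : ∀ᵐ x ∂(surface Ω), RobinAt Ω α κ g u x

/-- Classical solutions of the symmetric problem with modified Robin condition. -/
structure SolvesSchrodinger {d : ℕ} (Ω : Set (Euc d)) (ε : ℝ) (V : Euc d → ℝ) (α κ : ℝ)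
    (f g z : Euc d → ℝ) : Prop where
  regular : IsC2C1 Ω z
  equation : ∀ x ∈ Ω, SchrodingerAt ε V f z x
  boundary : ∀ᵐ x ∂(surface Ω), ModifiedRobinAt Ω ε V α κ g z x

/-! ### The Sobolev space `H¹(Ω)` and its trace operator -/

/-- `G` is the weak gradient of `v` on `Ω`. -/
def IsWeakGradient {d : ℕ} (Ω : Set (Euc d)) (v : Euc d → ℝ) (G : Euc d → Euc d) : Prop :=
  ∀ φ : Euc d → ℝ, ContDiff ℝ ∞ φ → HasCompactSupport φ → tsupport φ ⊆ Ω → ∀ i : Fin d,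
    ∫ x, v x * fderiv ℝ φ x (EuclideanSpace.single i 1) ∂(bulk Ω)
      = -∫ x, φ x * G x i ∂(bulk Ω)

/-- `L²(Ω) × L²(Ω; ℝ^d)` with its Hilbert norm. -/
abbrev L2Pairs {d : ℕ} (Ω : Set (Euc d)) : Type :=
  WithLp 2 (Lp ℝ 2 (bulk Ω) × Lp (Euc d) 2 (bulk Ω))

theorem integrable_val_mul {d : ℕ} {Ω : Set (Euc d)} (v : Lp ℝ 2 (bulk Ω)) {φ : Euc d → ℝ}
    (hφ : ContDiff ℝ ∞ φ) (hc : HasCompactSupport φ) (i : Fin d) :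
    Integrable (fun x => v x * fderiv ℝ φ x (EuclideanSpace.single i 1)) (bulk Ω) := by
  have h1 : Continuous fun x => fderiv ℝ φ x (EuclideanSpace.single i 1) :=
    (hφ.continuous_fderiv (by simp)).clm_apply continuous_const
  have h2 : HasCompactSupport fun x => fderiv ℝ φ x (EuclideanSpace.single i (1 : ℝ)) :=
    hc.fderiv_apply ℝ _
  have h3 : MemLp (fun x => fderiv ℝ φ x (EuclideanSpace.single i 1)) 2 (bulk Ω) :=
    (h1.memLp_of_hasCompactSupport h2 (μ := volume)).restrict Ω
  exact (Lp.memLp v).integrable_mul h3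

theorem integrable_mul_grad {d : ℕ} {Ω : Set (Euc d)} (G : Lp (Euc d) 2 (bulk Ω)) {φ : Euc d → ℝ}
    (hφ : ContDiff ℝ ∞ φ) (hc : HasCompactSupport φ) (i : Fin d) :
    Integrable (fun x => φ x * G x i) (bulk Ω) := by
  have h3 : MemLp φ 2 (bulk Ω) :=
    (hφ.continuous.memLp_of_hasCompactSupport hc (μ := volume)).restrict Ω
  have h4 : MemLp (fun x => G x i) 2 (bulk Ω) :=
    (EuclideanSpace.proj (𝕜 := ℝ) i).comp_memLp' (Lp.memLp G)
  exact h3.integrable_mul h4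

/-- `H¹(Ω)`, realized as the space of pairs `(v, ∇v)` in `L²(Ω) × L²(Ω; ℝ^d)` with `∇v` the weak
gradient of `v`; the norm is `‖v‖² = ‖v‖²_{L²} + ‖∇v‖²_{L²}`. -/
def H1 {d : ℕ} (Ω : Set (Euc d)) : Submodule ℝ (L2Pairs Ω) where
  carrier := {p | IsWeakGradient Ω p.fst p.snd}
  zero_mem' := by
    intro φ _ _ _ i
    have h1 : ∀ᵐ x ∂(bulk Ω), (0 : L2Pairs Ω).fst x = 0 := Lp.coeFn_zero ℝ 2 (bulk Ω)
    have h2 : ∀ᵐ x ∂(bulk Ω), (0 : L2Pairs Ω).snd x = 0 := Lp.coeFn_zero (Euc d) 2 (bulk Ω)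
    rw [integral_eq_zero_of_ae (h1.mono fun x hx => by
        show _ * _ = (0 : ℝ)
        rw [hx, zero_mul]),
      integral_eq_zero_of_ae (h2.mono fun x hx => by
        show _ * _ = (0 : ℝ)
        rw [hx]; simp), neg_zero]
  add_mem' := by
    intro p q hp hq φ h1 h2 h3 i
    have e1 : ∀ᵐ x ∂(bulk Ω), (p + q).fst x = p.fst x + q.fst x := Lp.coeFn_add p.fst q.fst
    have e2 : ∀ᵐ x ∂(bulk Ω), (p + q).snd x = p.snd x + q.snd x := Lp.coeFn_add p.snd q.snd
    rw [integral_congr_ae (e1.mono fun x hx => by simp only [hx, add_mul]; rfl),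
      integral_congr_ae (f := fun x => φ x * (p + q).snd x i)
        (e2.mono fun x hx => by simp only [hx, PiLp.add_apply, mul_add]; rfl),
      integral_add (integrable_val_mul _ h1 h2 i) (integrable_val_mul _ h1 h2 i),
      integral_add (integrable_mul_grad _ h1 h2 i) (integrable_mul_grad _ h1 h2 i),
      hp φ h1 h2 h3 i, hq φ h1 h2 h3 i]
    ring
  smul_mem' := by
    intro c p hp φ h1 h2 h3 i
    have e1 : ∀ᵐ x ∂(bulk Ω), (c • p).fst x = c * p.fst x := Lp.coeFn_smul c p.fst
    have e2 : ∀ᵐ x ∂(bulk Ω), (c • p).snd x = c • p.snd x := Lp.coeFn_smul c p.snd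
    rw [integral_congr_ae (e1.mono fun x hx => by simp only [hx, mul_assoc]; rfl),
      integral_congr_ae (f := fun x => φ x * (c • p).snd x i)
        (e2.mono fun x hx => by
          simp only [hx, PiLp.smul_apply, smul_eq_mul, mul_left_comm _ c]; rfl),
      integral_const_mul, integral_const_mul, hp φ h1 h2 h3 i]
    ring

/-- The underlying function of an element of `H¹(Ω)`. -/
def h1Val {d : ℕ} {Ω : Set (Euc d)} (p : H1 Ω) : Lp ℝ 2 (bulk Ω) := (p : L2Pairs Ω).fst

/-- The weak gradient of an element of `H¹(Ω)`. -/
def h1Grad {d : ℕ} {Ω : Set (Euc d)} (p : H1 Ω) : Lp (Euc d) 2 (bulk Ω) := (p : L2Pairs Ω).snd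

/-- `p ∈ H¹(Ω)` is the class of the function `w`. -/
def Represents {d : ℕ} {Ω : Set (Euc d)} (p : H1 Ω) (w : Euc d → ℝ) : Prop :=
  h1Val p =ᵐ[bulk Ω] w

/-- `T` is the trace operator of `Ω`: the bounded linear map `H¹(Ω) → L²(∂Ω)` that restricts each
function in `H¹(Ω) ∩ C(closure Ω)` to `∂Ω`. -/
def IsTraceOperator {d : ℕ} (Ω : Set (Euc d)) (T : H1 Ω →L[ℝ] Lp ℝ 2 (surface Ω)) : Prop :=
  ∀ (p : H1 Ω) (w : Euc d → ℝ), ContinuousOn w (closure Ω) → Represents p w →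
    T p =ᵐ[surface Ω] w

/-! ### The weak formulation and the energy -/

/-- `κ/α + 1/(2ε) ∇V·n`. -/
def boundaryCoeff {d : ℕ} (Ω : Set (Euc d)) (ε : ℝ) (V : Euc d → ℝ) (α κ : ℝ) (x : Euc d) : ℝ :=
  κ / α + 1 / (2 * ε) * normalDeriv Ω V x

/-- The bilinear form `a(p, q)`; boundary values are taken through the trace `T`. -/
def bilin {d : ℕ} {Ω : Set (Euc d)} (T : H1 Ω →L[ℝ] Lp ℝ 2 (surface Ω)) (ε : ℝ) (V : Euc d → ℝ)
    (α κ : ℝ) (p q : H1 Ω) : ℝ :=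
  (∫ x, inner ℝ (h1Grad p x) (h1Grad q x) ∂(bulk Ω))
    + (∫ x, bulkCoeff ε V x * h1Val p x * h1Val q x ∂(bulk Ω))
    + ∫ x, boundaryCoeff Ω ε V α κ x * T p x * T q x ∂(surface Ω)

/-- The linear form `ℓ(q)`. -/
def load {d : ℕ} {Ω : Set (Euc d)} (T : H1 Ω →L[ℝ] Lp ℝ 2 (surface Ω)) (ε : ℝ) (V : Euc d → ℝ)
    (α : ℝ) (f g : Euc d → ℝ) (q : H1 Ω) : ℝ :=
  (∫ x, f x * (Real.exp (-V x / (2 * ε)) / ε) * h1Val q x ∂(bulk Ω))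
    + ∫ x, 1 / α * Real.exp (-V x / (2 * ε)) * g x * T q x ∂(surface Ω)

/-- `a(p, q) = ℓ(q)` for all `q ∈ H¹(Ω)`. -/
def IsWeakSolution {d : ℕ} {Ω : Set (Euc d)} (T : H1 Ω →L[ℝ] Lp ℝ 2 (surface Ω)) (ε : ℝ)
    (V : Euc d → ℝ) (α κ : ℝ) (f g : Euc d → ℝ) (p : H1 Ω) : Prop :=
  ∀ q : H1 Ω, bilin T ε V α κ p q = load T ε V α f g q

/-- The energy `½ a(q, q) - ℓ(q)`. -/
def energy {d : ℕ} {Ω : Set (Euc d)} (T : H1 Ω →L[ℝ] Lp ℝ 2 (surface Ω)) (ε : ℝ)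
    (V : Euc d → ℝ) (α κ : ℝ) (f g : Euc d → ℝ) (q : H1 Ω) : ℝ :=
  1 / 2 * bilin T ε V α κ q q - load T ε V α f g q

end RobinProblem

end

open RobinProblem

noncomputable section

namespace RobinProblem

open Filter Topology Module


/-! ### The area formula for maps with norm-nondecreasing derivative -/

section Area

/-! The change of variable is a computation. With $E=e^{V/(2\varepsilon)}$ and $u=Ez$, the terms in
$\nabla V\cdot\nabla z$ coming from $-\varepsilon\Delta u$ and from $\nabla\cdot(u\nabla V)$ cancel,
so the operator becomes $\varepsilon E(-\Delta z+c_Vz)$ (`convDiff_operator_eq`). The Robin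
expression likewise acquires the factor $E$ (`robinAt_iff`). Both factors are nonzero.

The analytic weight lies in the boundary integrals, which are taken against Hausdorff measure on a
merely Lipschitz boundary. An area formula and Rademacher's theorem identify this measure locally
with $\sqrt{1+|\nabla c|^2}\,dh$ on a graph (`map_graphMap`). The divergence theorem above a graph
follows by differentiating the integral of a translated function over the epigraph in two ways
(`integral_epigraph_fderiv`), and a partition of unity makes it global
(`integral_fderiv_eq_surface`).

Functions are smoothed up to the boundary by mollifiers that sample only along inward cones
(`exists_smoothing`). The same smoothing converges in $L^2$, uniformly for functions continuous on
the closure, and for vector fields with $L^2$ weak divergence it makes the divergences converge in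
$L^2$. Hence $C^1$ functions are dense in $H^1(\Omega)$. The divergence theorem applied to
$\varphi^2$ and fields transversal to the boundary bounds their boundary values, so the trace exists
by extension, and density makes it unique (`existsUnique_trace`).

For $z\in C^2(\Omega)\cap C^1(\overline\Omega)$ only $\Delta z$ is under control in $L^2$, not each
second derivative. Green's formula is therefore proved by smoothing the field $\nabla z$, whose
divergence converges as a whole, and then passing from $C^1$ test functions to $H^1$ by density
(`green`). It turns $a(z,v)-\ell(v)$ into the integral of the bulk residual plus that of the
boundary residual against $v$ (`bilin_sub_load_eq`). Both vanish for classical solutions;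
conversely, test functions supported inside recover the equation, and then arbitrary smooth ones
recover the boundary condition.

Under the positivity conditions the form is coercive on the Hilbert space $H^1(\Omega)$. Lax–Milgram
gives the unique weak solution, and completing the square makes it the unique minimizer. -/

theorem euclideanHausdorffMeasure_image_le_of_dist_le {X Y Z : Type*}
    [MetricSpace Y] [MeasurableSpace Y] [BorelSpace Y]
    [MetricSpace Z] [MeasurableSpace Z] [BorelSpace Z] (f : X → Y) (g : X → Z) (P : Set X)
    (c : ℝ≥0) (h : ∀ x ∈ P, ∀ y ∈ P, dist (f x) (f y) ≤ c * dist (g x) (g y)) (m : ℕ) :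
    (Measure.euclideanHausdorffMeasure m : Measure Y) (f '' P)
      ≤ (c : ℝ≥0∞) ^ m * (Measure.euclideanHausdorffMeasure m : Measure Z) (g '' P) := by
  rcases P.eq_empty_or_nonempty with rfl | ⟨x₀, -⟩
  · simp
  have : Nonempty X := ⟨x₀⟩
  have hinv : ∀ x ∈ P, Function.invFunOn g P (g x) ∈ P ∧ g (Function.invFunOn g P (g x)) = g x :=
    fun x hx => ⟨Function.invFunOn_mem ⟨x, hx, rfl⟩, Function.invFunOn_eq ⟨x, hx, rfl⟩⟩
  -- The distance bound makes `f` constant on the fibres of `g` in `P`, so on `P` it factors through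
  -- `g` by a `c`-Lipschitz map, whatever preimages `invFunOn` selects.
  have himg : f '' P = (f ∘ Function.invFunOn g P) '' (g '' P) := by
    rw [image_image]
    refine image_congr fun x hx => ?_
    have := h x hx _ (hinv x hx).1
    rw [(hinv x hx).2, dist_self, mul_zero] at this
    exact dist_le_zero.1 this
  have hlip : LipschitzOnWith c (f ∘ Function.invFunOn g P) (g '' P) := by
    refine LipschitzOnWith.of_dist_le_mul ?_
    rintro _ ⟨x, hx, rfl⟩ _ ⟨y, hy, rfl⟩
    refine (h _ (hinv x hx).1 _ (hinv y hy).1).trans_eq ?_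
    rw [(hinv x hx).2, (hinv y hy).2]
  rw [himg]
  simp only [Measure.euclideanHausdorffMeasure_def, Measure.smul_apply, Measure.nnreal_smul_coe_apply]
  have := hlip.hausdorffMeasure_image_le (d := (m : ℝ)) (by positivity)
  rw [ENNReal.rpow_natCast] at this
  exact (mul_le_mul_right this _).trans_eq (by ring)

variable {U V : Type*} [NormedAddCommGroup U] [InnerProductSpace ℝ U] [FiniteDimensional ℝ U]
  [MeasurableSpace U] [BorelSpace U] [NormedAddCommGroup V] [InnerProductSpace ℝ V]
  [MeasurableSpace V] [BorelSpace V]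

/-- Because `L` never shrinks a vector, the error `δ‖x - y‖` is at most `δ‖L (x - y)‖`. Hence
distances under `f` and under `L` agree up to the factor `c` in both directions, and the measure of
the image under `L` is known exactly. -/
theorem area_bounds_of_approximatesLinearOn {f : U → V} {L : U →L[ℝ] V} (hL : ∀ v, ‖v‖ ≤ ‖L v‖)
    {P : Set U} {c δ : ℝ≥0} (hδ : δ ≤ 1) (h1 : 1 + δ ≤ c) (h2 : 1 ≤ c * (1 - δ))
    (hf : ApproximatesLinearOn f L P δ) :
    (Measure.euclideanHausdorffMeasure (finrank ℝ U) : Measure V) (f '' P)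
      ≤ (c : ℝ≥0∞) ^ finrank ℝ U * (ENNReal.ofReal (L : U →ₗ[ℝ] V).normDet * volume P) ∧
    ENNReal.ofReal (L : U →ₗ[ℝ] V).normDet * volume P ≤ (c : ℝ≥0∞) ^ finrank ℝ U *
      (Measure.euclideanHausdorffMeasure (finrank ℝ U) : Measure V) (f '' P) := by
  rw [← LinearMap.euclideanHausdorffMeasure_image_eq_normDet_mul_volume]
  have key : ∀ x ∈ P, ∀ y ∈ P, ‖f x - f y - L (x - y)‖ ≤ δ * ‖L (x - y)‖ := fun x hx y hy =>
    (hf x hx y hy).trans (by gcongr; exact hL _)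
  have h1' : (1 : ℝ) + δ ≤ c := by exact_mod_cast h1
  have h2' : (1 : ℝ) ≤ c * (1 - δ) := by
    have := NNReal.coe_le_coe.2 h2
    rwa [NNReal.coe_mul, NNReal.coe_sub hδ, NNReal.coe_one] at this
  refine ⟨euclideanHausdorffMeasure_image_le_of_dist_le f L P c ?_ _,
    euclideanHausdorffMeasure_image_le_of_dist_le L f P c ?_ _⟩
  · intro x hx y hy
    rw [dist_eq_norm, dist_eq_norm, ← map_sub]
    have a := key x hx y hy
    have b := norm_le_norm_add_norm_sub' (f x - f y) (L (x - y))
    nlinarith [norm_nonneg (L (x - y))]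
  · intro x hx y hy
    rw [dist_eq_norm, dist_eq_norm, ← map_sub]
    have a := key x hx y hy
    have b := norm_le_norm_add_norm_sub (f x - f y) (L (x - y))
    have h3 : (1 - δ) * ‖L (x - y)‖ ≤ ‖f x - f y‖ := by linarith
    have h4 : (c : ℝ) * ((1 - δ) * ‖L (x - y)‖) ≤ c * ‖f x - f y‖ := by gcongr
    nlinarith [norm_nonneg (L (x - y))]

theorem ENNReal_le_of_forall_le_pow_mul {X Y : ℝ≥0∞} (n : ℕ)
    (h : ∀ c : ℝ≥0, 1 < c → X ≤ (c : ℝ≥0∞) ^ n * Y) : X ≤ Y := by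
  have h1 : Tendsto (fun c : ℝ≥0 => (c : ℝ≥0∞) ^ n * Y) (𝓝[>] 1) (𝓝 ((1 : ℝ≥0) ^ n * Y)) := by
    refine ENNReal.Tendsto.mul_const ?_ (Or.inl (by simp))
    exact (((ENNReal.continuous_pow n).comp ENNReal.continuous_coe).tendsto 1).mono_left
      nhdsWithin_le_nhds
  have : X ≤ ((1 : ℝ≥0) : ℝ≥0∞) ^ n * Y :=
    ge_of_tendsto h1 (eventually_mem_nhdsWithin.mono fun c hc => h c hc)
  simpa using this

/-- Cut `A` into layers on which `J` varies by at most a factor `c`, then into pieces on which `f`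
is nearly linear. On each piece both sides agree up to `c ^ (n + 1)`, with `n` factors from the
distances and one from `J`. Injectivity keeps the images disjoint, so the bounds add up; finally `c`
tends to 1. -/
theorem euclideanHausdorffMeasure_image_eq_lintegral [FiniteDimensional ℝ V] {f : U → V} {f' : U → U →L[ℝ] V}
    {A : Set U} (hA : MeasurableSet A) (hf : ∀ x ∈ A, HasFDerivWithinAt f (f' x) A x)
    (hinj : InjOn f A) (hexp : ∀ x ∈ A, ∀ v, ‖v‖ ≤ ‖f' x v‖) {J : U → ℝ} (hJm : Measurable J)
    (hJ1 : ∀ x, 1 ≤ J x) (hJ : ∀ x ∈ A, (f' x : U →ₗ[ℝ] V).normDet = J x) :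
    (Measure.euclideanHausdorffMeasure (finrank ℝ U) : Measure V) (f '' A)
      = ∫⁻ x in A, ENNReal.ofReal (J x) := by
  set μ := (Measure.euclideanHausdorffMeasure (finrank ℝ U) : Measure V) with hμ
  -- for each `c > 1` a countable partition on which both sides agree up to a power of `c`
  have main : ∀ c : ℝ≥0, 1 < c →
      μ (f '' A) ≤ (c : ℝ≥0∞) ^ (finrank ℝ U + 1) * ∫⁻ x in A, ENNReal.ofReal (J x) ∧
      ∫⁻ x in A, ENNReal.ofReal (J x) ≤ (c : ℝ≥0∞) ^ (finrank ℝ U + 1) * μ (f '' A) := by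
    intro c hc
    have hc' : (1 : ℝ) < c := by exact_mod_cast hc
    -- The choice `δ = (c - 1) / c` gives `c (1 - δ) = 1` exactly, and `1 + δ = 2 - 1/c ≤ c` is `(c
    -- - 1)² ≥ 0`.
    obtain ⟨δ, hδ0, hδ1, h1, h2⟩ : ∃ δ : ℝ≥0, δ ≠ 0 ∧ δ ≤ 1 ∧ 1 + δ ≤ c ∧ 1 ≤ c * (1 - δ) := by
      have hlt : ((c : ℝ) - 1) / c ≤ 1 := by rw [div_le_one (by positivity)]; linarith
      have hpos : 0 < ((c : ℝ) - 1) / c := div_pos (by linarith) (by positivity)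
      obtain ⟨δ, hδ⟩ : ∃ δ : ℝ≥0, (δ : ℝ) = (c - 1) / c := CanLift.prf _ hpos.le
      have hle : δ ≤ 1 := by rw [← NNReal.coe_le_coe, hδ]; exact hlt
      refine ⟨δ, ?_, hle, ?_, ?_⟩
      · rw [← NNReal.coe_ne_zero, hδ]; exact hpos.ne'
      · rw [← NNReal.coe_le_coe, NNReal.coe_add, hδ, NNReal.coe_one,
          show (1 : ℝ) + (c - 1) / c = (2 * c - 1) / c by field_simp; ring,
          div_le_iff₀ (by positivity)]
        nlinarith
      · rw [← NNReal.coe_le_coe, NNReal.coe_mul, NNReal.coe_sub hle, hδ, NNReal.coe_one]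
        apply le_of_eq
        field_simp
        ring
    -- Nonnegative exponents exhaust `A` because `J ≥ 1`.
    let s : ℕ → Set U := fun k => A ∩ {x | (c : ℝ) ^ k ≤ J x ∧ J x < (c : ℝ) ^ (k + 1)}
    have hsm : ∀ k, MeasurableSet (s k) := fun k =>
      hA.inter ((measurableSet_le measurable_const hJm).inter
        (measurableSet_lt hJm measurable_const))
    have hsd : Pairwise (Function.onFun Disjoint s) := by
      intro i j hij
      rw [Function.onFun, Set.disjoint_left]
      rintro x ⟨-, h3, h4⟩ ⟨-, h5, h6⟩
      have a := (pow_lt_pow_iff_right₀ hc').1 (h3.trans_lt h6)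
      have b := (pow_lt_pow_iff_right₀ hc').1 (h5.trans_lt h4)
      omega
    have hsA : A = ⋃ k, s k := by
      ext x
      simp only [s, mem_iUnion, mem_inter_iff, exists_and_left, iff_self_and]
      intro _
      exact exists_nat_pow_near (hJ1 x) hc'
    -- the claim on each layer
    have layer : ∀ k, μ (f '' s k)
          ≤ (c : ℝ≥0∞) ^ (finrank ℝ U + 1) * ∫⁻ x in s k, ENNReal.ofReal (J x) ∧
        ∫⁻ x in s k, ENNReal.ofReal (J x) ≤ (c : ℝ≥0∞) ^ (finrank ℝ U + 1) * μ (f '' s k) := by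
      intro k
      obtain ⟨t, L, htd, htm, hst, happ, hL⟩ :=
        exists_partition_approximatesLinearOn_of_hasFDerivWithinAt f (s k) f'
          (fun x hx => (hf x hx.1).mono inter_subset_left) (fun _ => δ) (fun _ => hδ0)
      rcases (s k).eq_empty_or_nonempty with he | hne
      · simp [he]
      have hd : Pairwise (Function.onFun Disjoint fun n => s k ∩ t n) := fun i j hij =>
        (htd hij).mono inter_subset_right inter_subset_right
      have hU : s k = ⋃ n, s k ∩ t n := by
        rw [← inter_iUnion, inter_eq_left.2 hst]
      have hmeas : ∀ n, MeasurableSet (s k ∩ t n) := fun n => (hsm k).inter (htm n)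
      have hcont : ContinuousOn f A := fun x hx => (hf x hx).continuousWithinAt
      have e1 : μ (f '' s k) = ∑' n, μ (f '' (s k ∩ t n)) := by
        conv_lhs => rw [hU, image_iUnion]
        refine measure_iUnion (fun i j hij => ?_) fun n => ?_
        · rw [Function.onFun, Set.disjoint_left]
          rintro _ ⟨x, hx, rfl⟩ ⟨y, hy, hxy⟩
          have := hinj hy.1.1 hx.1.1 hxy
          subst this
          exact Set.disjoint_left.1 (hd hij) hx hy
        · exact (hmeas n).image_of_continuousOn_injOn
            (hcont.mono (inter_subset_left.trans inter_subset_left))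
            (hinj.mono (inter_subset_left.trans inter_subset_left))
      have e2 : ∫⁻ x in s k, ENNReal.ofReal (J x) = ∑' n, ∫⁻ x in s k ∩ t n, ENNReal.ofReal (J x) := by
        conv_lhs => rw [hU]
        exact lintegral_iUnion hmeas hd _
      have piece : ∀ n, μ (f '' (s k ∩ t n))
            ≤ (c : ℝ≥0∞) ^ (finrank ℝ U + 1) * ∫⁻ x in s k ∩ t n, ENNReal.ofReal (J x) ∧
          ∫⁻ x in s k ∩ t n, ENNReal.ofReal (J x)
            ≤ (c : ℝ≥0∞) ^ (finrank ℝ U + 1) * μ (f '' (s k ∩ t n)) := by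
        intro n
        obtain ⟨y, hy, hLy⟩ := hL hne n
        have hLe : ∀ v, ‖v‖ ≤ ‖L n v‖ := by rw [hLy]; exact hexp y hy.1
        obtain ⟨b1, b2⟩ := area_bounds_of_approximatesLinearOn hLe hδ1 h1 h2 (happ n)
        have hdet : (L n : U →ₗ[ℝ] V).normDet = J y := by rw [hLy, hJ y hy.1]
        rw [hdet] at b1 b2
        -- The base point `y` of the linear approximation need not lie in `t n`. That it lies in the
        -- same layer suffices to compare the Jacobians.
        have hle : ∀ x ∈ s k ∩ t n, J y ≤ c * J x ∧ J x ≤ c * J y := by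
          rintro x ⟨⟨-, h3, h4⟩, -⟩
          obtain ⟨-, h5, h6⟩ := hy
          have hc0 : (0 : ℝ) < c := by linarith
          constructor
          · calc J y ≤ c ^ (k + 1) := h6.le
              _ = c * c ^ k := pow_succ' _ _
              _ ≤ _ := by gcongr
          · calc J x ≤ c ^ (k + 1) := h4.le
              _ = c * c ^ k := pow_succ' _ _
              _ ≤ _ := by gcongr
        have ofle : ∀ a b : ℝ, a ≤ c * b → ENNReal.ofReal a ≤ c * ENNReal.ofReal b := by
          intro a b hab
          refine (ENNReal.ofReal_le_ofReal hab).trans_eq ?_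
          rw [ENNReal.ofReal_mul c.coe_nonneg, ENNReal.ofReal_coe_nnreal]
        have i1 : ENNReal.ofReal (J y) * volume (s k ∩ t n)
            ≤ c * ∫⁻ x in s k ∩ t n, ENNReal.ofReal (J x) := by
          rw [← lintegral_const_mul _ hJm.ennreal_ofReal, ← setLIntegral_const]
          exact setLIntegral_mono' (hmeas n) fun x hx => ofle _ _ (hle x hx).1
        have i2 : ∫⁻ x in s k ∩ t n, ENNReal.ofReal (J x)
            ≤ c * (ENNReal.ofReal (J y) * volume (s k ∩ t n)) := by
          rw [← mul_assoc, ← setLIntegral_const]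
          exact setLIntegral_mono' (hmeas n) fun x hx => ofle _ _ (hle x hx).2
        constructor
        · calc _ ≤ _ := b1
            _ ≤ (c : ℝ≥0∞) ^ finrank ℝ U * (c * ∫⁻ x in s k ∩ t n, ENNReal.ofReal (J x)) := by
              gcongr
            _ = _ := by rw [pow_succ, mul_assoc]
        · calc _ ≤ _ := i2
            _ ≤ c * ((c : ℝ≥0∞) ^ finrank ℝ U * μ (f '' (s k ∩ t n))) := by gcongr
            _ = _ := by rw [pow_succ']; ring
      rw [e1, e2, ← ENNReal.tsum_mul_left, ← ENNReal.tsum_mul_left]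
      exact ⟨ENNReal.tsum_le_tsum fun n => (piece n).1, ENNReal.tsum_le_tsum fun n => (piece n).2⟩
    have hcont : ContinuousOn f A := fun x hx => (hf x hx).continuousWithinAt
    have e1 : μ (f '' A) = ∑' n, μ (f '' (s n)) := by
      conv_lhs => rw [hsA, image_iUnion]
      refine measure_iUnion (fun i j hij => ?_) fun n => ?_
      · rw [Function.onFun, Set.disjoint_left]
        rintro _ ⟨x, hx, rfl⟩ ⟨y, hy, hxy⟩
        have := hinj hy.1 hx.1 hxy
        subst this
        exact Set.disjoint_left.1 (hsd hij) hx hy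
      · exact (hsm n).image_of_continuousOn_injOn (hcont.mono inter_subset_left)
          (hinj.mono inter_subset_left)
    have e2 : ∫⁻ x in A, ENNReal.ofReal (J x) = ∑' n, ∫⁻ x in s n, ENNReal.ofReal (J x) := by
      conv_lhs => rw [hsA]
      exact lintegral_iUnion hsm hsd _
    rw [e1, e2, ← ENNReal.tsum_mul_left, ← ENNReal.tsum_mul_left]
    exact ⟨ENNReal.tsum_le_tsum fun n => (layer n).1, ENNReal.tsum_le_tsum fun n => (layer n).2⟩
  exact le_antisymm (ENNReal_le_of_forall_le_pow_mul _ fun c hc => (main c hc).1)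
    (ENNReal_le_of_forall_le_pow_mul _ fun c hc => (main c hc).2)

end Area


/-! ### Hyperplane coordinates and Lipschitz graphs -/

section Graph

variable {V : Type*} [NormedAddCommGroup V] [InnerProductSpace ℝ V]

theorem sub_inner_smul_mem {e : V} (he : ‖e‖ = 1) (y : V) : y - inner ℝ e y • e ∈ (ℝ ∙ e)ᗮ := by
  rw [Submodule.mem_orthogonal_singleton_iff_inner_right, inner_sub_right, inner_smul_right,
    real_inner_self_eq_norm_sq, he]
  ring

theorem inner_coe_hyperplane {e : V} (h : (ℝ ∙ e)ᗮ) : inner ℝ e (h : V) = 0 :=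
  Submodule.mem_orthogonal_singleton_iff_inner_right.1 h.2

/-- The splitting of `y` into its component in the hyperplane orthogonal to the unit vector `e` and
its coordinate along `e`. -/
def hyperCoord (e : V) (he : ‖e‖ = 1) : V ≃L[ℝ] (ℝ ∙ e)ᗮ × ℝ where
  toFun y := (⟨y - inner ℝ e y • e, sub_inner_smul_mem he y⟩, inner ℝ e y)
  invFun q := (q.1 : V) + q.2 • e
  map_add' x y := by
    ext
    · simp only [inner_add_right, Prod.fst_add, Submodule.coe_add]; module
    · simp [inner_add_right]
  map_smul' c x := by
    ext
    · simp only [inner_smul_right, Prod.smul_fst, Submodule.coe_smul, RingHom.id_apply]; module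
    · simp [inner_smul_right]
  left_inv y := by simp
  right_inv q := by
    have h1 : inner ℝ e ((q.1 : V) + q.2 • e) = q.2 := by
      rw [inner_add_right, inner_coe_hyperplane, inner_smul_right, real_inner_self_eq_norm_sq, he]
      ring
    ext
    · simp [h1]
    · simp [h1]
  continuous_toFun := by
    refine Continuous.prodMk ?_ (by fun_prop)
    exact Continuous.subtype_mk (by fun_prop) _
  continuous_invFun := by fun_prop

@[simp]
theorem hyperCoord_fst {e : V} (he : ‖e‖ = 1) (y : V) :
    ((hyperCoord e he y).1 : V) = y - inner ℝ e y • e := rfl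

@[simp]
theorem hyperCoord_snd {e : V} (he : ‖e‖ = 1) (y : V) : (hyperCoord e he y).2 = inner ℝ e y := rfl

theorem hyperCoord_symm_apply {e : V} (he : ‖e‖ = 1) (q : (ℝ ∙ e)ᗮ × ℝ) :
    (hyperCoord e he).symm q = (q.1 : V) + q.2 • e := rfl

/-- The graph of `c` over the hyperplane orthogonal to `e`. -/
def graphMap (e : V) (c : (ℝ ∙ e)ᗮ → ℝ) (h : (ℝ ∙ e)ᗮ) : V := (h : V) + c h • e

theorem hyperCoord_graphMap {e : V} (he : ‖e‖ = 1) (c : (ℝ ∙ e)ᗮ → ℝ) (h : (ℝ ∙ e)ᗮ) :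
    hyperCoord e he (graphMap e c h) = (h, c h) :=
  (hyperCoord e he).apply_symm_apply (h, c h)

theorem mem_range_graphMap {e : V} (he : ‖e‖ = 1) (c : (ℝ ∙ e)ᗮ → ℝ) (y : V) :
    y ∈ range (graphMap e c) ↔ c (hyperCoord e he y).1 = inner ℝ e y := by
  constructor
  · rintro ⟨h, rfl⟩
    rw [← hyperCoord_snd he, hyperCoord_graphMap he]
  · intro h
    refine ⟨(hyperCoord e he y).1, ?_⟩
    rw [graphMap, h]
    simp

/-- The surface element of the graph of `c`. -/
def graphJac {e : V} (c : (ℝ ∙ e)ᗮ → ℝ) (h : (ℝ ∙ e)ᗮ) : ℝ := √(1 + ‖fderiv ℝ c h‖ ^ 2)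

theorem one_le_graphJac {e : V} (c : (ℝ ∙ e)ᗮ → ℝ) (h : (ℝ ∙ e)ᗮ) : 1 ≤ graphJac c h := by
  rw [graphJac, Real.one_le_sqrt]
  nlinarith [sq_nonneg ‖fderiv ℝ c h‖]

theorem graphJac_le {e : V} {c : (ℝ ∙ e)ᗮ → ℝ} {K : ℝ≥0} (hc : LipschitzWith K c) (h : (ℝ ∙ e)ᗮ) :
    graphJac c h ≤ √(1 + K ^ 2) := by
  rw [graphJac]
  gcongr
  exact norm_fderiv_le_of_lipschitz ℝ hc

theorem continuous_graphMap {e : V} {c : (ℝ ∙ e)ᗮ → ℝ} (hc : Continuous c) :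
    Continuous (graphMap e c) := by unfold graphMap; fun_prop

theorem graphMap_injective {e : V} (he : ‖e‖ = 1) (c : (ℝ ∙ e)ᗮ → ℝ) :
    Function.Injective (graphMap e c) := fun x y hxy => by
  have := congrArg (hyperCoord e he) hxy
  rw [hyperCoord_graphMap, hyperCoord_graphMap] at this
  exact congrArg Prod.fst this

/-- In an orthonormal basis of the hyperplane the Gram matrix is the identity plus the rank-one
matrix $pp^{T}$, whose determinant is $1+|p|^2$ by the matrix determinant lemma. -/
theorem normDet_graph [FiniteDimensional ℝ V] {e : V} (he : ‖e‖ = 1) (p : (ℝ ∙ e)ᗮ →L[ℝ] ℝ) :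
    (((ℝ ∙ e)ᗮ.subtypeL + p.smulRight e : (ℝ ∙ e)ᗮ →L[ℝ] V) :
      (ℝ ∙ e)ᗮ →ₗ[ℝ] V).normDet = √(1 + ‖p‖ ^ 2) := by
  let b := stdOrthonormalBasis ℝ (ℝ ∙ e)ᗮ
  have h := LinearMap.normDet_sq_eq_det_gram
    (((ℝ ∙ e)ᗮ.subtypeL + p.smulRight e : (ℝ ∙ e)ᗮ →L[ℝ] V) : (ℝ ∙ e)ᗮ →ₗ[ℝ] V) b
  have hg : Matrix.gram ℝ (fun i => (((ℝ ∙ e)ᗮ.subtypeL + p.smulRight e : (ℝ ∙ e)ᗮ →L[ℝ] V) :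
      (ℝ ∙ e)ᗮ →ₗ[ℝ] V) (b i)) = 1 + Matrix.replicateCol Unit (fun i => p (b i)) *
        Matrix.replicateRow Unit (fun i => p (b i)) := by
    ext i j
    have hb : inner ℝ ((b i : (ℝ ∙ e)ᗮ) : V) (b j : V) = (1 : Matrix _ _ ℝ) i j := by
      rw [← Submodule.coe_inner, OrthonormalBasis.inner_eq_ite, Matrix.one_apply]
    have h1 : inner ℝ ((b i : (ℝ ∙ e)ᗮ) : V) e = 0 := by
      rw [real_inner_comm, inner_coe_hyperplane]
    simp [inner_add_left, inner_add_right, inner_smul_left, inner_smul_right, hb, h1,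
      inner_coe_hyperplane, he, Matrix.mul_apply, mul_comm]
  rw [hg, Matrix.det_one_add_replicateCol_mul_replicateRow] at h
  have hp : (fun i => p (b i)) ⬝ᵥ (fun i => p (b i)) = ‖p‖ ^ 2 := by
    have h5 : ‖p‖ = ‖(InnerProductSpace.toDual ℝ _).symm p‖ := by simp
    rw [h5, ← b.sum_sq_norm_inner_right, dotProduct]
    refine Finset.sum_congr rfl fun i _ => ?_
    rw [real_inner_comm, InnerProductSpace.toDual_symm_apply, Real.norm_eq_abs, sq_abs, sq]
  rw [hp] at h
  rw [← h]
  simp only [RCLike.ofReal_real_eq_id, id_eq]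
  rw [Real.sqrt_sq (LinearMap.normDet_nonneg _)]

variable [MeasurableSpace V] [BorelSpace V]

theorem measurable_graphJac {e : V} (c : (ℝ ∙ e)ᗮ → ℝ) : Measurable (graphJac c) :=
  (((measurable_fderiv ℝ c).norm.pow_const 2).const_add 1).sqrt

variable [FiniteDimensional ℝ V]

/-- This is the orthogonal splitting along the line spanned by `e` and its complement, followed by
the isometry of that line with `ℝ` and an exchange of the factors. -/
theorem measurePreserving_hyperCoord {e : V} (he : ‖e‖ = 1) :
    MeasurePreserving (hyperCoord e he) := by
  have h1 := (ℝ ∙ e).measurePreserving_measurableEquivProd (0 : V)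
  rw [InnerProductSpace.euclideanHausdorffMeasure_eq_volume] at h1
  have h2 : MeasurePreserving (LinearIsometryEquiv.toSpanUnitSingleton (𝕜 := ℝ) e he).symm :=
    LinearIsometryEquiv.measurePreserving _
  have h3 : MeasurePreserving (Prod.map (LinearIsometryEquiv.toSpanUnitSingleton (𝕜 := ℝ) e he).symm
      (id : (ℝ ∙ e)ᗮ → (ℝ ∙ e)ᗮ)) := h2.prod (MeasurePreserving.id _)
  have h4 := (Measure.measurePreserving_swap (μ := (volume : Measure ℝ))
    (ν := (volume : Measure (ℝ ∙ e)ᗮ))).comp (h3.comp h1)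
  convert! h4 using 1
  funext y
  have hp : (ℝ ∙ e).orthogonalProjectionOnto y
      = LinearIsometryEquiv.toSpanUnitSingleton (𝕜 := ℝ) e he (inner ℝ e y) := by
    ext
    rw [Submodule.coe_orthogonalProjectionOnto_apply, Submodule.starProjection_unit_singleton ℝ he,
      LinearIsometryEquiv.toSpanUnitSingleton_apply]
  ext
  · simp only [hyperCoord_fst, Function.comp_apply, Submodule.measurableEquivProd_apply,
      vsub_eq_sub, sub_zero, Prod.map_apply, Prod.fst_swap, id_eq]
    rw [Submodule.coe_orthogonalProjectionOnto_apply, Submodule.starProjection_orthogonal_val,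
      Submodule.starProjection_unit_singleton ℝ he]
  · simp only [hyperCoord_snd, Function.comp_apply, Submodule.measurableEquivProd_apply,
      vsub_eq_sub, sub_zero, Prod.map_apply, Prod.snd_swap]
    rw [hp, LinearIsometryEquiv.symm_apply_apply]

theorem measurableEmbedding_graphMap {e : V} (he : ‖e‖ = 1) {c : (ℝ ∙ e)ᗮ → ℝ} (hc : Continuous c) :
    MeasurableEmbedding (graphMap e c) :=
  (continuous_graphMap hc).measurableEmbedding (graphMap_injective he c)

/-- The area formula applies on the set where `c` is differentiable. By Rademacher's theorem the
rest is null, and its image under the Lipschitz graph map is null for the surface measure. -/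
theorem map_graphMap {e : V} (he : ‖e‖ = 1) {c : (ℝ ∙ e)ᗮ → ℝ} {K : ℝ≥0} (hc : LipschitzWith K c)
    {m : ℕ} (hm : finrank ℝ (ℝ ∙ e)ᗮ = m) :
    (volume.withDensity fun h => ENNReal.ofReal (graphJac c h)).map (graphMap e c)
      = (Measure.euclideanHausdorffMeasure m).restrict (range (graphMap e c)) := by
  have hemb := measurableEmbedding_graphMap he hc.continuous
  have hnull : volume {h | DifferentiableAt ℝ c h}ᶜ = 0 := hc.ae_differentiableAt
  have hlip : LipschitzWith (1 + K * ‖e‖₊) (graphMap e c) := by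
    refine LipschitzWith.add ?_ ?_
    · exact LipschitzWith.subtype_val _
    · refine LipschitzWith.of_dist_le_mul fun x y => ?_
      rw [dist_eq_norm, ← sub_smul, norm_smul, NNReal.coe_mul, coe_nnnorm, ← dist_eq_norm]
      nlinarith [hc.dist_le_mul x y, norm_nonneg e]
  ext A hA
  rw [hemb.map_apply, Measure.restrict_apply hA]
  set B := graphMap e c ⁻¹' A with hB
  have hBm : MeasurableSet B := hemb.measurable hA
  have hAB : A ∩ range (graphMap e c) = graphMap e c '' B := by rw [image_preimage_eq_inter_range]
  set D := {h | DifferentiableAt ℝ c h} with hD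
  have hDm : MeasurableSet D := measurableSet_of_differentiableAt ℝ c
  have hsplit : graphMap e c '' B = graphMap e c '' (B ∩ D) ∪ graphMap e c '' (B ∩ Dᶜ) := by
    rw [← image_union, ← inter_union_distrib_left, union_compl_self, inter_univ]
  have hz : (Measure.euclideanHausdorffMeasure m : Measure V) (graphMap e c '' (B ∩ Dᶜ)) = 0 := by
    refine le_antisymm ((euclideanHausdorffMeasure_image_le_of_dist_le (graphMap e c) id _
      (1 + K * ‖e‖₊) (fun x _ y _ => hlip.dist_le_mul x y) m).trans ?_) bot_le
    rw [image_id, ← hm, InnerProductSpace.euclideanHausdorffMeasure_eq_volume,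
      measure_mono_null inter_subset_right hnull, mul_zero]
  have hBD : (Measure.euclideanHausdorffMeasure m : Measure V) (graphMap e c '' (B ∩ D))
      = ∫⁻ h in B ∩ D, ENNReal.ofReal (graphJac c h) := by
    rw [← hm]
    refine euclideanHausdorffMeasure_image_eq_lintegral
      (f' := fun h => (ℝ ∙ e)ᗮ.subtypeL + (fderiv ℝ c h).smulRight e) (hBm.inter hDm) ?_
      (graphMap_injective he c).injOn ?_ (measurable_graphJac c) (one_le_graphJac c) ?_
    · intro h hh
      have h1 : HasFDerivAt c (fderiv ℝ c h) h := hh.2.hasFDerivAt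
      exact ((ℝ ∙ e)ᗮ.subtypeL.hasFDerivAt.add (h1.smul_const e)).hasFDerivWithinAt
    · intro h _ v
      have h1 : ‖(v : V) + fderiv ℝ c h v • e‖ ^ 2 = ‖v‖ ^ 2 + (fderiv ℝ c h v) ^ 2 := by
        rw [norm_add_sq_real, inner_smul_right, real_inner_comm, inner_coe_hyperplane, norm_smul,
          he, Real.norm_eq_abs, mul_one, sq_abs]
        simp
      show ‖v‖ ≤ ‖(v : V) + fderiv ℝ c h v • e‖
      nlinarith [norm_nonneg v, norm_nonneg ((v : V) + fderiv ℝ c h v • e),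
        sq_nonneg (fderiv ℝ c h v)]
    · intro h _
      exact normDet_graph he _
  rw [hAB, withDensity_apply _ hBm, hsplit]
  refine le_antisymm ?_ ?_
  · refine le_trans ?_ (measure_mono subset_union_left)
    rw [hBD]
    refine le_of_eq (setLIntegral_congr ?_)
    rw [← sdiff_compl]
    exact (sdiff_null_ae_eq_self hnull).symm
  · refine (measure_union_le _ _).trans ?_
    rw [hz, add_zero, hBD]
    exact lintegral_mono_set inter_subset_left

end Graph


/-! ### The divergence theorem above a Lipschitz graph -/

section Epigraph

variable {V : Type*} [NormedAddCommGroup V] [InnerProductSpace ℝ V]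

/-- The strict epigraph of `c` in the direction `e`. -/
def epigraph (e : V) (he : ‖e‖ = 1) (c : (ℝ ∙ e)ᗮ → ℝ) : Set V :=
  {y | c (hyperCoord e he y).1 < inner ℝ e y}

theorem isOpen_epigraph {e : V} (he : ‖e‖ = 1) {c : (ℝ ∙ e)ᗮ → ℝ} (hc : Continuous c) :
    IsOpen (epigraph e he c) :=
  isOpen_lt (hc.comp ((hyperCoord e he).continuous.fst)) (by fun_prop)

variable [FiniteDimensional ℝ V] [MeasurableSpace V] [BorelSpace V]

/-- Differentiation under the integral, with a Lipschitz bound on the bounded set met by the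
supports of translates with `|τ| < 1`. No regularity of `S` enters, since the translation acts on
the function and not on the set. -/
theorem hasDerivAt_integral_translate {φ : V → ℝ} (hφ : ContDiff ℝ 1 φ) (hs : HasCompactSupport φ)
    (v : V) (S : Set V) :
    HasDerivAt (fun τ : ℝ => ∫ y in S, φ (y + τ • v)) (∫ y in S, fderiv ℝ φ y v) 0 := by
  obtain ⟨C, hC⟩ := hφ.lipschitzWith_of_hasCompactSupport hs one_ne_zero
  obtain ⟨R, hR⟩ := hs.isCompact.isBounded.subset_closedBall (0 : V)
  have hzero : ∀ y, R + ‖v‖ < ‖y‖ → ∀ τ ∈ Metric.ball (0 : ℝ) 1, φ (y + τ • v) = 0 := by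
    intro y hy τ hτ
    by_contra h
    have h1 := hR (subset_tsupport φ h)
    rw [mem_closedBall_zero_iff] at h1
    have h2 : ‖τ • v‖ ≤ ‖v‖ := by
      rw [norm_smul]
      have : ‖τ‖ < 1 := by simpa using hτ
      nlinarith [norm_nonneg v]
    have h3 := norm_sub_le (y + τ • v) (τ • v)
    rw [add_sub_cancel_right] at h3
    linarith
  refine (hasDerivAt_integral_of_dominated_loc_of_lip
    (F := fun τ y => φ (y + τ • v)) (s := Metric.ball 0 1)
    (bound := (Metric.closedBall (0 : V) (R + ‖v‖)).indicator fun _ => C * ‖v‖)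
    (Metric.ball_mem_nhds _ one_pos) (Eventually.of_forall fun τ => ?_) ?_ ?_ ?_ ?_ ?_).2
  · exact (hφ.continuous.comp (by fun_prop)).aestronglyMeasurable
  · simp only [zero_smul, add_zero]
    exact (hφ.continuous.integrable_of_hasCompactSupport hs).integrableOn
  · exact ((hφ.continuous_fderiv one_ne_zero).clm_apply continuous_const).aestronglyMeasurable
  · refine Eventually.of_forall fun y => ?_
    by_cases hy : y ∈ Metric.closedBall (0 : V) (R + ‖v‖)
    · rw [indicator_of_mem hy]
      refine LipschitzOnWith.of_dist_le_mul fun a _ b _ => (hC.dist_le_mul _ _).trans_eq ?_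
      rw [dist_add_left, dist_eq_norm, ← sub_smul, norm_smul, Real.coe_nnabs,
        abs_of_nonneg (by positivity), dist_eq_norm]
      ring
    · rw [indicator_of_notMem hy]
      rw [mem_closedBall_zero_iff, not_le] at hy
      refine LipschitzOnWith.of_dist_le_mul fun a ha b hb => ?_
      simp only [hzero y hy a ha, hzero y hy b hb, dist_self]
      positivity
  · refine Integrable.integrableOn ?_
    rw [integrable_indicator_iff measurableSet_closedBall]
    exact integrableOn_const (measure_closedBall_lt_top.ne)
  · refine Eventually.of_forall fun y => ?_
    have h1 : HasFDerivAt φ (fderiv ℝ φ y) (y + (0 : ℝ) • v) := by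
      simpa using (hφ.differentiable one_ne_zero y).hasFDerivAt
    have h2 : HasDerivAt (fun τ : ℝ => y + τ • v) v 0 := by
      simpa using ((hasDerivAt_id (0 : ℝ)).smul_const v).const_add y
    exact h1.comp_hasDerivAt 0 h2

/-- Shift the set instead of the function: the epigraph translated by `v` is again an epigraph, of a
shifted and raised `c`. Then apply Fubini in hyperplane coordinates. -/
theorem setIntegral_epigraph_translate {e : V} (he : ‖e‖ = 1) {c : (ℝ ∙ e)ᗮ → ℝ}
    (hc : Continuous c) {φ : V → ℝ} (hφ : Continuous φ) (hs : HasCompactSupport φ) (v : V) :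
    Integrable (fun h : (ℝ ∙ e)ᗮ => ∫ t in Ioi (c (h - (hyperCoord e he v).1) + inner ℝ e v),
      φ ((h : V) + t • e)) ∧
    ∫ y in epigraph e he c, φ (y + v) =
      ∫ h : (ℝ ∙ e)ᗮ, ∫ t in Ioi (c (h - (hyperCoord e he v).1) + inner ℝ e v),
        φ ((h : V) + t • e) := by
  have hmp := (measurePreserving_hyperCoord he).symm (hyperCoord e he).toHomeomorph.toMeasurableEquiv
  set S := epigraph e he c with hS
  have hSm : MeasurableSet S := (isOpen_epigraph he hc).measurableSet
  set G : V → ℝ := fun y => S.indicator 1 (y - v) * φ y with hG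
  have hGint : Integrable G := by
    have h1 : Integrable ((fun y => y - v) ⁻¹' S |>.indicator φ) :=
      (hφ.integrable_of_hasCompactSupport hs).indicator (hSm.preimage (by fun_prop))
    refine h1.congr (Eventually.of_forall fun y => ?_)
    by_cases hy : y - v ∈ S
    · simp [hG, indicator_of_mem hy, indicator_of_mem (show y ∈ (fun y => y - v) ⁻¹' S from hy)]
    · simp [hG, indicator_of_notMem hy,
        indicator_of_notMem (show y ∉ (fun y => y - v) ⁻¹' S from hy)]
  have e1 : ∫ y in S, φ (y + v) = ∫ y, G y := by
    rw [← integral_indicator hSm, ← integral_add_right_eq_self G v]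
    congr 1
    funext y
    by_cases hy : y ∈ S <;> simp [hG, hy]
  have hcomp : ∀ q : (ℝ ∙ e)ᗮ × ℝ, G ((hyperCoord e he).symm q) =
      (Ioi (c (q.1 - (hyperCoord e he v).1) + inner ℝ e v)).indicator
        (fun t => φ ((q.1 : V) + t • e)) q.2 := by
    rintro ⟨h, t⟩
    have hmem : (hyperCoord e he).symm (h, t) - v ∈ S ↔
        t ∈ Ioi (c (h - (hyperCoord e he v).1) + inner ℝ e v) := by
      simp only [hS, epigraph, mem_ofPred_eq, map_sub, ContinuousLinearEquiv.apply_symm_apply,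
        Prod.fst_sub, mem_Ioi]
      rw [← hyperCoord_snd he, map_sub, ContinuousLinearEquiv.apply_symm_apply, Prod.snd_sub,
        hyperCoord_snd, lt_sub_iff_add_lt]
    by_cases hm : t ∈ Ioi (c (h - (hyperCoord e he v).1) + inner ℝ e v)
    · rw [indicator_of_mem hm]
      have h1 := indicator_of_mem (hmem.2 hm) (1 : V → ℝ)
      simp only [hyperCoord_symm_apply] at h1 ⊢
      simp only [hG, h1, Pi.one_apply, one_mul]
    · rw [indicator_of_notMem hm]
      simp [hG, indicator_of_notMem (fun h => hm (hmem.1 h))]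
  have hGi : Integrable (fun q => G ((hyperCoord e he).symm q)) := by
    exact (hmp.integrable_comp_emb (MeasurableEquiv.measurableEmbedding _)).2 hGint
  have e2 : ∫ y, G y = ∫ q : (ℝ ∙ e)ᗮ × ℝ, G ((hyperCoord e he).symm q) :=
    (hmp.integral_comp (MeasurableEquiv.measurableEmbedding _) G).symm
  simp only [hcomp] at hGi e2
  have hin : ∀ h : (ℝ ∙ e)ᗮ, ∫ t, (Ioi (c (h - (hyperCoord e he v).1) + inner ℝ e v)).indicator
      (fun t => φ ((h : V) + t • e)) t =
      ∫ t in Ioi (c (h - (hyperCoord e he v).1) + inner ℝ e v), φ ((h : V) + t • e) := fun h =>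
    integral_indicator measurableSet_Ioi
  refine ⟨?_, ?_⟩
  · simpa only [hin] using hGi.integral_prod_left
  · rw [e1, e2, Measure.volume_eq_prod, integral_prod _ hGi]
    simp only [hin]

/-- The integral of `φ (y + τ • v)` over the epigraph is differentiated at `τ = 0` in two ways. On
the function side it gives the left member. After Fubini only the lower limit `c (h - τ • w) + τ *
s` depends on `τ`, and it is differentiable for almost every `h` by Rademacher's theorem. Thus no
smoothing of `c` is needed. -/
theorem integral_epigraph_fderiv {e : V} (he : ‖e‖ = 1) {c : (ℝ ∙ e)ᗮ → ℝ} {K : ℝ≥0}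
    (hc : LipschitzWith K c) {φ : V → ℝ} (hφ : ContDiff ℝ 1 φ) (hs : HasCompactSupport φ) (v : V) :
    Integrable (fun h => φ (graphMap e c h) *
      (fderiv ℝ c h (hyperCoord e he v).1 - inner ℝ e v)) ∧
    ∫ y in epigraph e he c, fderiv ℝ φ y v =
      ∫ h, φ (graphMap e c h) * (fderiv ℝ c h (hyperCoord e he v).1 - inner ℝ e v) := by
  set w := (hyperCoord e he v).1 with hw
  set s := inner ℝ e v with hs'
  have hφc := hφ.continuous
  obtain ⟨M, hM⟩ := hφc.bounded_above_of_compact_support hs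
  obtain ⟨R, hR⟩ := hs.isCompact.isBounded.subset_closedBall (0 : V)
  have hM0 : 0 ≤ M := (norm_nonneg _).trans (hM 0)
  let Θ : (ℝ ∙ e)ᗮ → ℝ → ℝ := fun h a => ∫ t in Ioi a, φ ((h : V) + t • e)
  have hline : ∀ h : (ℝ ∙ e)ᗮ, Integrable fun t : ℝ => φ ((h : V) + t • e) := by
    intro h
    refine (hφc.comp (by fun_prop)).integrable_of_hasCompactSupport ?_
    refine hs.comp_isClosedEmbedding (g := fun t : ℝ => (h : V) + t • e) ?_
    have hiso : Isometry fun t : ℝ => (h : V) + t • e := by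
      refine Isometry.of_dist_eq fun a b => ?_
      rw [dist_add_left, dist_eq_norm, ← sub_smul, norm_smul, he, mul_one, dist_eq_norm]
    exact hiso.isClosedEmbedding
  have hΘ : ∀ h a b, Θ h a - Θ h b = ∫ t in a..b, φ ((h : V) + t • e) := by
    intro h a b
    have := intervalIntegral.integral_interval_add_Ioi (a := a) (b := b)
      (f := fun t => φ ((h : V) + t • e)) (hline h).integrableOn (hline h).integrableOn
    simp only [Θ]
    linarith
  have hΘd : ∀ h a, HasDerivAt (Θ h) (-φ ((h : V) + a • e)) a := by
    intro h a
    have h1 : HasDerivAt (fun x => ∫ t in a..x, φ ((h : V) + t • e)) (φ ((h : V) + a • e)) a :=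
      intervalIntegral.integral_hasDerivAt_right
        ((hline h).intervalIntegrable) (hφc.comp (by fun_prop)).stronglyMeasurable.stronglyMeasurableAtFilter
        (hφc.comp (by fun_prop)).continuousAt
    refine ((h1.const_sub (Θ h a))).congr_of_eventuallyEq (Eventually.of_forall fun x => ?_)
    show Θ h x = Θ h a - ∫ t in a..x, φ ((h : V) + t • e)
    rw [← hΘ h a x]
    ring
  have hΘl : ∀ h a b, |Θ h a - Θ h b| ≤ M * |a - b| := by
    intro h a b
    rw [hΘ, ← Real.norm_eq_abs, abs_sub_comm]
    exact intervalIntegral.norm_integral_le_of_norm_le_const fun t _ => hM _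
  have hΘ0 : ∀ h : (ℝ ∙ e)ᗮ, R < ‖h‖ → ∀ a, Θ h a = 0 := by
    intro h hh a
    have hz : ∀ t : ℝ, φ ((h : V) + t • e) = 0 := by
      intro t
      by_contra hne
      have h1 := hR (subset_tsupport φ hne)
      rw [mem_closedBall_zero_iff] at h1
      have h2 : ‖(h : V) + t • e‖ ^ 2 = ‖h‖ ^ 2 + t ^ 2 := by
        rw [norm_add_sq_real, inner_smul_right, real_inner_comm, inner_coe_hyperplane, norm_smul,
          he, Real.norm_eq_abs, mul_one, sq_abs]
        simp
      nlinarith [norm_nonneg h, norm_nonneg ((h : V) + t • e), sq_nonneg t]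
    simp [Θ, hz]
  have hI : ∀ τ : ℝ, Integrable (fun h => Θ h (c (h - τ • w) + τ * s)) ∧
      ∫ y in epigraph e he c, φ (y + τ • v) = ∫ h, Θ h (c (h - τ • w) + τ * s) := by
    intro τ
    have := setIntegral_epigraph_translate he hc.continuous hφc hs (τ • v)
    simpa only [map_smul, Prod.smul_fst, inner_smul_right] using this
  have hder : Integrable (fun h => φ (graphMap e c h) * (fderiv ℝ c h w - s)) ∧
      HasDerivAt (fun τ : ℝ => ∫ h, Θ h (c (h - τ • w) + τ * s))
      (∫ h, φ (graphMap e c h) * (fderiv ℝ c h w - s)) 0 := by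
    -- The lower limit is Lipschitz in `τ` with constant `K‖w‖ + |s|`, and `Θ h` is Lipschitz with
    -- constant `M`. The integrand vanishes for `‖h‖ > R`, as projecting to the hyperplane does not
    -- increase norms.
    refine hasDerivAt_integral_of_dominated_loc_of_lip
      (F := fun τ h => Θ h (c (h - τ • w) + τ * s)) (s := univ)
      (bound := (Metric.closedBall (0 : (ℝ ∙ e)ᗮ) R).indicator fun _ => M * (K * ‖w‖ + |s|))
      univ_mem (Eventually.of_forall fun τ => (hI τ).1.aestronglyMeasurable) (hI 0).1 ?_ ?_ ?_ ?_
    · refine AEStronglyMeasurable.mul ?_ ?_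
      · exact (hφc.comp (continuous_graphMap hc.continuous)).aestronglyMeasurable
      · exact ((measurable_fderiv_apply_const ℝ c w).sub_const s).aestronglyMeasurable
    · refine Eventually.of_forall fun h => ?_
      by_cases hh : h ∈ Metric.closedBall (0 : (ℝ ∙ e)ᗮ) R
      · rw [indicator_of_mem hh]
        refine LipschitzOnWith.of_dist_le_mul fun a _ b _ => ?_
        rw [Real.coe_nnabs, abs_of_nonneg (by positivity), Real.dist_eq, Real.dist_eq]
        refine (hΘl h _ _).trans ?_
        rw [mul_assoc]
        gcongr
        have h1 := hc.dist_le_mul (h - a • w) (h - b • w)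
        rw [dist_sub_left, dist_eq_norm (a • w), ← sub_smul, norm_smul, Real.dist_eq,
          Real.norm_eq_abs] at h1
        calc |c (h - a • w) + a * s - (c (h - b • w) + b * s)|
            = |(c (h - a • w) - c (h - b • w)) + (a - b) * s| := by ring_nf
          _ ≤ |c (h - a • w) - c (h - b • w)| + |(a - b) * s| := abs_add_le _ _
          _ ≤ K * (|a - b| * ‖w‖) + |a - b| * |s| := by rw [abs_mul]; gcongr
          _ = _ := by ring
      · rw [indicator_of_notMem hh]
        rw [mem_closedBall_zero_iff, not_le] at hh
        refine LipschitzOnWith.of_dist_le_mul fun a _ b _ => ?_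
        simp only [hΘ0 h hh, dist_self]
        positivity
    · rw [integrable_indicator_iff measurableSet_closedBall]
      exact integrableOn_const (measure_closedBall_lt_top.ne)
    · filter_upwards [hc.ae_differentiableAt] with h hh
      have h1 : HasDerivAt (fun τ : ℝ => h - τ • w) (-w) 0 := by
        simpa using ((hasDerivAt_id (0 : ℝ)).smul_const w).const_sub h
      have h2 : HasFDerivAt c (fderiv ℝ c h) (h - (0 : ℝ) • w) := by
        simpa using hh.hasFDerivAt
      have h3 : HasDerivAt (fun τ : ℝ => c (h - τ • w) + τ * s) (fderiv ℝ c h (-w) + s) 0 := by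
        refine (h2.comp_hasDerivAt 0 h1).add ?_
        simpa using (hasDerivAt_id (0 : ℝ)).mul_const s
      have h4 := (hΘd h (c (h - (0 : ℝ) • w) + 0 * s)).comp (0 : ℝ) h3
      convert! h4 using 1
      simp only [zero_smul, sub_zero, zero_mul, add_zero, map_neg, graphMap]
      ring
  refine ⟨hder.1, ?_⟩
  have h2 := hasDerivAt_integral_translate hφ hs v (epigraph e he c)
  simp only [(hI _).2] at h2
  exact h2.unique hder.2

end Epigraph


/-! ### Charts of a Lipschitz domain -/

/-- The pieces are indexed by the centres of their balls, so chart or cone data chosen at each point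
of `K` serve them directly. -/
theorem exists_smooth_partition {V : Type*} [NormedAddCommGroup V] [NormedSpace ℝ V]
    [FiniteDimensional ℝ V] {K : Set V} (hK : IsCompact K) (r : V → ℝ) (hr : ∀ x ∈ K, 0 < r x) :
    ∃ (t : Finset V) (ζ : V → V → ℝ), (∀ x ∈ t, x ∈ K) ∧
      (∀ x ∈ t, ContDiff ℝ ∞ (ζ x) ∧ HasCompactSupport (ζ x) ∧
        tsupport (ζ x) ⊆ Metric.ball x (r x) ∧ ∀ y, 0 ≤ ζ x y) ∧
      ∀ y ∈ K, ∑ x ∈ t, ζ x y = 1 := by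
  obtain ⟨t, htK, ht⟩ := hK.elim_nhds_subcover (fun x => Metric.ball x (r x))
    fun x hx => Metric.ball_mem_nhds x (hr x hx)
  have hcov : K ⊆ ⋃ x : t, Metric.ball (x : V) (r x) := fun y hy => by
    obtain ⟨x, hx, hxy⟩ := mem_iUnion₂.1 (ht hy)
    exact mem_iUnion.2 ⟨⟨x, hx⟩, hxy⟩
  obtain ⟨f, hf⟩ := SmoothPartitionOfUnity.exists_isSubordinate (modelWithCornersSelf ℝ V)
    hK.isClosed (fun x : t => Metric.ball (x : V) (r x)) (fun _ => Metric.isOpen_ball) hcov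
  classical
  refine ⟨t, fun x => if hx : x ∈ t then f ⟨x, hx⟩ else 0, htK, fun x hx => ?_, fun y hy => ?_⟩
  · simp only [hx, dite_true]
    refine ⟨(f ⟨x, hx⟩).contMDiff.contDiff, ?_, hf ⟨x, hx⟩, fun y => f.nonneg _ _⟩
    exact HasCompactSupport.of_support_subset_isCompact (isCompact_closedBall x (r x))
      ((subset_tsupport _).trans ((hf ⟨x, hx⟩).trans Metric.ball_subset_closedBall))
  · have h1 := f.sum_eq_one hy
    rw [finsum_eq_sum_of_fintype] at h1
    rw [← h1, ← Finset.sum_coe_sort t]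
    exact Finset.sum_congr rfl fun x _ => by simp

section Chart

variable {d : ℕ} {Ω : Set (Euc d)}

theorem IsBoundedLipschitz.exists_chart (hΩ : IsBoundedLipschitz Ω) {x : Euc d}
    (hx : x ∈ frontier Ω) : ∃ (e : Euc d) (he : ‖e‖ = 1) (r : ℝ) (K : ℝ≥0) (c : (ℝ ∙ e)ᗮ → ℝ),
      0 < r ∧ LipschitzWith K c ∧ ∀ y ∈ Metric.ball x r, y ∈ Ω ↔ y ∈ epigraph e he c := by
  obtain ⟨e, r, K, γ, he, hr, hγ, h⟩ := hΩ.locallyEpigraph x hx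
  refine ⟨e, he, r, K, fun h => γ h, hr, ?_, h⟩
  have := hγ.comp (LipschitzWith.subtype_val ((ℝ ∙ e)ᗮ : Set (Euc d)))
  rwa [mul_one] at this

variable {x : Euc d} {e : Euc d} {he : ‖e‖ = 1} {r : ℝ} {K : ℝ≥0} {c : (ℝ ∙ e)ᗮ → ℝ}

theorem le_inner_of_mem_closure (hc : Continuous c)
    (hch : ∀ y ∈ Metric.ball x r, y ∈ Ω ↔ y ∈ epigraph e he c) {y : Euc d}
    (hy : y ∈ closure Ω) (hyr : y ∈ Metric.ball x r) : c (hyperCoord e he y).1 ≤ inner ℝ e y := by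
  have h1 : y ∈ closure (Metric.ball x r ∩ Ω) :=
    Metric.isOpen_ball.inter_closure ⟨hyr, hy⟩
  have h2 : IsClosed {y : Euc d | c (hyperCoord e he y).1 ≤ inner ℝ e y} :=
    isClosed_le (hc.comp ((hyperCoord e he).continuous.fst)) (by fun_prop)
  have h3 : Metric.ball x r ∩ Ω ⊆ {y : Euc d | c (hyperCoord e he y).1 ≤ inner ℝ e y} :=
    fun z hz => le_of_lt (show c (hyperCoord e he z).1 < inner ℝ e z from (hch z hz.1).1 hz.2)
  exact closure_minimal h3 h2 h1

theorem norm_hyperCoord_fst_le (he : ‖e‖ = 1) (y : Euc d) : ‖(hyperCoord e he y).1‖ ≤ ‖y‖ := by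
  have h1 : ‖y - inner ℝ e y • e‖ ^ 2 = ‖y‖ ^ 2 - (inner ℝ e y) ^ 2 := by
    rw [norm_sub_sq_real, inner_smul_right, real_inner_comm, norm_smul, he, Real.norm_eq_abs,
      mul_one, sq_abs]
    ring
  have h2 : ‖(hyperCoord e he y).1‖ = ‖y - inner ℝ e y • e‖ := rfl
  rw [h2, ← sq_le_sq₀ (norm_nonneg _) (norm_nonneg _), h1]
  linarith [sq_nonneg (inner ℝ e y : ℝ)]

/-- Moving by `s` raises the height by at least `τ - τ / (K + 2)`, while the graph rises by at most
`K τ / (K + 2)`. The first exceeds the second, so even a point lying on the graph is moved strictly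
above it. -/
theorem add_mem_of_cone (hc : LipschitzWith K c)
    (hch : ∀ y ∈ Metric.ball x r, y ∈ Ω ↔ y ∈ epigraph e he c) {y s : Euc d} {τ : ℝ} (hτ : 0 < τ)
    (hy : y ∈ closure Ω) (hyr : y ∈ Metric.ball x r) (hs : ‖s - τ • e‖ ≤ 1 / (K + 2) * τ)
    (hysr : y + s ∈ Metric.ball x r) : y + s ∈ Ω := by
  have h0 := le_inner_of_mem_closure hc.continuous hch hy hyr
  rw [hch _ hysr, epigraph, mem_ofPred_eq, inner_add_right]
  have h1 : τ - 1 / (K + 2) * τ ≤ inner ℝ e s := by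
    have h2 := abs_real_inner_le_norm e (s - τ • e)
    rw [inner_sub_right, inner_smul_right, real_inner_self_eq_norm_sq, he] at h2
    have := (abs_le.1 h2).1
    linarith
  have h3 : ‖(hyperCoord e he s).1‖ ≤ 1 / (K + 2) * τ := by
    have h4 : (hyperCoord e he s).1 = (hyperCoord e he (s - τ • e)).1 := by
      ext1
      simp only [hyperCoord_fst, inner_sub_right, inner_smul_right, real_inner_self_eq_norm_sq, he]
      module
    rw [h4]
    exact (norm_hyperCoord_fst_le he _).trans hs
  have h5 : c (hyperCoord e he (y + s)).1 ≤ c (hyperCoord e he y).1 + K * (1 / (K + 2) * τ) := by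
    have h6 := hc.dist_le_mul (hyperCoord e he (y + s)).1 (hyperCoord e he y).1
    rw [map_add, Prod.fst_add, dist_self_add_left, Real.dist_eq] at h6
    have h7 := le_of_abs_le h6
    rw [map_add, Prod.fst_add]
    have : (K : ℝ) * ‖(hyperCoord e he s).1‖ ≤ K * (1 / (K + 2) * τ) := by gcongr
    linarith
  have h8 : (K : ℝ) * (1 / (K + 2) * τ) + 1 / (K + 2) * τ < τ := by
    have hK : (0 : ℝ) < K + 2 := by positivity
    have : (K : ℝ) * (1 / (K + 2) * τ) + 1 / (K + 2) * τ = (K + 1) / (K + 2) * τ := by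
      field_simp
    rw [this]
    have h9 : ((K : ℝ) + 1) / (K + 2) < 1 := by rw [div_lt_one hK]; linarith
    nlinarith
  linarith

/-- A frontier point is a limit of points above the graph but is not above it itself. Conversely, a
point of the graph is the limit of its upward shifts `y + τ • e`. -/
theorem mem_frontier_iff_of_chart (hΩ : IsOpen Ω) (hc : LipschitzWith K c)
    (hch : ∀ y ∈ Metric.ball x r, y ∈ Ω ↔ y ∈ epigraph e he c) {y : Euc d}
    (hyr : y ∈ Metric.ball x r) : y ∈ frontier Ω ↔ y ∈ range (graphMap e c) := by
  rw [mem_range_graphMap he, hΩ.frontier_eq, Set.mem_sdiff]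
  constructor
  · rintro ⟨h1, h2⟩
    refine le_antisymm (le_inner_of_mem_closure hc.continuous hch h1 hyr) ?_
    rw [hch y hyr] at h2
    exact not_lt.1 h2
  · intro h
    refine ⟨?_, fun h2 => (((hch y hyr).1 h2 : c _ < _).ne h)⟩
    have h1 : Tendsto (fun τ : ℝ => y + τ • e) (𝓝[>] 0) (𝓝 y) := by
      have : Continuous fun τ : ℝ => y + τ • e := by fun_prop
      simpa using (this.tendsto 0).mono_left nhdsWithin_le_nhds
    refine mem_closure_of_tendsto h1 ?_
    filter_upwards [h1.eventually (Metric.isOpen_ball.mem_nhds hyr), self_mem_nhdsWithin]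
      with τ hτ hτ0
    rw [hch _ hτ]
    show c (hyperCoord e he (y + τ • e)).1 < inner ℝ e (y + τ • e)
    have h4 : (hyperCoord e he (y + τ • e)).1 = (hyperCoord e he y).1 := by
      ext1
      simp only [hyperCoord_fst, inner_add_right, inner_smul_right, real_inner_self_eq_norm_sq, he]
      module
    rw [h4, h, inner_add_right, inner_smul_right, real_inner_self_eq_norm_sq, he]
    have : (0 : ℝ) < τ := hτ0
    linarith

/-! ### The outward normal -/

/-- Step from `x` in the direction `ν' - ν`: it is strictly inward for `ν` and strictly outward for
`ν'`, so a nearby point would lie both inside and outside `Ω`. -/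
theorem IsOutwardNormal.unique {x ν ν' : Euc d} (h : IsOutwardNormal Ω x ν)
    (h' : IsOutwardNormal Ω x ν') : ν = ν' := by
  by_contra hne
  have hlt : inner ℝ ν ν' < 1 := (inner_lt_one_iff_real_of_norm_eq_one h.1 h'.1).2 hne
  set s := ν' - ν with hs
  have hs0 : 0 < ‖s‖ := norm_pos_iff.2 (sub_ne_zero.2 (Ne.symm hne))
  -- The products of `s` with `ν` and `ν'` are `∓(1 - ⟪ν, ν'⟫)`. This `δ` makes `δ‖s‖` half of that
  -- size, so `s` lies strictly inside both cones.
  set δ := (1 - inner ℝ ν ν') / (2 * ‖s‖) with hδ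
  have hδ0 : 0 < δ := div_pos (by linarith) (by positivity)
  obtain ⟨r, hr, h1⟩ := h.2 δ hδ0
  obtain ⟨r', hr', h2⟩ := h'.2 δ hδ0
  have hδs : δ * ‖s‖ = (1 - inner ℝ ν ν') / 2 := by rw [hδ]; field_simp
  set t := min r r' / (2 * ‖s‖) with ht
  have hm : 0 < min r r' := lt_min hr hr'
  have ht0 : 0 < t := by positivity
  have hts : t * ‖s‖ = min r r' / 2 := by rw [ht]; field_simp
  have hb : ‖t • s‖ < min r r' := by
    rw [norm_smul, Real.norm_eq_abs, abs_of_pos ht0, hts]; linarith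
  have hn : inner ℝ s ν = inner ℝ ν ν' - 1 := by
    rw [hs, inner_sub_left, real_inner_self_eq_norm_sq, h.1, real_inner_comm]; ring
  have hn' : inner ℝ s ν' = 1 - inner ℝ ν ν' := by
    rw [hs, inner_sub_left, real_inner_self_eq_norm_sq, h'.1]; ring
  have a := (h1 (x + t • s) (by
    rw [Metric.mem_ball, dist_self_add_left]; exact hb.trans_le (min_le_left _ _))).1
  have b := (h2 (x + t • s) (by
    rw [Metric.mem_ball, dist_self_add_left]; exact hb.trans_le (min_le_right _ _))).2
  rw [add_sub_cancel_left, inner_smul_left, norm_smul, Real.norm_eq_abs, abs_of_pos ht0] at a b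
  simp only [conj_trivial] at a b
  refine b ?_ (a ?_)
  · rw [hn']; nlinarith
  · rw [hn]; nlinarith

theorem IsOutwardNormal.outwardNormal_eq {x ν : Euc d} (h : IsOutwardNormal Ω x ν) :
    outwardNormal Ω x = ν := by
  have hex : ∃ ν, IsOutwardNormal Ω x ν := ⟨ν, h⟩
  rw [outwardNormal, dif_pos hex]
  exact hex.choose_spec.unique h

theorem norm_outwardNormal_le (Ω : Set (Euc d)) (x : Euc d) : ‖outwardNormal Ω x‖ ≤ 1 := by
  rw [outwardNormal]
  split_ifs with h
  · exact h.choose_spec.1.le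
  · simp

/-- The unit normal to the graph of `c`, pointing below it. -/
def graphNormal (e : Euc d) (c : (ℝ ∙ e)ᗮ → ℝ) (h : (ℝ ∙ e)ᗮ) : Euc d :=
  (graphJac c h)⁻¹ • (((∇ c h : (ℝ ∙ e)ᗮ) : Euc d) - e)

/-- The surface element cancels the normalization of the normal. This turns the integrand of
`integral_epigraph_fderiv` into a normal component with respect to surface measure. -/
theorem graphJac_mul_inner_graphNormal (he : ‖e‖ = 1) (c : (ℝ ∙ e)ᗮ → ℝ) (h : (ℝ ∙ e)ᗮ)
    (v : Euc d) : graphJac c h * inner ℝ v (graphNormal e c h)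
      = fderiv ℝ c h (hyperCoord e he v).1 - inner ℝ e v := by
  have hJ : graphJac c h ≠ 0 := (zero_lt_one.trans_le (one_le_graphJac c h)).ne'
  rw [graphNormal, inner_smul_right, mul_inv_cancel_left₀ hJ, inner_sub_right, real_inner_comm e v]
  congr 1
  have h1 : v = ((hyperCoord e he v).1 : Euc d) + inner ℝ e v • e := by simp
  conv_lhs => rw [h1]
  rw [inner_add_left, inner_smul_left, inner_coe_hyperplane, ← Submodule.coe_inner,
    real_inner_comm, gradient, InnerProductSpace.toDual_symm_apply]
  simp

theorem measurable_graphNormal (c : (ℝ ∙ e)ᗮ → ℝ) : Measurable (graphNormal e c) := by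
  refine (measurable_graphJac c).inv.smul (Measurable.sub_const ?_ e)
  refine measurable_subtype_coe.comp ?_
  exact (LinearIsometryEquiv.continuous _).measurable.comp (measurable_fderiv ℝ c)

theorem norm_graphNormal (he : ‖e‖ = 1) (c : (ℝ ∙ e)ᗮ → ℝ) (h : (ℝ ∙ e)ᗮ) :
    ‖graphNormal e c h‖ = 1 := by
  have hJ : 0 < graphJac c h := zero_lt_one.trans_le (one_le_graphJac c h)
  have h1 : ‖((∇ c h : (ℝ ∙ e)ᗮ) : Euc d) - e‖ = graphJac c h := by
    have h2 : ‖((∇ c h : (ℝ ∙ e)ᗮ) : Euc d)‖ = ‖fderiv ℝ c h‖ := by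
      rw [← Submodule.coe_norm, gradient, LinearIsometryEquiv.norm_map]
    rw [graphJac, ← Real.sqrt_sq (norm_nonneg _), norm_sub_sq_real, h2, he, real_inner_comm,
      inner_coe_hyperplane]
    congr 1
    ring
  rw [graphNormal, norm_smul, h1, norm_inv, Real.norm_eq_abs, abs_of_pos hJ, inv_mul_cancel₀ hJ.ne']

/-- Up to the factor `graphJac c h ≥ 1`, the product of `y - x` with the normal is the height of the
tangent plane minus that of `y`. Differentiability replaces the plane by the graph with error at
most `δ / 2 * ‖y - x‖` near the point, too small to change the side in either cone. -/
theorem isOutwardNormal_graphNormal (he : ‖e‖ = 1)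
    (hch : ∀ y ∈ Metric.ball x r, y ∈ Ω ↔ y ∈ epigraph e he c) {h : (ℝ ∙ e)ᗮ}
    (hd : DifferentiableAt ℝ c h) (hh : graphMap e c h ∈ Metric.ball x r) :
    IsOutwardNormal Ω (graphMap e c h) (graphNormal e c h) := by
  refine ⟨norm_graphNormal he c h, fun δ hδ => ?_⟩
  have h1 := hd.hasFDerivAt.isLittleO.def (half_pos hδ)
  have h2 : Tendsto (fun y => (hyperCoord e he y).1) (𝓝 (graphMap e c h)) (𝓝 h) := by
    have : Continuous fun y => (hyperCoord e he y).1 := (hyperCoord e he).continuous.fst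
    simpa [hyperCoord_graphMap] using this.tendsto (graphMap e c h)
  obtain ⟨ρ, hρ, hb⟩ := Metric.eventually_nhds_iff_ball.1
    ((h2.eventually h1).and (Metric.isOpen_ball.mem_nhds hh))
  refine ⟨ρ, hρ, fun y hy => ?_⟩
  obtain ⟨h3, h4⟩ := hb y hy
  have h5 := graphJac_mul_inner_graphNormal he c h (y - graphMap e c h)
  have h6 : inner ℝ e (y - graphMap e c h) = inner ℝ e y - c h := by
    rw [inner_sub_right, ← hyperCoord_snd he (graphMap e c h), hyperCoord_graphMap]
  rw [map_sub, Prod.fst_sub, hyperCoord_graphMap, h6] at h5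
  have h7 : ‖(hyperCoord e he y).1 - h‖ ≤ ‖y - graphMap e c h‖ := by
    have := norm_hyperCoord_fst_le he (y - graphMap e c h)
    rwa [map_sub, Prod.fst_sub, hyperCoord_graphMap] at this
  have hJ := one_le_graphJac c h
  rw [Real.norm_eq_abs] at h3
  have h8 : |c (hyperCoord e he y).1 - c h - fderiv ℝ c h ((hyperCoord e he y).1 - h)|
      ≤ δ / 2 * ‖y - graphMap e c h‖ := h3.trans (by gcongr)
  obtain ⟨h9, h10⟩ := abs_le.1 h8
  have hn := norm_nonneg (y - graphMap e c h)
  constructor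
  · intro hlt
    rw [hch y h4]
    show c (hyperCoord e he y).1 < inner ℝ e y
    nlinarith [mul_nonneg hδ.le hn]
  · intro hlt hmem
    rw [hch y h4] at hmem
    have hmem' : c (hyperCoord e he y).1 < inner ℝ e y := hmem
    nlinarith [mul_nonneg hδ.le hn]

/-! ### Surface measure and the divergence theorem -/

theorem finrank_hyperplane (he : ‖e‖ = 1) : finrank ℝ (ℝ ∙ e)ᗮ = d - 1 := by
  have hne : e ≠ 0 := fun h => by simp [h] at he
  have h1 := (ℝ ∙ e).finrank_add_finrank_orthogonal
  rw [finrank_span_singleton hne, finrank_euclideanSpace_fin] at h1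
  omega

theorem surface_restrict_ball (hΩ : IsOpen Ω) (hc : LipschitzWith K c)
    (hch : ∀ y ∈ Metric.ball x r, y ∈ Ω ↔ y ∈ epigraph e he c) :
    (surface Ω).restrict (Metric.ball x r) =
      ((volume.withDensity fun h => ENNReal.ofReal (graphJac c h)).map (graphMap e c)).restrict
        (Metric.ball x r) := by
  rw [map_graphMap he hc (finrank_hyperplane he), surface,
    Measure.restrict_restrict Metric.isOpen_ball.measurableSet,
    Measure.restrict_restrict Metric.isOpen_ball.measurableSet]
  congr 1
  ext y
  simp only [mem_inter_iff, and_congr_right_iff]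
  exact fun hy => mem_frontier_iff_of_chart hΩ hc hch hy

theorem surface_ball_lt_top (hΩ : IsOpen Ω) (hc : LipschitzWith K c)
    (hch : ∀ y ∈ Metric.ball x r, y ∈ Ω ↔ y ∈ epigraph e he c) :
    surface Ω (Metric.ball x r) < ⊤ := by
  have hemb := measurableEmbedding_graphMap he hc.continuous
  have h1 := congrArg (fun μ : Measure (Euc d) => μ univ) (surface_restrict_ball hΩ hc hch)
  simp only [Measure.restrict_apply_univ] at h1
  rw [h1, hemb.map_apply, withDensity_apply _ (hemb.measurable Metric.isOpen_ball.measurableSet)]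
  have h2 : graphMap e c ⁻¹' Metric.ball x r ⊆ Metric.closedBall 0 (‖x‖ + r) := by
    intro h hh
    rw [mem_closedBall_zero_iff]
    have h3 := norm_hyperCoord_fst_le he (graphMap e c h)
    rw [hyperCoord_graphMap] at h3
    have h4 : ‖graphMap e c h - x‖ < r := by simpa [dist_eq_norm] using hh
    have h5 := norm_le_norm_add_norm_sub' (graphMap e c h) x
    linarith
  calc ∫⁻ h in graphMap e c ⁻¹' Metric.ball x r, ENNReal.ofReal (graphJac c h)
      ≤ ∫⁻ _ in Metric.closedBall (0 : (ℝ ∙ e)ᗮ) (‖x‖ + r), ENNReal.ofReal √(1 + K ^ 2) := by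
        refine (lintegral_mono_set h2).trans (lintegral_mono fun h => ?_)
        exact ENNReal.ofReal_le_ofReal (graphJac_le hc h)
    _ < ⊤ := by
        rw [setLIntegral_const]
        exact ENNReal.mul_lt_top ENNReal.ofReal_lt_top measure_closedBall_lt_top

/-- Rademacher's theorem in the graph parameter, carried to the surface: densities and push-forward
along the graph map preserve null sets. -/
theorem outwardNormal_ae_eq (hΩ : IsOpen Ω) (hc : LipschitzWith K c)
    (hch : ∀ y ∈ Metric.ball x r, y ∈ Ω ↔ y ∈ epigraph e he c) :
    outwardNormal Ω =ᵐ[(surface Ω).restrict (Metric.ball x r)]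
      fun y => graphNormal e c (hyperCoord e he y).1 := by
  have hemb := measurableEmbedding_graphMap he hc.continuous
  rw [surface_restrict_ball hΩ hc hch, Filter.EventuallyEq,
    ae_restrict_iff' Metric.isOpen_ball.measurableSet, hemb.ae_map_iff]
  have h1 : ∀ᵐ h, DifferentiableAt ℝ c h := hc.ae_differentiableAt
  refine (withDensity_absolutelyContinuous _ _).ae_le ?_
  filter_upwards [h1] with h hh hb
  rw [(isOutwardNormal_graphNormal he hch hh hb).outwardNormal_eq, hyperCoord_graphMap]

/-- Since `φ` lives in the chart ball, `Ω` may be exchanged for the full epigraph and the surface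
integral pulled back to the hyperplane. There it is `integral_epigraph_fderiv`. -/
theorem integral_fderiv_of_chart (hΩ : IsOpen Ω) (hc : LipschitzWith K c)
    (hch : ∀ y ∈ Metric.ball x r, y ∈ Ω ↔ y ∈ epigraph e he c) {φ : Euc d → ℝ}
    (hφ : ContDiff ℝ 1 φ) (hs : HasCompactSupport φ) (hsupp : tsupport φ ⊆ Metric.ball x r)
    (v : Euc d) :
    ∫ y, fderiv ℝ φ y v ∂(bulk Ω) = ∫ y, φ y * inner ℝ v (outwardNormal Ω y) ∂(surface Ω) := by
  have hemb := measurableEmbedding_graphMap he hc.continuous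
  have hoff : ∀ y, y ∉ Metric.ball x r → φ y = 0 := fun y hy =>
    image_eq_zero_of_notMem_tsupport fun h => hy (hsupp h)
  have hoff' : ∀ y, y ∉ Metric.ball x r → fderiv ℝ φ y v = 0 := fun y hy => by
    have : fderiv ℝ φ y = 0 :=
      image_eq_zero_of_notMem_tsupport fun h => hy (hsupp (tsupport_fderiv_subset ℝ h))
    rw [this]; rfl
  have e1 : ∫ y, fderiv ℝ φ y v ∂(bulk Ω) = ∫ y in epigraph e he c, fderiv ℝ φ y v := by
    rw [bulk, ← integral_indicator hΩ.measurableSet,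
      ← integral_indicator (isOpen_epigraph he hc.continuous).measurableSet]
    congr 1
    funext y
    by_cases hy : y ∈ Metric.ball x r
    · by_cases hyΩ : y ∈ Ω
      · rw [indicator_of_mem hyΩ, indicator_of_mem ((hch y hy).1 hyΩ)]
      · rw [indicator_of_notMem hyΩ, indicator_of_notMem fun h => hyΩ ((hch y hy).2 h)]
    · simp only [indicator, hoff' y hy, ite_self]
  have e2 : ∫ y, φ y * inner ℝ v (outwardNormal Ω y) ∂(surface Ω) =
      ∫ y in Metric.ball x r, φ y * inner ℝ v (graphNormal e c (hyperCoord e he y).1)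
        ∂(surface Ω) := by
    rw [← setIntegral_eq_integral_of_forall_compl_eq_zero (s := Metric.ball x r)]
    · refine integral_congr_ae ?_
      filter_upwards [outwardNormal_ae_eq hΩ hc hch] with y hy
      rw [hy]
    · intro y hy
      rw [hoff y hy, zero_mul]
  rw [e1, e2, (integral_epigraph_fderiv he hc hφ hs v).2, surface_restrict_ball hΩ hc hch,
    setIntegral_eq_integral_of_forall_compl_eq_zero, hemb.integral_map,
    integral_withDensity_eq_integral_toReal_smul]
  · refine integral_congr_ae (Eventually.of_forall fun h => ?_)
    simp only [hyperCoord_graphMap]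
    rw [ENNReal.toReal_ofReal (zero_le_one.trans (one_le_graphJac c h)), smul_eq_mul,
      ← graphJac_mul_inner_graphNormal he c h v]
    ring
  · exact (measurable_graphJac c).ennreal_ofReal
  · exact Eventually.of_forall fun _ => ENNReal.ofReal_lt_top
  · intro y hy
    rw [hoff y hy, zero_mul]

end Chart

/-! ### The divergence theorem on the whole domain. -/

section Domain

variable {d : ℕ} {Ω : Set (Euc d)}

theorem IsBoundedLipschitz.isCompact_closure (hΩ : IsBoundedLipschitz Ω) : IsCompact (closure Ω) :=
  hΩ.isBounded.isCompact_closure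

theorem IsBoundedLipschitz.isCompact_frontier (hΩ : IsBoundedLipschitz Ω) :
    IsCompact (frontier Ω) :=
  hΩ.isCompact_closure.of_isClosed_subset isClosed_frontier frontier_subset_closure

theorem IsBoundedLipschitz.isFiniteMeasure_surface (hΩ : IsBoundedLipschitz Ω) :
    IsFiniteMeasure (surface Ω) := by
  have h1 : surface Ω (frontier Ω) < ⊤ := by
    refine hΩ.isCompact_frontier.measure_lt_top_of_nhdsWithin fun x hx => ?_
    obtain ⟨e, he, r, K, c, hr, hc, hch⟩ := hΩ.exists_chart hx
    exact ⟨Metric.ball x r, mem_nhdsWithin_of_mem_nhds (Metric.ball_mem_nhds x hr),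
      surface_ball_lt_top hΩ.isOpen hc hch⟩
  refine ⟨?_⟩
  have h2 : surface Ω univ = surface Ω (frontier Ω) := by
    rw [surface, Measure.restrict_apply_univ, Measure.restrict_apply_self]
  rwa [h2]

theorem isFiniteMeasure_bulk (hΩ : IsBoundedLipschitz Ω) : IsFiniteMeasure (bulk Ω) :=
  ⟨by rw [bulk, Measure.restrict_apply_univ]; exact hΩ.isBounded.measure_lt_top⟩

/-- The normal is defined by choice, so measurability is inherited almost everywhere from the
explicit graph normals of finitely many charts. -/
theorem aestronglyMeasurable_outwardNormal (hΩ : IsBoundedLipschitz Ω) :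
    AEStronglyMeasurable (outwardNormal Ω) (surface Ω) := by
  choose! e he r K c hr hc hch using fun x (hx : x ∈ frontier Ω) => hΩ.exists_chart hx
  obtain ⟨t, htK, ht⟩ := hΩ.isCompact_frontier.elim_nhds_subcover (fun x => Metric.ball x (r x))
    fun x hx => Metric.ball_mem_nhds x (hr x hx)
  have h1 : ∀ x ∈ t, AEStronglyMeasurable (outwardNormal Ω)
      ((surface Ω).restrict (Metric.ball x (r x))) := by
    intro x hx
    have hx' := htK x hx
    refine AEStronglyMeasurable.congr ?_ (outwardNormal_ae_eq hΩ.isOpen (hc x hx') (hch x hx')).symm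
    exact ((measurable_graphNormal _).comp
      (hyperCoord (e x) (he x hx')).continuous.fst.measurable).aestronglyMeasurable
  have h2 : AEStronglyMeasurable (outwardNormal Ω)
      ((surface Ω).restrict (⋃ x : t, Metric.ball (x : Euc d) (r x))) := by
    rw [aestronglyMeasurable_iUnion_iff]
    exact fun x => h1 x x.2
  have h3 : (surface Ω).restrict (⋃ x : t, Metric.ball (x : Euc d) (r x)) = surface Ω := by
    rw [surface, Measure.restrict_restrict (MeasurableSet.iUnion fun _ =>
      Metric.isOpen_ball.measurableSet), inter_eq_right.2]
    intro y hy
    obtain ⟨x, hx, hxy⟩ := mem_iUnion₂.1 (ht hy)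
    exact mem_iUnion.2 ⟨⟨x, hx⟩, hxy⟩
  rwa [h3] at h2

/-- The integral over the whole space is invariant under translation, so its derivative along `v` is
zero. -/
theorem integral_fderiv_of_tsupport_subset {φ : Euc d → ℝ} (hφ : ContDiff ℝ 1 φ)
    (hs : HasCompactSupport φ) (hsupp : tsupport φ ⊆ Ω) (v : Euc d) :
    ∫ y, fderiv ℝ φ y v ∂(bulk Ω) = 0 := by
  rw [bulk, setIntegral_eq_integral_of_forall_compl_eq_zero]
  · have := (hasDerivAt_integral_translate hφ hs v univ)
    simp only [Measure.restrict_univ, integral_add_right_eq_self] at this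
    exact this.unique (hasDerivAt_const _ _)
  · intro y hy
    have : fderiv ℝ φ y = 0 :=
      image_eq_zero_of_notMem_tsupport fun h => hy (hsupp (tsupport_fderiv_subset ℝ h))
    rw [this]; rfl

theorem integral_fderiv_eq_surface_of_local (hΩ : IsBoundedLipschitz Ω) {x : Euc d}
    (hx : x ∈ closure Ω) : ∃ r > 0, ∀ φ : Euc d → ℝ, ContDiff ℝ 1 φ → HasCompactSupport φ →
      tsupport φ ⊆ Metric.ball x r → ∀ v : Euc d,
      ∫ y, fderiv ℝ φ y v ∂(bulk Ω) = ∫ y, φ y * inner ℝ v (outwardNormal Ω y) ∂(surface Ω) := by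
  by_cases hxΩ : x ∈ Ω
  · obtain ⟨r, hr, hb⟩ := Metric.isOpen_iff.1 hΩ.isOpen x hxΩ
    refine ⟨r, hr, fun φ hφ hs hsupp v => ?_⟩
    rw [integral_fderiv_of_tsupport_subset hφ hs (hsupp.trans hb), surface, eq_comm]
    refine setIntegral_eq_zero_of_forall_eq_zero fun y hy => ?_
    rw [image_eq_zero_of_notMem_tsupport (f := φ), zero_mul]
    intro h
    rw [hΩ.isOpen.frontier_eq] at hy
    exact hy.2 (hb (hsupp h))
  · have hx' : x ∈ frontier Ω := by rw [hΩ.isOpen.frontier_eq]; exact ⟨hx, hxΩ⟩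
    obtain ⟨e, he, r, K, c, hr, hc, hch⟩ := hΩ.exists_chart hx'
    exact ⟨r, hr, fun φ hφ hs hsupp v => integral_fderiv_of_chart hΩ.isOpen hc hch hφ hs hsupp v⟩

theorem integrable_mul_inner_outwardNormal (hΩ : IsBoundedLipschitz Ω) {φ : Euc d → ℝ}
    (hφ : ContinuousOn φ (closure Ω)) (v : Euc d) :
    Integrable (fun y => φ y * inner ℝ v (outwardNormal Ω y)) (surface Ω) := by
  have := hΩ.isFiniteMeasure_surface
  obtain ⟨M, hM⟩ := hΩ.isCompact_frontier.exists_bound_of_continuousOn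
    (hφ.mono frontier_subset_closure)
  refine Integrable.of_bound (C := M * ‖v‖) ?_ ?_
  · refine AEStronglyMeasurable.mul ?_ ?_
    · exact (hφ.mono frontier_subset_closure).aestronglyMeasurable isClosed_frontier.measurableSet
    · exact (aestronglyMeasurable_outwardNormal hΩ).const_inner
  · filter_upwards [ae_restrict_mem isClosed_frontier.measurableSet] with y hy
    rw [norm_mul]
    refine mul_le_mul (hM y hy) ?_ (norm_nonneg _) ((norm_nonneg _).trans (hM y hy))
    refine (norm_inner_le_norm _ _).trans ?_
    have := norm_outwardNormal_le Ω y
    nlinarith [norm_nonneg v]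

/-- The divergence theorem on a bounded Lipschitz domain. -/
theorem integral_fderiv_eq_surface (hΩ : IsBoundedLipschitz Ω) {φ : Euc d → ℝ}
    (hφ : ContDiff ℝ 1 φ) (v : Euc d) :
    ∫ y, fderiv ℝ φ y v ∂(bulk Ω) = ∫ y, φ y * inner ℝ v (outwardNormal Ω y) ∂(surface Ω) := by
  choose! r hr hloc using fun x (hx : x ∈ closure Ω) => integral_fderiv_eq_surface_of_local hΩ hx
  obtain ⟨t, ζ, htK, hζ, hsum⟩ := exists_smooth_partition hΩ.isCompact_closure r hr
  have hζ1 : ∀ x ∈ t, ContDiff ℝ 1 (fun y => ζ x y * φ y) := fun x hx =>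
    ((hζ x hx).1.of_le (by exact_mod_cast le_top)).mul hφ
  have hζs : ∀ x ∈ t, HasCompactSupport (fun y => ζ x y * φ y) := fun x hx =>
    (hζ x hx).2.1.mul_right
  have e1 : ∫ y, fderiv ℝ φ y v ∂(bulk Ω) =
      ∑ x ∈ t, ∫ y, fderiv ℝ (fun y => ζ x y * φ y) y v ∂(bulk Ω) := by
    rw [← integral_finsetSum]
    · refine setIntegral_congr_fun hΩ.isOpen.measurableSet fun y hy => ?_
      -- The partition sums to 1 only on the closure; openness of `Ω` gives the identity near `y`,
      -- as differentiation requires.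
      have h1 : φ =ᶠ[𝓝 y] fun y => ∑ x ∈ t, ζ x y * φ y := by
        filter_upwards [hΩ.isOpen.mem_nhds hy] with z hz
        rw [← Finset.sum_mul, hsum z (subset_closure hz), one_mul]
      simp only [h1.fderiv_eq]
      rw [fderiv_fun_sum fun x hx => (hζ1 x hx).differentiable one_ne_zero y]
      simp
    · intro x hx
      refine Integrable.restrict ?_
      refine Continuous.integrable_of_hasCompactSupport ?_ ?_
      · exact ((hζ1 x hx).continuous_fderiv one_ne_zero).clm_apply continuous_const
      · exact (hζs x hx).fderiv_apply ℝ v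
  have e2 : ∫ y, φ y * inner ℝ v (outwardNormal Ω y) ∂(surface Ω) =
      ∑ x ∈ t, ∫ y, ζ x y * φ y * inner ℝ v (outwardNormal Ω y) ∂(surface Ω) := by
    rw [← integral_finsetSum]
    · refine setIntegral_congr_fun isClosed_frontier.measurableSet fun y hy => ?_
      rw [← Finset.sum_mul, ← Finset.sum_mul, hsum y (frontier_subset_closure hy), one_mul]
    · exact fun x hx =>
        integrable_mul_inner_outwardNormal hΩ (hζ1 x hx).continuous.continuousOn v
  rw [e1, e2]
  refine Finset.sum_congr rfl fun x hx => ?_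
  refine hloc x (htK x hx) _ (hζ1 x hx) (hζs x hx) ?_ v
  exact (tsupport_mul_subset_left).trans (hζ x hx).2.2.1

end Domain


/-! ### Mollification -/

section Mollify

variable {d : ℕ}

/-- Convolution of `u` with the kernel `ρ`. -/
def mollify (ρ u : Euc d → ℝ) : Euc d → ℝ :=
  convolution u ρ (ContinuousLinearMap.mul ℝ ℝ) volume

theorem mollify_apply (ρ u : Euc d → ℝ) (y : Euc d) : mollify ρ u y = ∫ t, u t * ρ (y - t) :=
  convolution_mul

theorem mollify_apply_swap (ρ u : Euc d → ℝ) (y : Euc d) : mollify ρ u y = ∫ s, u (y - s) * ρ s :=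
  convolution_mul_swap

theorem contDiff_mollify {ρ u : Euc d → ℝ} (hρ : ContDiff ℝ ∞ ρ) (hs : HasCompactSupport ρ)
    (hu : LocallyIntegrable u) : ContDiff ℝ 1 (mollify ρ u) :=
  (hs.contDiff_convolution_right _ hu (hρ.of_le (by exact_mod_cast le_top)) : ContDiff ℝ (1 : ℕ∞) _)

theorem integrable_mul_comp_sub {ρ u : Euc d → ℝ} (hρ : Continuous ρ) (hs : HasCompactSupport ρ)
    (hu : LocallyIntegrable u) (y : Euc d) : Integrable fun t => u t * ρ (y - t) :=
  hs.convolutionExists_right (ContinuousLinearMap.mul ℝ ℝ) hu hρ y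

theorem fderiv_mollify {ρ u : Euc d → ℝ} (hρ : ContDiff ℝ ∞ ρ) (hs : HasCompactSupport ρ)
    (hu : LocallyIntegrable u) (y v : Euc d) :
    fderiv ℝ (mollify ρ u) y v = ∫ t, u t * fderiv ℝ ρ (y - t) v := by
  have h1 : ContDiff ℝ 1 ρ := hρ.of_le (by exact_mod_cast le_top)
  have h2 := hs.hasFDerivAt_convolution_right (ContinuousLinearMap.mul ℝ ℝ) hu h1 y
  rw [mollify, h2.fderiv, convolution_precompR_apply _ hu (hs.fderiv (𝕜 := ℝ))
    (h1.continuous_fderiv one_ne_zero)]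
  rfl

/-- Continuity of translation in $L^2$, obtained from the continuity of composition with a
continuous family of measure-preserving maps. -/
theorem tendsto_eLpNorm_translate_sub {u : Euc d → ℝ} (hu : MemLp u 2) :
    Tendsto (fun s => eLpNorm (fun y => u (y - s) - u y) 2 volume) (𝓝 (0 : Euc d)) (𝓝 0) := by
  let g : Euc d → C(Euc d, Euc d) := fun s => ⟨fun y => y - s, by fun_prop⟩
  have hg : Continuous g :=
    ContinuousMap.continuous_of_continuous_uncurry _ (by
      show Continuous fun p : Euc d × Euc d => p.2 - p.1
      fun_prop)
  have hgm : ∀ s, MeasurePreserving (g s) (volume : Measure (Euc d)) volume :=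
    fun s => measurePreserving_sub_right volume s
  have h1 : Continuous fun s => Lp.compMeasurePreserving (g s) (hgm s) (hu.toLp u) :=
    continuous_const.compMeasurePreservingLp hg hgm (by simp)
  have h2 : ∀ s, eLpNorm (fun y => u (y - s) - u y) 2 volume =
      edist (Lp.compMeasurePreserving (g s) (hgm s) (hu.toLp u)) (hu.toLp u) := by
    intro s
    rw [Lp.edist_def]
    refine eLpNorm_congr_ae ?_
    have h3 := Lp.coeFn_compMeasurePreserving (hu.toLp u) (hgm s)
    have h4 := (hgm s).quasiMeasurePreserving.ae_eq_comp hu.coeFn_toLp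
    filter_upwards [h3, h4, hu.coeFn_toLp] with y h3 h4 h5
    rw [Pi.sub_apply, h3, h4, h5]
    rfl
  simp only [h2]
  have h3 : (Lp.compMeasurePreserving (g 0) (hgm 0) (hu.toLp u)) = hu.toLp u := by
    rw [← edist_eq_zero, ← h2]
    simp
  have h4 := (h1.tendsto 0).edist (tendsto_const_nhds (x := hu.toLp u))
  rwa [h3, edist_self] at h4

theorem eLpNorm_two_sq {α E : Type*} [MeasurableSpace α] [NormedAddCommGroup E] (μ : Measure α)
    (f : α → E) : eLpNorm f 2 μ ^ 2 = ∫⁻ x, ‖f x‖ₑ ^ 2 ∂μ := by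
  have := eLpNorm_nnreal_pow_eq_lintegral (f := f) (μ := μ) (p := 2) two_ne_zero
  simpa using this

/-- The error at `y` is the average of `u (y - s) - u y` under the probability measure with density
`ρ`. Its square is at most the average of the squares, and Tonelli then leaves the translation
errors, each bounded by `η`. -/
theorem eLpNorm_mollify_sub_le {ρ u : Euc d → ℝ} (hρ : Continuous ρ) (hs : HasCompactSupport ρ)
    (h0 : ∀ s, 0 ≤ ρ s) (h1 : ∫ s, ρ s = 1) (hu : MemLp u 2) {η : ℝ≥0∞}
    (hη : ∀ s, ρ s ≠ 0 → eLpNorm (fun y => u (y - s) - u y) 2 volume ≤ η) :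
    eLpNorm (fun y => mollify ρ u y - u y) 2 volume ≤ η := by
  have hρi : Integrable ρ := hρ.integrable_of_hasCompactSupport hs
  have hul : LocallyIntegrable u := hu.locallyIntegrable (by norm_num)
  set π := (volume : Measure (Euc d)).withDensity fun s => ENNReal.ofReal (ρ s) with hπ
  have hρm : Measurable fun s => ENNReal.ofReal (ρ s) := hρ.measurable.ennreal_ofReal
  have hprob : IsProbabilityMeasure π := by
    refine ⟨?_⟩
    rw [hπ, withDensity_apply _ MeasurableSet.univ, Measure.restrict_univ,
      ← ofReal_integral_eq_lintegral_ofReal hρi (Eventually.of_forall h0), h1, ENNReal.ofReal_one]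
  have hmeas : AEStronglyMeasurable (fun p : Euc d × Euc d => u (p.1 - p.2) - u p.1)
      ((volume : Measure (Euc d)).prod π) := by
    refine AEStronglyMeasurable.sub ?_ ?_
    · exact hu.1.comp_quasiMeasurePreserving
        (quasiMeasurePreserving_sub_of_right_invariant volume π)
    · exact hu.1.comp_fst
  have hpt : ∀ᵐ y, ‖mollify ρ u y - u y‖ₑ ^ 2 ≤ ∫⁻ s, ‖u (y - s) - u y‖ₑ ^ 2 ∂π := by
    filter_upwards [hmeas.prodMk_left] with y hy
    have e1 : mollify ρ u y - u y = ∫ s, (u (y - s) - u y) * ρ s := by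
      have hi : Integrable fun s => u (y - s) * ρ s := by
        simpa using (integrable_mul_comp_sub hρ hs hul y).comp_sub_left y
      rw [mollify_apply_swap]
      simp only [sub_mul]
      rw [integral_sub hi (hρi.const_mul _), integral_const_mul, h1, mul_one]
    have e2 : ‖mollify ρ u y - u y‖ₑ ≤ ∫⁻ s, ‖u (y - s) - u y‖ₑ ∂π := by
      rw [e1, hπ, lintegral_withDensity_eq_lintegral_mul_non_measurable _ hρm
        (Eventually.of_forall fun _ => ENNReal.ofReal_lt_top)]
      refine (enorm_integral_le_lintegral_enorm _).trans_eq (lintegral_congr fun s => ?_)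
      rw [enorm_mul, Pi.mul_apply, mul_comm, Real.enorm_eq_ofReal (h0 s)]
    have e3 : ∫⁻ s, ‖u (y - s) - u y‖ₑ ∂π ≤ eLpNorm (fun s => u (y - s) - u y) 2 π := by
      rw [← eLpNorm_one_eq_lintegral_enorm]
      exact eLpNorm_le_eLpNorm_of_exponent_le (by norm_num) hy
    rw [← eLpNorm_two_sq]
    gcongr
    exact e2.trans e3
  have key : eLpNorm (fun y => mollify ρ u y - u y) 2 volume ^ 2 ≤ η ^ 2 := by
    rw [eLpNorm_two_sq]
    calc ∫⁻ y, ‖mollify ρ u y - u y‖ₑ ^ 2 ≤ ∫⁻ y, ∫⁻ s, ‖u (y - s) - u y‖ₑ ^ 2 ∂π :=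
          lintegral_mono_ae hpt
      _ = ∫⁻ s, (∫⁻ y, ‖u (y - s) - u y‖ₑ ^ 2) ∂π :=
          lintegral_lintegral_swap (hmeas.enorm.pow_const 2)
      _ ≤ ∫⁻ _, η ^ 2 ∂π := by
          refine lintegral_mono_ae ?_
          rw [hπ, ae_withDensity_iff hρm]
          refine Eventually.of_forall fun s hs => ?_
          rw [← eLpNorm_two_sq]
          gcongr
          refine hη s fun h => hs ?_
          rw [h, ENNReal.ofReal_zero]
      _ = η ^ 2 := by simp
  exact (ENNReal.pow_le_pow_left_iff two_ne_zero).1 key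

/-- Mollifiers `ρ k` concentrated in shrinking balls centred on the ray spanned by `-e`. -/
structure IsConeMollifier (e : Euc d) (δ : ℝ) (ρ : ℕ → Euc d → ℝ) : Prop where
  contDiff : ∀ k, ContDiff ℝ ∞ (ρ k)
  hasCompactSupport : ∀ k, HasCompactSupport (ρ k)
  nonneg : ∀ k s, 0 ≤ ρ k s
  integral_eq_one : ∀ k, ∫ s, ρ k s = 1
  tsupport_subset : ∀ k, ∀ s ∈ tsupport (ρ k),
    ‖s + (1 / ((k : ℝ) + 1)) • e‖ ≤ δ * (1 / ((k : ℝ) + 1))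

/-- The bumps are centred at `-e / (k + 1)`, with the minus sign because convolution evaluates at `y
- s`. The samples thus lie in the cone from `y` in the direction `e`. -/
theorem exists_isConeMollifier (e : Euc d) {δ : ℝ} (hδ : 0 < δ) :
    ∃ ρ, IsConeMollifier e δ ρ := by
  have hp : ∀ k : ℕ, 0 < δ * (1 / ((k : ℝ) + 1)) := fun k => by positivity
  let b : ∀ k : ℕ, ContDiffBump (-((1 / ((k : ℝ) + 1)) • e)) := fun k =>
    ⟨δ * (1 / ((k : ℝ) + 1)) / 2, δ * (1 / ((k : ℝ) + 1)), half_pos (hp k), half_lt_self (hp k)⟩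
  refine ⟨fun k => (b k).normed volume, fun k => (b k).contDiff_normed,
    fun k => (b k).hasCompactSupport_normed, fun k => (b k).nonneg_normed,
    fun k => (b k).integral_normed, fun k s hs => ?_⟩
  rw [(b k).tsupport_normed_eq, mem_closedBall_iff_norm, sub_neg_eq_add] at hs
  exact hs

variable {e : Euc d} {δ : ℝ} {ρ : ℕ → Euc d → ℝ}

theorem IsConeMollifier.eventually_norm_lt (hρ : IsConeMollifier e δ ρ) {η : ℝ} (hη : 0 < η) :
    ∀ᶠ k in atTop, ∀ s ∈ tsupport (ρ k), ‖s‖ < η := by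
  have h1 : Tendsto (fun k : ℕ => (δ + ‖e‖) * (1 / ((k : ℝ) + 1))) atTop (𝓝 0) := by
    simpa using (tendsto_one_div_add_atTop_nhds_zero_nat (𝕜 := ℝ)).const_mul (δ + ‖e‖)
  filter_upwards [h1.eventually (gt_mem_nhds hη)] with k hk s hs
  have h2 := hρ.tsupport_subset k s hs
  have h3 := norm_sub_le (s + (1 / ((k : ℝ) + 1)) • e) ((1 / ((k : ℝ) + 1)) • e)
  rw [add_sub_cancel_right, norm_smul, Real.norm_eq_abs, abs_of_pos (by positivity)] at h3
  calc ‖s‖ ≤ _ := h3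
    _ ≤ δ * (1 / ((k : ℝ) + 1)) + (1 / ((k : ℝ) + 1)) * ‖e‖ := by gcongr
    _ = _ := by ring
    _ < η := hk

theorem IsConeMollifier.tendsto_eLpNorm (hρ : IsConeMollifier e δ ρ) {u : Euc d → ℝ}
    (hu : MemLp u 2) :
    Tendsto (fun k => eLpNorm (fun y => mollify (ρ k) u y - u y) 2 volume) atTop (𝓝 0) := by
  rw [ENNReal.tendsto_nhds_zero]
  intro η hη
  obtain ⟨r, hr, hb⟩ := Metric.eventually_nhds_iff.1
    (ENNReal.tendsto_nhds_zero.1 (tendsto_eLpNorm_translate_sub hu) η hη)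
  filter_upwards [hρ.eventually_norm_lt hr] with k hk
  refine eLpNorm_mollify_sub_le (hρ.contDiff k).continuous (hρ.hasCompactSupport k) (hρ.nonneg k)
    (hρ.integral_eq_one k) hu fun s hs => hb ?_
  rw [dist_zero_right]
  exact hk s (subset_tsupport _ hs)

theorem IsConeMollifier.tendstoUniformly (hρ : IsConeMollifier e δ ρ) {u : Euc d → ℝ}
    (hu : UniformContinuous u) : TendstoUniformly (fun k => mollify (ρ k) u) u atTop := by
  rw [Metric.tendstoUniformly_iff]
  intro η hη
  obtain ⟨r, hr, hb⟩ := Metric.uniformContinuous_iff.1 hu (η / 2) (half_pos hη)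
  filter_upwards [hρ.eventually_norm_lt hr] with k hk y
  have hρc := (hρ.contDiff k).continuous
  have hρi : Integrable (ρ k) := hρc.integrable_of_hasCompactSupport (hρ.hasCompactSupport k)
  have hi : Integrable fun s => u (y - s) * ρ k s := by
    simpa using (integrable_mul_comp_sub hρc (hρ.hasCompactSupport k)
      hu.continuous.locallyIntegrable y).comp_sub_left y
  have e1 : mollify (ρ k) u y - u y = ∫ s, (u (y - s) - u y) * ρ k s := by
    rw [mollify_apply_swap]
    simp only [sub_mul]
    rw [integral_sub hi (hρi.const_mul _), integral_const_mul, hρ.integral_eq_one, mul_one]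
  rw [dist_comm, Real.dist_eq, e1, ← Real.norm_eq_abs]
  refine lt_of_le_of_lt (norm_integral_le_of_norm_le (hρi.const_mul (η / 2))
    (Eventually.of_forall fun s => ?_)) ?_
  · rw [norm_mul, Real.norm_eq_abs (ρ k s), abs_of_nonneg (hρ.nonneg k s)]
    by_cases hs : ρ k s = 0
    · simp [hs]
    · have h2 := hk s (subset_tsupport _ hs)
      refine mul_le_mul_of_nonneg_right (le_of_lt ?_) (hρ.nonneg k s)
      rw [← dist_eq_norm]
      exact hb (by simpa [dist_eq_norm] using h2)
  · rw [integral_const_mul, hρ.integral_eq_one]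
    linarith

end Mollify


/-! ### Inward cones -/

section Cone

variable {d : ℕ} {Ω : Set (Euc d)}

/-- Near `x` the domain contains the truncated cones of direction `e` and opening `δ` with vertex in
its closure. -/
def InwardCone (Ω : Set (Euc d)) (x e : Euc d) (δ r : ℝ) : Prop :=
  ∀ y ∈ closure Ω, y ∈ Metric.ball x r → ∀ τ : ℝ, 0 < τ → τ < r → ∀ s : Euc d,
    ‖s - τ • e‖ ≤ δ * τ → y + s ∈ Ω

theorem IsBoundedLipschitz.exists_inwardCone (hΩ : IsBoundedLipschitz Ω) {x : Euc d}
    (hx : x ∈ closure Ω) : ∃ (e : Euc d) (δ r : ℝ), 0 < δ ∧ 0 < r ∧ InwardCone Ω x e δ r := by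
  by_cases hxΩ : x ∈ Ω
  · obtain ⟨R, hR, hb⟩ := Metric.isOpen_iff.1 hΩ.isOpen x hxΩ
    -- At an interior point the direction `0` is allowed: the cone is then the ball `‖s‖ ≤ τ`.
    refine ⟨0, 1, R / 2, one_pos, half_pos hR, fun y _ hy τ hτ hτr s hs => hb ?_⟩
    rw [smul_zero, sub_zero, one_mul] at hs
    rw [mem_ball_iff_norm] at hy ⊢
    have := norm_add_le (y - x) s
    rw [show y + s - x = y - x + s by abel]
    linarith
  · have hx' : x ∈ frontier Ω := by rw [hΩ.isOpen.frontier_eq]; exact ⟨hx, hxΩ⟩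
    obtain ⟨e, he, R, K, c, hR, hc, hch⟩ := hΩ.exists_chart hx'
    -- The shift has norm at most `2τ < R / 2`, so starting within `R / 4` of `x` it stays in the
    -- chart ball.
    refine ⟨e, 1 / (K + 2), R / 4, by positivity, by positivity, fun y hy hyb τ hτ hτr s hs => ?_⟩
    have hle : (1 : ℝ) / (K + 2) ≤ 1 := by
      rw [div_le_one (by positivity)]
      linarith [K.coe_nonneg]
    have h1 : ‖s‖ ≤ 2 * τ := by
      have h2 := norm_add_le (s - τ • e) (τ • e)
      rw [sub_add_cancel, norm_smul, he, Real.norm_eq_abs, abs_of_pos hτ] at h2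
      nlinarith
    rw [mem_ball_iff_norm] at hyb
    refine add_mem_of_cone hc hch hτ hy ?_ hs ?_
    · rw [mem_ball_iff_norm]; linarith
    · rw [mem_ball_iff_norm]
      have := norm_add_le (y - x) s
      rw [show y + s - x = y - x + s by abel]
      linarith

/-- If the inequality failed, `e + δ • ν` would belong to the inward cone and yet have a positive
product with `ν`, hence point strictly outward. This transversality drives the trace inequality. -/
theorem InwardCone.inner_le {x e : Euc d} {δ r : ℝ} (hr : 0 < r) (h : InwardCone Ω x e δ r)
    {y ν : Euc d} (hy : y ∈ closure Ω) (hyr : y ∈ Metric.ball x r) (hδ : 0 ≤ δ)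
    (hν : IsOutwardNormal Ω y ν) : inner ℝ e ν ≤ -δ := by
  by_contra! hlt
  set s := e + δ • ν with hs
  have h1 : 0 < inner ℝ s ν := by
    rw [hs, inner_add_left, inner_smul_left, real_inner_self_eq_norm_sq, hν.1]
    simp only [conj_trivial]
    linarith
  have hs0 : 0 < ‖s‖ := by
    rw [norm_pos_iff]
    rintro h0
    rw [h0, inner_zero_left] at h1
    exact lt_irrefl _ h1
  obtain ⟨R, hR, hb⟩ := hν.2 (inner ℝ s ν / (2 * ‖s‖)) (by positivity)
  set τ := min (r / 2) (R / (2 * ‖s‖)) with hτ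
  have hτ0 : 0 < τ := by positivity
  have hτr : τ < r := (min_le_left _ _).trans_lt (half_lt_self hr)
  have hτR : ‖τ • s‖ < R := by
    rw [norm_smul, Real.norm_eq_abs, abs_of_pos hτ0]
    calc τ * ‖s‖ ≤ R / (2 * ‖s‖) * ‖s‖ := by gcongr; exact min_le_right _ _
      _ = R / 2 := by field_simp
      _ < R := half_lt_self hR
  have h2 := h y hy hyr τ hτ0 hτr (τ • s) (by
    rw [← smul_sub, hs, add_sub_cancel_left, norm_smul, norm_smul, hν.1, mul_one,
      Real.norm_eq_abs, Real.norm_eq_abs, abs_of_pos hτ0, abs_of_nonneg hδ, mul_comm])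
  refine (hb (y + τ • s) ?_).2 ?_ h2
  · rw [mem_ball_iff_norm, add_sub_cancel_left]; exact hτR
  · rw [add_sub_cancel_left, norm_smul, Real.norm_eq_abs, abs_of_pos hτ0, inner_smul_left]
    simp only [conj_trivial]
    have : inner ℝ s ν / (2 * ‖s‖) * (τ * ‖s‖) = τ * inner ℝ s ν / 2 := by field_simp
    rw [this]
    nlinarith

/-- At each point the closure contains the convex hull of that point and a ball of the inward cone.
This makes derivatives within the closure unique, hence the gradient on the boundary meaningful. -/
theorem IsBoundedLipschitz.uniqueDiffOn_closure (hΩ : IsBoundedLipschitz Ω) :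
    UniqueDiffOn ℝ (closure Ω) := by
  intro x hx
  obtain ⟨e, δ, r, hδ, hr, h⟩ := hΩ.exists_inwardCone hx
  set s : Set (Euc d) := convexHull ℝ (insert x (Metric.ball (x + (r / 2) • e) (δ * (r / 2))))
    with hs
  have hsub : s ⊆ closure Ω := by
    rw [hs, convexHull_insert (Metric.nonempty_ball.2 (by positivity)),
      (convex_ball _ _).convexHull_eq]
    intro z hz
    rw [convexJoin_singleton_left] at hz
    obtain ⟨w, hw, hz⟩ := mem_iUnion₂.1 hz
    rw [segment_eq_image'] at hz
    obtain ⟨θ, hθ, rfl⟩ := hz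
    rcases hθ.1.eq_or_lt with h0 | h0
    · simpa [← h0] using hx
    · refine subset_closure (h x hx (Metric.mem_ball_self hr) (θ * (r / 2)) (by positivity)
        (by nlinarith [hθ.2]) _ ?_)
      rw [mem_ball_iff_norm] at hw
      rw [mul_smul, ← smul_sub, norm_smul, Real.norm_eq_abs, abs_of_pos h0,
        show w - x - (r / 2) • e = w - (x + (r / 2) • e) by abel]
      nlinarith
  refine UniqueDiffWithinAt.mono (uniqueDiffWithinAt_convex (convex_convexHull ℝ _) ?_ ?_) hsub
  · refine ⟨x + (r / 2) • e, ?_⟩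
    rw [mem_interior]
    exact ⟨_, (subset_insert _ _).trans (subset_convexHull ℝ _), Metric.isOpen_ball,
      Metric.mem_ball_self (by positivity)⟩
  · exact subset_closure (subset_convexHull ℝ _ (mem_insert _ _))

/-- The value of `outwardNormal` is either a normal or `0`. Almost everywhere it equals a graph
normal, which has norm 1, so the default value is excluded. -/
theorem ae_isOutwardNormal (hΩ : IsBoundedLipschitz Ω) :
    ∀ᵐ y ∂(surface Ω), IsOutwardNormal Ω y (outwardNormal Ω y) := by
  rw [surface, ae_restrict_iff' isClosed_frontier.measurableSet, ae_iff]
  refine measure_null_of_locally_null _ fun x hx => ?_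
  simp only [Classical.not_imp, mem_ofPred_eq] at hx
  obtain ⟨e, he, r, K, c, hr, hc, hch⟩ := hΩ.exists_chart hx.1
  have h1 := outwardNormal_ae_eq hΩ.isOpen hc hch
  rw [surface, Measure.restrict_restrict Metric.isOpen_ball.measurableSet, Filter.EventuallyEq,
    ae_restrict_iff' (Metric.isOpen_ball.measurableSet.inter isClosed_frontier.measurableSet),
    ae_iff] at h1
  refine ⟨_, inter_mem_nhdsWithin _ (Metric.ball_mem_nhds x hr), measure_mono_null ?_ h1⟩
  rintro y ⟨hy, hyb⟩
  simp only [Classical.not_imp, mem_ofPred_eq] at hy ⊢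
  refine ⟨⟨hyb, hy.1⟩, fun heq => hy.2 ?_⟩
  have hn : ‖outwardNormal Ω y‖ = 1 := by rw [heq, norm_graphNormal he]
  rw [outwardNormal] at hn ⊢
  split_ifs with hex
  · exact hex.choose_spec
  · rw [dif_neg hex, norm_zero] at hn
    exact absurd hn (by norm_num)

end Cone

/-! ### Smoothing up to the boundary -/

section Smoothing

variable {d : ℕ} {Ω : Set (Euc d)}

/-- `D` is the weak divergence of the field with components `X j` on `Ω`. -/
def IsWeakDivergence (Ω : Set (Euc d)) (X : Fin d → Euc d → ℝ) (D : Euc d → ℝ) : Prop :=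
  ∀ φ : Euc d → ℝ, ContDiff ℝ ∞ φ → HasCompactSupport φ → tsupport φ ⊆ Ω →
    ∫ x, ∑ j, X j x * fderiv ℝ φ x (EuclideanSpace.single j 1) ∂(bulk Ω)
      = -∫ x, φ x * D x ∂(bulk Ω)

variable {x e : Euc d} {δ r : ℝ} {ρ : ℕ → Euc d → ℝ} {ζ : Euc d → ℝ}

/-- For large `k` the point `y` is close to the support of `ζ`, hence in the cone region, and `t -
y` lies in the inward cone. Thus mollification near the boundary samples only inside `Ω`, even for
`y` on the frontier. -/
theorem IsConeMollifier.eventually_mem (hρ : IsConeMollifier e δ ρ) (hr : 0 < r)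
    (hcone : InwardCone Ω x e δ r) (hζc : HasCompactSupport ζ)
    (hζ : tsupport ζ ⊆ Metric.ball x r) : ∀ᶠ k in atTop, ∀ y ∈ closure Ω, ∀ t ∈ tsupport ζ,
      y - t ∈ tsupport (ρ k) → t ∈ Ω := by
  obtain ⟨η, hη, hsub⟩ := hζc.isCompact.exists_thickening_subset_open Metric.isOpen_ball hζ
  have h1 : ∀ᶠ k : ℕ in atTop, 1 / ((k : ℝ) + 1) < r :=
    (tendsto_one_div_add_atTop_nhds_zero_nat (𝕜 := ℝ)).eventually (gt_mem_nhds hr)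
  filter_upwards [hρ.eventually_norm_lt hη, h1] with k hk hkr y hy t ht hyt
  have hyb : y ∈ Metric.ball x r := by
    refine hsub (Metric.mem_thickening_iff.2 ⟨t, ht, ?_⟩)
    rw [dist_eq_norm]
    exact hk _ hyt
  have h2 := hcone y hy hyb (1 / ((k : ℝ) + 1)) (by positivity) hkr (t - y) (by
    rw [← norm_neg, show -(t - y - (1 / ((k : ℝ) + 1)) • e)
      = y - t + (1 / ((k : ℝ) + 1)) • e by abel]
    exact hρ.tsupport_subset k _ hyt)
  rwa [add_sub_cancel] at h2

theorem memLp_indicator_mul (hΩ : IsOpen Ω) (hζ : Continuous ζ) (hζc : HasCompactSupport ζ)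
    {u : Euc d → ℝ} (hu : MemLp u 2 (bulk Ω)) :
    MemLp (Ω.indicator fun y => ζ y * u y) 2 := by
  rw [memLp_indicator_iff_restrict hΩ.measurableSet]
  exact hu.mul ((hζ.memLp_of_hasCompactSupport hζc (p := ⊤) (μ := volume)).restrict Ω)

theorem integral_indicator_mul_eq (hΩ : IsOpen Ω) (u w : Euc d → ℝ) :
    ∫ t, Ω.indicator u t * w t = ∫ t, u t * w t ∂(bulk Ω) := by
  rw [bulk, ← integral_indicator hΩ.measurableSet]
  congr 1
  funext t
  by_cases ht : t ∈ Ω <;> simp [ht]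

/-- The definition of weak divergence is tested with `t ↦ ζ t * κ (y - t)`, which `hy` places inside
`Ω`. The derivative in `t` falls on `κ` with a minus sign, giving the derivative in `y`, or on `ζ`,
giving the commutator terms. -/
theorem fderiv_mollify_weakDivergence (hΩ : IsOpen Ω) (hζ : ContDiff ℝ ∞ ζ)
    (hζc : HasCompactSupport ζ) {κ : Euc d → ℝ} (hκ : ContDiff ℝ ∞ κ) (hκc : HasCompactSupport κ)
    {X : Fin d → Euc d → ℝ} {D : Euc d → ℝ} (hX : ∀ j, MemLp (X j) 2 (bulk Ω))
    (hXD : IsWeakDivergence Ω X D) {y : Euc d}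
    (hy : ∀ t ∈ tsupport ζ, y - t ∈ tsupport κ → t ∈ Ω) :
    ∑ j, fderiv ℝ (mollify κ (Ω.indicator fun z => ζ z * X j z)) y (EuclideanSpace.single j 1) =
      mollify κ (Ω.indicator fun z => ζ z * D z) y + ∑ j, mollify κ
        (Ω.indicator fun z => fderiv ℝ ζ z (EuclideanSpace.single j 1) * X j z) y := by
  have hζ1 : ContDiff ℝ 1 ζ := hζ.of_le (by exact_mod_cast le_top)
  have hκ1 : ContDiff ℝ 1 κ := hκ.of_le (by exact_mod_cast le_top)
  have hdζ : ∀ j : Fin d, Continuous fun z => fderiv ℝ ζ z (EuclideanSpace.single j 1) := fun j =>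
    (hζ1.continuous_fderiv one_ne_zero).clm_apply continuous_const
  have hdζc : ∀ j : Fin d, HasCompactSupport fun z =>
    fderiv ℝ ζ z (EuclideanSpace.single j (1 : ℝ)) := fun j => hζc.fderiv_apply ℝ _
  have hdκ : ∀ j : Fin d, Continuous fun z => fderiv ℝ κ z (EuclideanSpace.single j 1) := fun j =>
    (hκ1.continuous_fderiv one_ne_zero).clm_apply continuous_const
  have hdκc : ∀ j : Fin d, HasCompactSupport fun z =>
    fderiv ℝ κ z (EuclideanSpace.single j (1 : ℝ)) := fun j => hκc.fderiv_apply ℝ _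
  have hl : ∀ (w u : Euc d → ℝ), Continuous w → HasCompactSupport w → MemLp u 2 (bulk Ω) →
      LocallyIntegrable (Ω.indicator fun z => w z * u z) := fun w u hw hwc hu =>
    (memLp_indicator_mul hΩ hw hwc hu).locallyIntegrable (by norm_num)
  have hI : ∀ (w u κ' : Euc d → ℝ), Continuous w → HasCompactSupport w → MemLp u 2 (bulk Ω) →
      Continuous κ' → HasCompactSupport κ' →
      Integrable (fun t => w t * u t * κ' (y - t)) (bulk Ω) := fun w u κ' hw hwc hu h1 h2 => by
    have := integrable_mul_comp_sub h1 h2 (hl w u hw hwc hu) y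
    refine (this.restrict (s := Ω)).congr ?_
    filter_upwards [ae_restrict_mem hΩ.measurableSet] with t ht
    rw [indicator_of_mem ht]
  set ψ : Euc d → ℝ := fun t => ζ t * κ (y - t) with hψ
  have hψs : ContDiff ℝ ∞ ψ := hζ.mul (hκ.comp (contDiff_const.sub contDiff_id))
  have hψc : HasCompactSupport ψ := hζc.mul_right
  have hψt : tsupport ψ ⊆ Ω := by
    intro t ht
    refine hy t (tsupport_mul_subset_left ht) ?_
    have h1 : t ∈ tsupport fun t => κ (y - t) := tsupport_mul_subset_right ht
    exact tsupport_comp_subset_preimage κ (continuous_const.sub continuous_id) h1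
  have hψd : ∀ t v, fderiv ℝ ψ t v = fderiv ℝ ζ t v * κ (y - t) - ζ t * fderiv ℝ κ (y - t) v := by
    intro t v
    have h1 : HasFDerivAt ζ (fderiv ℝ ζ t) t := (hζ1.differentiable one_ne_zero t).hasFDerivAt
    have h2 : HasFDerivAt (fun t => κ (y - t))
        ((fderiv ℝ κ (y - t)).comp (-ContinuousLinearMap.id ℝ (Euc d))) t :=
      (hκ1.differentiable one_ne_zero (y - t)).hasFDerivAt.comp t ((hasFDerivAt_id t).const_sub y)
    have h3 : fderiv ℝ ψ t = _ := (h1.mul h2).fderiv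
    rw [h3]
    simp
    ring
  have key := hXD ψ hψs hψc hψt
  have e1 : ∀ j, fderiv ℝ (mollify κ (Ω.indicator fun z => ζ z * X j z)) y
      (EuclideanSpace.single j 1) =
      ∫ t, ζ t * X j t * fderiv ℝ κ (y - t) (EuclideanSpace.single j 1) ∂(bulk Ω) := fun j => by
    rw [fderiv_mollify hκ hκc (hl _ _ hζ.continuous hζc (hX j)),
      integral_indicator_mul_eq hΩ _ fun t => fderiv ℝ κ (y - t) (EuclideanSpace.single j 1)]
  have e2 : mollify κ (Ω.indicator fun z => ζ z * D z) y = ∫ t, ψ t * D t ∂(bulk Ω) := by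
    rw [mollify_apply, integral_indicator_mul_eq hΩ _ fun t => κ (y - t)]
    congr 1
    funext t
    rw [hψ]
    ring
  have e3 : ∀ j, mollify κ (Ω.indicator fun z => fderiv ℝ ζ z (EuclideanSpace.single j 1) * X j z) y
      = ∫ t, fderiv ℝ ζ t (EuclideanSpace.single j 1) * X j t * κ (y - t) ∂(bulk Ω) := fun j => by
    rw [mollify_apply, integral_indicator_mul_eq hΩ _ fun t => κ (y - t)]
  simp only [e1, e2, e3]
  have e4 : ∫ t, ∑ j, X j t * fderiv ℝ ψ t (EuclideanSpace.single j 1) ∂(bulk Ω) =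
      ∑ j, (∫ t, fderiv ℝ ζ t (EuclideanSpace.single j 1) * X j t * κ (y - t) ∂(bulk Ω) -
        ∫ t, ζ t * X j t * fderiv ℝ κ (y - t) (EuclideanSpace.single j 1) ∂(bulk Ω)) := by
    have h1 : ∀ j t, X j t * fderiv ℝ ψ t (EuclideanSpace.single j 1) =
        fderiv ℝ ζ t (EuclideanSpace.single j 1) * X j t * κ (y - t) -
          ζ t * X j t * fderiv ℝ κ (y - t) (EuclideanSpace.single j 1) := fun j t => by
      rw [hψd]; ring
    simp only [h1]
    rw [integral_finsetSum]
    · refine Finset.sum_congr rfl fun j _ => integral_sub ?_ ?_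
      · exact hI _ _ _ (hdζ j) (hdζc j) (hX j) hκ.continuous hκc
      · exact hI _ _ _ hζ.continuous hζc (hX j) (hdκ j) (hdκc j)
    · intro j _
      exact (hI _ _ _ (hdζ j) (hdζc j) (hX j) hκ.continuous hκc).sub
        (hI _ _ _ hζ.continuous hζc (hX j) (hdκ j) (hdκc j))
  rw [e4, Finset.sum_sub_distrib] at key
  linarith

/-- Extend `u` continuously to the whole space. The product with `ζ` is uniformly continuous, and
for large `k` the mollification at points of the closure does not see whether the integrand was cut
off outside `Ω`. -/
theorem IsConeMollifier.tendstoUniformlyOn_mollify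
    (hρ : IsConeMollifier e δ ρ) (hr : 0 < r) (hcone : InwardCone Ω x e δ r)
    (hζcont : Continuous ζ) (hζc : HasCompactSupport ζ) (hζ : tsupport ζ ⊆ Metric.ball x r)
    {u : Euc d → ℝ} (hu : ContinuousOn u (closure Ω)) :
    TendstoUniformlyOn (fun k => mollify (ρ k) (Ω.indicator fun y => ζ y * u y))
      (fun y => ζ y * u y) atTop (closure Ω) := by
  obtain ⟨g, hg⟩ := ContinuousMap.exists_restrict_eq (Y := ℝ) (isClosed_closure (s := Ω))
    ⟨(closure Ω).domRestrict u, hu.domRestrict⟩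
  have hgu : ∀ y ∈ closure Ω, g y = u y := fun y hy =>
    congrArg (fun f : C(closure Ω, ℝ) => f ⟨y, hy⟩) hg
  have huc : UniformContinuous fun y => ζ y * g y :=
    hζc.mul_right.uniformContinuous_of_continuous (hζcont.mul g.continuous)
  have h1 := (hρ.tendstoUniformly huc).tendstoUniformlyOn (s := closure Ω)
  refine (h1.congr ?_).congr_right fun y hy => by simp only [hgu y hy]
  filter_upwards [hρ.eventually_mem hr hcone hζc hζ] with k hk y hy
  simp only [mollify_apply]
  congr 1
  funext t
  by_cases ht : t ∈ Ω
  · rw [indicator_of_mem ht, hgu t (subset_closure ht)]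
  · rw [indicator_of_notMem ht, zero_mul]
    by_cases hz : t ∈ tsupport ζ
    · have h2 : y - t ∉ tsupport (ρ k) := fun h => ht (hk y hy t hz h)
      rw [image_eq_zero_of_notMem_tsupport h2, mul_zero]
    · rw [image_eq_zero_of_notMem_tsupport hz, zero_mul, zero_mul]

theorem IsConeMollifier.tendsto_eLpNorm_bulk (hΩ : IsOpen Ω) (hρ : IsConeMollifier e δ ρ)
    (hζ : Continuous ζ) (hζc : HasCompactSupport ζ) {u : Euc d → ℝ} (hu : MemLp u 2 (bulk Ω)) :
    Tendsto (fun k => eLpNorm (fun y => mollify (ρ k) (Ω.indicator fun y => ζ y * u y) y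
      - ζ y * u y) 2 (bulk Ω)) atTop (𝓝 0) := by
  refine tendsto_of_tendsto_of_tendsto_of_le_of_le tendsto_const_nhds
    (hρ.tendsto_eLpNorm (memLp_indicator_mul hΩ hζ hζc hu)) (fun _ => bot_le) fun k => ?_
  refine le_trans (le_of_eq (eLpNorm_congr_ae ?_)) (eLpNorm_mono_measure _ Measure.restrict_le_self)
  filter_upwards [ae_restrict_mem hΩ.measurableSet] with y hy
  rw [indicator_of_mem hy]

end Smoothing


/-! ### Gluing the local smoothings. -/

section GlobalSmoothing

variable {d : ℕ} {Ω : Set (Euc d)}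

theorem tendsto_eLpNorm_finset_sum {α ι : Type*} [MeasurableSpace α] {μ : Measure α}
    {t : Finset ι} {f : ι → ℕ → α → ℝ} (hm : ∀ i ∈ t, ∀ k, AEStronglyMeasurable (f i k) μ)
    (h : ∀ i ∈ t, Tendsto (fun k => eLpNorm (f i k) 2 μ) atTop (𝓝 0)) :
    Tendsto (fun k => eLpNorm (fun x => ∑ i ∈ t, f i k x) 2 μ) atTop (𝓝 0) := by
  have h1 : Tendsto (fun k => ∑ i ∈ t, eLpNorm (f i k) 2 μ) atTop (𝓝 0) := by
    simpa using tendsto_finsetSum t h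
  refine tendsto_of_tendsto_of_tendsto_of_le_of_le tendsto_const_nhds h1 (fun _ => bot_le)
    fun k => ?_
  have h2 := eLpNorm_sum_le (p := 2) (μ := μ) (f := fun i => f i k) (s := t)
    (fun i hi => hm i hi k) (by norm_num)
  refine le_trans (le_of_eq ?_) h2
  congr 1
  funext x
  simp

/-- Simultaneous smoothing of functions on a bounded Lipschitz domain, compatible with `L²` limits,
uniform limits and weak divergences. -/
theorem exists_smoothing (hΩ : IsBoundedLipschitz Ω) :
    ∃ P : ℕ → (Euc d → ℝ) → Euc d → ℝ, (∀ k, P k 0 = 0) ∧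
      (∀ k u, MemLp u 2 (bulk Ω) → ContDiff ℝ 1 (P k u)) ∧
      (∀ u, MemLp u 2 (bulk Ω) →
        Tendsto (fun k => eLpNorm (fun y => P k u y - u y) 2 (bulk Ω)) atTop (𝓝 0)) ∧
      (∀ u, ContinuousOn u (closure Ω) →
        TendstoUniformlyOn (fun k => P k u) u atTop (closure Ω)) ∧
      ∀ (X : Fin d → Euc d → ℝ) (D : Euc d → ℝ), (∀ j, MemLp (X j) 2 (bulk Ω)) →
        MemLp D 2 (bulk Ω) → IsWeakDivergence Ω X D →
        Tendsto (fun k => eLpNorm (fun y =>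
          ∑ j, fderiv ℝ (P k (X j)) y (EuclideanSpace.single j 1) - D y) 2 (bulk Ω))
          atTop (𝓝 0) := by
  choose! e δ r hδ hr hcone using fun x (hx : x ∈ closure Ω) => hΩ.exists_inwardCone hx
  obtain ⟨t, ζ, htK, hζ, hsum⟩ := exists_smooth_partition hΩ.isCompact_closure r hr
  choose! ρ hρ using fun x (hx : x ∈ closure Ω) => exists_isConeMollifier (e x) (hδ x hx)
  have hrho : ∀ x ∈ t, IsConeMollifier (e x) (δ x) (ρ x) := fun x hx => hρ x (htK x hx)
  have hO := hΩ.isOpen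
  have hζ1 : ∀ x ∈ t, ContDiff ℝ 1 (ζ x) := fun x hx =>
    (hζ x hx).1.of_le (by exact_mod_cast le_top)
  let m : Euc d → ℕ → (Euc d → ℝ) → (Euc d → ℝ) → Euc d → ℝ := fun x k w u =>
    mollify (ρ x k) (Ω.indicator fun z => w z * u z)
  have hl : ∀ (w u : Euc d → ℝ), Continuous w → HasCompactSupport w → MemLp u 2 (bulk Ω) →
      LocallyIntegrable (Ω.indicator fun z => w z * u z) := fun w u hw hwc hu =>
    (memLp_indicator_mul hO hw hwc hu).locallyIntegrable (by norm_num)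
  have hmd : ∀ x ∈ t, ∀ k (w u : Euc d → ℝ), Continuous w → HasCompactSupport w →
      MemLp u 2 (bulk Ω) → ContDiff ℝ 1 (m x k w u) := fun x hx k w u hw hwc hu =>
    contDiff_mollify ((hrho x hx).contDiff k) ((hrho x hx).hasCompactSupport k) (hl w u hw hwc hu)
  have hmm : ∀ x ∈ t, ∀ (w u : Euc d → ℝ), Continuous w → HasCompactSupport w →
      MemLp u 2 (bulk Ω) → ∀ k,
      AEStronglyMeasurable (fun y => m x k w u y - w y * u y) (bulk Ω) :=
    fun x hx w u hw hwc hu k => (hmd x hx k w u hw hwc hu).continuous.aestronglyMeasurable.sub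
      (hw.aestronglyMeasurable.mul hu.1)
  have hmt : ∀ x ∈ t, ∀ (w u : Euc d → ℝ), Continuous w → HasCompactSupport w →
      MemLp u 2 (bulk Ω) →
      Tendsto (fun k => eLpNorm (fun y => m x k w u y - w y * u y) 2 (bulk Ω)) atTop (𝓝 0) :=
    fun x hx w u hw hwc hu => (hrho x hx).tendsto_eLpNorm_bulk hO hw hwc hu
  refine ⟨fun k u y => ∑ x ∈ t, m x k (ζ x) u y, fun k => ?_, fun k u hu => ?_, fun u hu => ?_,
    fun u hu => ?_, fun X D hX hD hXD => ?_⟩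
  · funext y
    refine Finset.sum_eq_zero fun x _ => ?_
    simp [m, mollify_apply]
  · exact ContDiff.sum fun x hx => hmd x hx k _ u (hζ x hx).1.continuous (hζ x hx).2.1 hu
  · refine (tendsto_eLpNorm_finset_sum (t := t) (μ := bulk Ω)
      (f := fun x k y => m x k (ζ x) u y - ζ x y * u y)
      (fun x hx => hmm x hx _ u (hζ x hx).1.continuous (hζ x hx).2.1 hu)
      (fun x hx => hmt x hx _ u (hζ x hx).1.continuous (hζ x hx).2.1 hu)).congr fun k => ?_
    refine eLpNorm_congr_ae ?_
    filter_upwards [ae_restrict_mem hO.measurableSet] with y hy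
    rw [Finset.sum_sub_distrib, ← Finset.sum_mul, hsum y (subset_closure hy), one_mul]
  · have h1 : ∀ s : Finset (Euc d), s ⊆ t → TendstoUniformlyOn
        (fun k y => ∑ x ∈ s, m x k (ζ x) u y) (fun y => ∑ x ∈ s, ζ x y * u y) atTop
        (closure Ω) := by
      intro s
      classical
      induction s using Finset.induction_on with
      | empty =>
        intro _
        simp only [Finset.sum_empty]
        exact Metric.tendstoUniformlyOn_iff.2 fun ε hε => Eventually.of_forall fun _ y _ => by
          simpa using hε
      | insert a s ha ih =>
        intro hs
        simp only [Finset.sum_insert ha]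
        have hat := hs (Finset.mem_insert_self a s)
        exact ((hrho a hat).tendstoUniformlyOn_mollify (hr a (htK a hat)) (hcone a (htK a hat))
          (hζ a hat).1.continuous (hζ a hat).2.1 (hζ a hat).2.2.1 hu).add
          (ih ((Finset.subset_insert a s).trans hs))
    refine (h1 t subset_rfl).congr_right fun y hy => ?_
    simp only
    rw [← Finset.sum_mul, hsum y hy, one_mul]
  · let dζ : Euc d → Fin d → Euc d → ℝ := fun x j z =>
      fderiv ℝ (ζ x) z (EuclideanSpace.single j 1)
    have hdζ : ∀ x ∈ t, ∀ j, Continuous (dζ x j) := fun x hx j =>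
      ((hζ1 x hx).continuous_fderiv one_ne_zero).clm_apply continuous_const
    have hdζc : ∀ x ∈ t, ∀ j, HasCompactSupport (dζ x j) := fun x hx j =>
      (hζ x hx).2.1.fderiv_apply ℝ _
    -- The cutoffs sum to 1 on the open set `Ω`, so their derivatives sum to 0 there. This is why
    -- the commutator terms disappear in the limit.
    have hdsum : ∀ y ∈ Ω, ∀ j, ∑ x ∈ t, dζ x j y = 0 := by
      intro y hy j
      have h1 : (fun z => ∑ x ∈ t, ζ x z) =ᶠ[𝓝 y] fun _ => (1 : ℝ) := by
        filter_upwards [hO.mem_nhds hy] with z hz using hsum z (subset_closure hz)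
      have h2 := h1.fderiv_eq (𝕜 := ℝ)
      rw [fderiv_fun_sum fun x hx => (hζ1 x hx).differentiable one_ne_zero y, fderiv_fun_const] at h2
      have h3 := congrArg (fun L : Euc d →L[ℝ] ℝ => L (EuclideanSpace.single j 1)) h2
      simpa using h3
    have hev : ∀ᶠ k in atTop, ∀ x ∈ t, ∀ y ∈ closure Ω, ∀ s ∈ tsupport (ζ x),
        y - s ∈ tsupport (ρ x k) → s ∈ Ω := by
      rw [Filter.eventually_all_finset]
      exact fun x hx => (hrho x hx).eventually_mem (hr x (htK x hx)) (hcone x (htK x hx))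
        (hζ x hx).2.1 (hζ x hx).2.2.1
    -- The subtracted terms `dζ x j * X j` sum to zero over `x`, so subtracting them costs nothing
    -- and turns the whole error into a sum of mollification errors.
    have hA := tendsto_eLpNorm_finset_sum (t := t) (μ := bulk Ω)
      (f := fun x k y => (m x k (ζ x) D y - ζ x y * D y) +
        ∑ j, (m x k (dζ x j) (X j) y - dζ x j y * X j y))
      (fun x hx k => (hmm x hx _ D (hζ x hx).1.continuous (hζ x hx).2.1 hD k).add
        (Finset.aestronglyMeasurable_fun_sum _ fun j _ =>
          hmm x hx _ (X j) (hdζ x hx j) (hdζc x hx j) (hX j) k))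
      (fun x hx => ?_)
    · refine hA.congr' ?_
      filter_upwards [hev] with k hk
      refine eLpNorm_congr_ae ?_
      filter_upwards [ae_restrict_mem hO.measurableSet] with y hy
      have e1 : ∀ j, fderiv ℝ (fun y => ∑ x ∈ t, m x k (ζ x) (X j) y) y
          (EuclideanSpace.single j 1) =
          ∑ x ∈ t, fderiv ℝ (m x k (ζ x) (X j)) y (EuclideanSpace.single j 1) := by
        intro j
        rw [fderiv_fun_sum fun x hx => (hmd x hx k _ (X j) (hζ x hx).1.continuous
          (hζ x hx).2.1 (hX j)).differentiable one_ne_zero y]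
        simp
      have e2 : ∀ x ∈ t, ∑ j, fderiv ℝ (m x k (ζ x) (X j)) y (EuclideanSpace.single j 1) =
          m x k (ζ x) D y + ∑ j, m x k (dζ x j) (X j) y := fun x hx =>
        fderiv_mollify_weakDivergence hO (hζ x hx).1 (hζ x hx).2.1 ((hrho x hx).contDiff k)
          ((hrho x hx).hasCompactSupport k) hX hXD (hk x hx y (subset_closure hy))
      simp only [e1]
      rw [Finset.sum_comm, Finset.sum_congr rfl e2]
      simp only [Finset.sum_add_distrib, Finset.sum_sub_distrib]
      rw [← Finset.sum_mul, hsum y (subset_closure hy), one_mul]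
      have e3 : ∑ x ∈ t, ∑ j, dζ x j y * X j y = 0 := by
        rw [Finset.sum_comm]
        refine Finset.sum_eq_zero fun j _ => ?_
        rw [← Finset.sum_mul, hdsum y hy j, zero_mul]
      rw [e3]
      ring
    · have h1 := hmt x hx _ D (hζ x hx).1.continuous (hζ x hx).2.1 hD
      have h2 := tendsto_eLpNorm_finset_sum (t := Finset.univ) (μ := bulk Ω)
        (f := fun j k y => m x k (dζ x j) (X j) y - dζ x j y * X j y)
        (fun j _ => hmm x hx _ (X j) (hdζ x hx j) (hdζc x hx j) (hX j))
        (fun j _ => hmt x hx _ (X j) (hdζ x hx j) (hdζc x hx j) (hX j))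
      have h3 := h1.add h2
      rw [add_zero] at h3
      refine tendsto_of_tendsto_of_tendsto_of_le_of_le tendsto_const_nhds h3 (fun _ => bot_le)
        fun k => ?_
      exact eLpNorm_add_le (hmm x hx _ D (hζ x hx).1.continuous (hζ x hx).2.1 hD k)
        (Finset.aestronglyMeasurable_fun_sum _ fun j _ =>
          hmm x hx _ (X j) (hdζ x hx j) (hdζc x hx j) (hX j) k) (by norm_num)

end GlobalSmoothing


/-! ### Continuously differentiable functions as elements of `H¹` -/

section Sobolev

variable {d : ℕ} {Ω : Set (Euc d)} {w : Euc d → ℝ}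

theorem inner_gradient_eq (w : Euc d → ℝ) (x v : Euc d) : inner ℝ (∇ w x) v = fderiv ℝ w x v := by
  rw [gradient, InnerProductSpace.toDual_symm_apply]

theorem gradient_apply_eq (w : Euc d → ℝ) (x : Euc d) (i : Fin d) :
    ∇ w x i = fderiv ℝ w x (EuclideanSpace.single i 1) := by
  rw [← inner_gradient_eq, EuclideanSpace.inner_single_right]
  simp

theorem norm_gradient (w : Euc d → ℝ) (x : Euc d) : ‖∇ w x‖ = ‖fderiv ℝ w x‖ := by
  rw [gradient, LinearIsometryEquiv.norm_map]

theorem memLp_bulk_of_bounded {E : Type*} [NormedAddCommGroup E] {f : Euc d → E} {p : ℝ≥0∞}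
    (hΩ : IsBoundedLipschitz Ω) (hf : ContinuousOn f Ω) {C : ℝ} (hC : ∀ x ∈ Ω, ‖f x‖ ≤ C) :
    MemLp f p (bulk Ω) := by
  have := isFiniteMeasure_bulk hΩ
  refine MemLp.of_bound (hf.aestronglyMeasurable hΩ.isOpen.measurableSet) C ?_
  filter_upwards [ae_restrict_mem hΩ.isOpen.measurableSet] with x hx using hC x hx

theorem memLp_bulk_of_continuousOn_closure {E : Type*} [NormedAddCommGroup E] {f : Euc d → E}
    {p : ℝ≥0∞} (hΩ : IsBoundedLipschitz Ω) (hf : ContinuousOn f (closure Ω)) :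
    MemLp f p (bulk Ω) := by
  obtain ⟨C, hC⟩ := hΩ.isCompact_closure.exists_bound_of_continuousOn hf
  exact memLp_bulk_of_bounded hΩ (hf.mono subset_closure) fun x hx => hC x (subset_closure hx)

theorem memLp_surface_of_continuousOn_closure {E : Type*} [NormedAddCommGroup E] {f : Euc d → E}
    {p : ℝ≥0∞} (hΩ : IsBoundedLipschitz Ω) (hf : ContinuousOn f (closure Ω)) :
    MemLp f p (surface Ω) := by
  have := hΩ.isFiniteMeasure_surface
  obtain ⟨C, hC⟩ := hΩ.isCompact_closure.exists_bound_of_continuousOn hf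
  refine MemLp.of_bound ((hf.mono frontier_subset_closure).aestronglyMeasurable
    isClosed_frontier.measurableSet) C ?_
  filter_upwards [ae_restrict_mem isClosed_frontier.measurableSet] with x hx
    using hC x (frontier_subset_closure hx)

theorem fderivWithin_closure_of_mem (hΩ : IsOpen Ω) {x : Euc d} (hx : x ∈ Ω) :
    fderivWithin ℝ w (closure Ω) x = fderiv ℝ w x :=
  fderivWithin_of_mem_nhds (mem_of_superset (hΩ.mem_nhds hx) subset_closure)

theorem continuousOn_fderivWithin_closure (hΩ : IsBoundedLipschitz Ω)
    (hw : ContDiffOn ℝ 1 w (closure Ω)) :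
    ContinuousOn (fderivWithin ℝ w (closure Ω)) (closure Ω) :=
  hw.continuousOn_fderivWithin hΩ.uniqueDiffOn_closure le_rfl

theorem exists_bound_fderiv (hΩ : IsBoundedLipschitz Ω) (hw : ContDiffOn ℝ 1 w (closure Ω)) :
    ∃ C, ∀ x ∈ Ω, ‖fderiv ℝ w x‖ ≤ C := by
  obtain ⟨C, hC⟩ := hΩ.isCompact_closure.exists_bound_of_continuousOn
    (continuousOn_fderivWithin_closure hΩ hw)
  exact ⟨C, fun x hx => fderivWithin_closure_of_mem (w := w) hΩ.isOpen hx ▸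
    hC x (subset_closure hx)⟩

theorem continuousOn_gradient (hΩ : IsOpen Ω) (hw : ContDiffOn ℝ 1 w Ω) :
    ContinuousOn (∇ w) Ω :=
  (InnerProductSpace.toDual ℝ (Euc d)).symm.continuous.comp_continuousOn
    (hw.continuousOn_fderiv_of_isOpen hΩ le_rfl)

theorem memLp_gradient (hΩ : IsBoundedLipschitz Ω) (hw : ContDiffOn ℝ 1 w (closure Ω))
    {p : ℝ≥0∞} : MemLp (∇ w) p (bulk Ω) := by
  obtain ⟨C, hC⟩ := exists_bound_fderiv hΩ hw
  exact memLp_bulk_of_bounded hΩ (continuousOn_gradient hΩ.isOpen (hw.mono subset_closure))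
    fun x hx => (norm_gradient w x).trans_le (hC x hx)

theorem integrable_mul_of_tsupport_subset (hΩ : IsOpen Ω) {f φ : Euc d → ℝ}
    (hf : ContinuousOn f Ω) (hφ : Continuous φ) (hc : HasCompactSupport φ) (hs : tsupport φ ⊆ Ω) :
    Integrable (fun x => f x * φ x) (bulk Ω) := by
  refine (Continuous.integrable_of_hasCompactSupport (continuous_of_tsupport fun x hx => ?_)
    hc.mul_left).restrict
  exact (hf.continuousAt (hΩ.mem_nhds (hs (tsupport_mul_subset_right hx)))).mul hφ.continuousAt

/-- Integration by parts against a compactly supported function. -/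
theorem integral_mul_fderiv_eq_neg (hΩ : IsOpen Ω) (hw : ContDiffOn ℝ 1 w Ω) {φ : Euc d → ℝ}
    (hφ : ContDiff ℝ 1 φ) (hc : HasCompactSupport φ) (hs : tsupport φ ⊆ Ω) (v : Euc d) :
    ∫ x, w x * fderiv ℝ φ x v ∂(bulk Ω) = -∫ x, φ x * fderiv ℝ w x v ∂(bulk Ω) := by
  have hwx : ∀ x ∈ Ω, ContDiffAt ℝ 1 w x := fun x hx => hw.contDiffAt (hΩ.mem_nhds hx)
  have hφw : ContDiff ℝ 1 fun x => φ x * w x := by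
    refine contDiff_iff_contDiffAt.2 fun x => ?_
    by_cases hx : x ∈ tsupport φ
    · exact hφ.contDiffAt.mul (hwx x (hs hx))
    · refine (contDiffAt_const (c := (0 : ℝ))).congr_of_eventuallyEq ?_
      filter_upwards [notMem_tsupport_iff_eventuallyEq.1 hx] with y hy
      simp [hy]
  have h0 := integral_fderiv_of_tsupport_subset (Ω := Ω) hφw hc.mul_right
    (tsupport_mul_subset_left.trans hs) v
  have hdφ : Continuous fun x => fderiv ℝ φ x v :=
    (hφ.continuous_fderiv one_ne_zero).clm_apply continuous_const
  have hdφs : tsupport (fun x => fderiv ℝ φ x v) ⊆ tsupport φ := tsupport_fderiv_apply_subset ℝ v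
  have h1 : Integrable (fun x => w x * fderiv ℝ φ x v) (bulk Ω) :=
    integrable_mul_of_tsupport_subset hΩ hw.continuousOn hdφ (hc.fderiv_apply ℝ v) (hdφs.trans hs)
  have h2 : Integrable (fun x => φ x * fderiv ℝ w x v) (bulk Ω) := by
    simp only [mul_comm (φ _)]
    exact integrable_mul_of_tsupport_subset hΩ
      ((hw.continuousOn_fderiv_of_isOpen hΩ le_rfl).clm_apply continuousOn_const) hφ.continuous
      hc hs
  rw [eq_neg_iff_add_eq_zero, ← integral_add h1 h2, ← h0]
  refine integral_congr_ae ?_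
  filter_upwards [ae_restrict_mem hΩ.measurableSet] with x hx
  rw [fderiv_fun_mul (hφ.differentiable one_ne_zero x) ((hwx x hx).differentiableAt one_ne_zero)]
  simp
  ring

theorem isWeakGradient_gradient (hΩ : IsOpen Ω) (hw : ContDiffOn ℝ 1 w Ω) :
    IsWeakGradient Ω w (∇ w) := by
  intro φ hφ hc hs i
  simp only [gradient_apply_eq]
  exact integral_mul_fderiv_eq_neg hΩ hw (hφ.of_le (by exact_mod_cast le_top)) hc hs _

theorem IsWeakGradient.congr_ae {v v' : Euc d → ℝ} {G G' : Euc d → Euc d}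
    (h : IsWeakGradient Ω v G) (hv : v =ᵐ[bulk Ω] v') (hG : G =ᵐ[bulk Ω] G') :
    IsWeakGradient Ω v' G' := by
  intro φ hφ hc hs i
  have h1 : (fun x => v x * fderiv ℝ φ x (EuclideanSpace.single i 1)) =ᵐ[bulk Ω]
      fun x => v' x * fderiv ℝ φ x (EuclideanSpace.single i 1) :=
    hv.mono fun x hx => by simp only [hx]
  have h2 : (fun x => φ x * G x i) =ᵐ[bulk Ω] fun x => φ x * G' x i :=
    hG.mono fun x hx => by simp only [hx]
  rw [← integral_congr_ae h1, h φ hφ hc hs i, integral_congr_ae h2]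

/-- The element of `H¹(Ω)` given by a function and its weak gradient. -/
def toH1 {v : Euc d → ℝ} {G : Euc d → Euc d} (hv : MemLp v 2 (bulk Ω)) (hG : MemLp G 2 (bulk Ω))
    (h : IsWeakGradient Ω v G) : H1 Ω :=
  ⟨WithLp.toLp 2 (hv.toLp, hG.toLp), h.congr_ae hv.coeFn_toLp.symm hG.coeFn_toLp.symm⟩

theorem h1_ext {p q : H1 Ω} (h1 : h1Val p = h1Val q) (h2 : h1Grad p = h1Grad q) : p = q :=
  Subtype.ext (WithLp.ofLp_injective 2 (Prod.ext h1 h2))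

theorem norm_sq_h1 (p : H1 Ω) : ‖p‖ ^ 2 = ‖h1Val p‖ ^ 2 + ‖h1Grad p‖ ^ 2 :=
  WithLp.prod_norm_sq_eq_of_L2 _

theorem norm_h1Val_le (p : H1 Ω) : ‖h1Val p‖ ≤ ‖p‖ := by
  have := norm_sq_h1 p
  exact le_of_sq_le_sq (by nlinarith [sq_nonneg ‖h1Grad p‖]) (norm_nonneg _)

theorem norm_h1Grad_le (p : H1 Ω) : ‖h1Grad p‖ ≤ ‖p‖ := by
  have := norm_sq_h1 p
  exact le_of_sq_le_sq (by nlinarith [sq_nonneg ‖h1Val p‖]) (norm_nonneg _)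

/-- Passage to the function, as a continuous linear map. -/
def valCLM (Ω : Set (Euc d)) : H1 Ω →L[ℝ] Lp ℝ 2 (bulk Ω) :=
  LinearMap.mkContinuous ⟨⟨h1Val, fun _ _ => rfl⟩, fun _ _ => rfl⟩ 1 fun p => (norm_h1Val_le p).trans_eq (one_mul _).symm

/-- Passage to the weak gradient, as a continuous linear map. -/
def gradCLM (Ω : Set (Euc d)) : H1 Ω →L[ℝ] Lp (Euc d) 2 (bulk Ω) :=
  LinearMap.mkContinuous ⟨⟨h1Grad, fun _ _ => rfl⟩, fun _ _ => rfl⟩ 1 fun p => (norm_h1Grad_le p).trans_eq (one_mul _).symm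

theorem tendsto_h1 {q : ℕ → H1 Ω} {p : H1 Ω}
    (h1 : Tendsto (fun k => h1Val (q k)) atTop (𝓝 (h1Val p)))
    (h2 : Tendsto (fun k => h1Grad (q k)) atTop (𝓝 (h1Grad p))) : Tendsto q atTop (𝓝 p) := by
  rw [tendsto_subtype_rng]
  exact ((WithLp.prod_continuous_toLp 2 _ _).tendsto (h1Val p, h1Grad p)).comp
    (h1.prodMk_nhds h2)

theorem norm_toLp_sq {α E : Type*} [MeasurableSpace α] {μ : Measure α} [NormedAddCommGroup E]
    [InnerProductSpace ℝ E] {v : α → E} (hv : MemLp v 2 μ) :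
    ‖hv.toLp‖ ^ 2 = ∫ x, ‖v x‖ ^ 2 ∂μ := by
  rw [← real_inner_self_eq_norm_sq, L2.inner_def]
  refine integral_congr_ae ?_
  filter_upwards [hv.coeFn_toLp] with x hx
  rw [hx, real_inner_self_eq_norm_sq]

/-- The space of continuously differentiable functions on `ℝ^d`. -/
def C1Fun (d : ℕ) : Submodule ℝ (Euc d → ℝ) where
  carrier := {φ | ContDiff ℝ 1 φ}
  zero_mem' := (contDiff_const : ContDiff ℝ 1 fun _ : Euc d => (0 : ℝ))
  add_mem' := fun {φ ψ} (h1 : ContDiff ℝ 1 φ) (h2 : ContDiff ℝ 1 ψ) => h1.add h2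
  smul_mem' := fun c φ (h : ContDiff ℝ 1 φ) => h.const_smul c

theorem contDiff_C1Fun (φ : C1Fun d) : ContDiff ℝ 1 (φ : Euc d → ℝ) := φ.2

theorem contDiffOn_C1Fun (φ : C1Fun d) (s : Set (Euc d)) : ContDiffOn ℝ 1 (φ : Euc d → ℝ) s :=
  (contDiff_C1Fun φ).contDiffOn

/-- The class in `H¹(Ω)` of a function in `C¹(closure Ω)`. -/
def classH1 (hΩ : IsBoundedLipschitz Ω) (hw : ContDiffOn ℝ 1 w (closure Ω)) : H1 Ω :=
  toH1 (memLp_bulk_of_continuousOn_closure hΩ hw.continuousOn) (memLp_gradient hΩ hw)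
    (isWeakGradient_gradient hΩ.isOpen (hw.mono subset_closure))

/-- Restriction of `C¹` functions to `Ω`. -/
def C1Fun.toH1 (hΩ : IsBoundedLipschitz Ω) : C1Fun d →ₗ[ℝ] H1 Ω where
  toFun φ := classH1 hΩ (contDiffOn_C1Fun φ _)
  map_add' φ ψ := by
    refine h1_ext rfl ?_
    refine Eq.trans ?_ (MemLp.toLp_add (memLp_gradient hΩ (contDiffOn_C1Fun φ _))
      (memLp_gradient hΩ (contDiffOn_C1Fun ψ _)))
    refine MemLp.toLp_congr (memLp_gradient hΩ (contDiffOn_C1Fun (φ + ψ) _)) _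
      (Eventually.of_forall fun x => ?_)
    ext i
    have h1 := (contDiff_C1Fun φ).differentiable one_ne_zero x
    have h2 := (contDiff_C1Fun ψ).differentiable one_ne_zero x
    simp only [Submodule.coe_add, gradient_apply_eq, Pi.add_apply, PiLp.add_apply]
    rw [fderiv_add h1 h2]
    rfl
  map_smul' c φ := by
    refine h1_ext rfl ?_
    refine Eq.trans ?_ (MemLp.toLp_const_smul c (memLp_gradient hΩ (contDiffOn_C1Fun φ _)))
    refine MemLp.toLp_congr (memLp_gradient hΩ (contDiffOn_C1Fun (c • φ) _)) _
      (Eventually.of_forall fun x => ?_)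
    ext i
    have h1 := (contDiff_C1Fun φ).differentiable one_ne_zero x
    simp only [Submodule.coe_smul, gradient_apply_eq, Pi.smul_apply, PiLp.smul_apply]
    rw [fderiv_const_smul h1]
    rfl

theorem h1Val_C1Fun_toH1 (hΩ : IsBoundedLipschitz Ω) (φ : C1Fun d) :
    h1Val (C1Fun.toH1 hΩ φ) =ᵐ[bulk Ω] (φ : Euc d → ℝ) :=
  (memLp_bulk_of_continuousOn_closure hΩ (contDiffOn_C1Fun φ _).continuousOn).coeFn_toLp

theorem h1Grad_C1Fun_toH1 (hΩ : IsBoundedLipschitz Ω) (φ : C1Fun d) :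
    h1Grad (C1Fun.toH1 hΩ φ) =ᵐ[bulk Ω] ∇ (φ : Euc d → ℝ) :=
  (memLp_gradient hΩ (contDiffOn_C1Fun φ _)).coeFn_toLp

/-- Restriction of `C¹` functions to `∂Ω`. -/
def C1Fun.toSurface (hΩ : IsBoundedLipschitz Ω) : C1Fun d →ₗ[ℝ] Lp ℝ 2 (surface Ω) where
  toFun φ := (memLp_surface_of_continuousOn_closure hΩ (contDiffOn_C1Fun φ _).continuousOn).toLp
  map_add' _ _ := MemLp.toLp_add _ _
  map_smul' c _ := MemLp.toLp_const_smul c _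

theorem tendsto_eLpNorm_euclidean {α : Type*} [MeasurableSpace α] {μ : Measure α}
    {X : ℕ → α → Euc d} (hm : ∀ k, AEStronglyMeasurable (X k) μ)
    (h : ∀ j, Tendsto (fun k => eLpNorm (fun x => X k x j) 2 μ) atTop (𝓝 0)) :
    Tendsto (fun k => eLpNorm (X k) 2 μ) atTop (𝓝 0) := by
  have h1 := tendsto_eLpNorm_finset_sum (μ := μ) (t := Finset.univ)
    (f := fun (j : Fin d) k x => ‖X k x j‖)
    (fun j _ k => (((EuclideanSpace.proj (𝕜 := ℝ) j).continuous.comp_aestronglyMeasurable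
      (hm k)).norm)) (fun j _ => by simpa only [eLpNorm_norm] using h j)
  refine tendsto_of_tendsto_of_tendsto_of_le_of_le tendsto_const_nhds h1 (fun _ => bot_le)
    fun k => eLpNorm_mono_real fun x => ?_
  have h2 : X k x = ∑ j, EuclideanSpace.single j (X k x j) := by
    ext i
    simp
  calc ‖X k x‖ = ‖∑ j, EuclideanSpace.single j (X k x j)‖ := by rw [← h2]
    _ ≤ ∑ j, ‖X k x j‖ := (norm_sum_le _ _).trans_eq (by simp)

/-- `C¹` functions approximate in `H¹(Ω)`, and uniformly where the limit is continuous. -/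
theorem exists_approx (hΩ : IsBoundedLipschitz Ω) :
    ∃ P : ℕ → H1 Ω → (Euc d → ℝ) → C1Fun d, ∀ (p : H1 Ω) (w : Euc d → ℝ), Represents p w →
      Tendsto (fun k => C1Fun.toH1 hΩ (P k p w)) atTop (𝓝 p) ∧
      (ContinuousOn w (closure Ω) →
        TendstoUniformlyOn (fun k => (P k p w : Euc d → ℝ)) w atTop (closure Ω)) := by
  classical
  obtain ⟨P, hP0, hP1, hP2, hPu, hPd⟩ := exists_smoothing hΩ
  refine ⟨fun k p w => if h : MemLp w 2 (bulk Ω) then ⟨P k w, hP1 k w h⟩ else 0,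
    fun p w hpw => ?_⟩
  have hw : MemLp w 2 (bulk Ω) := (memLp_congr_ae hpw).1 (Lp.memLp _)
  simp only [hw, dif_pos]
  refine ⟨tendsto_h1 ?_ ?_, hPu w⟩
  · rw [Lp.tendsto_Lp_iff_tendsto_eLpNorm']
    refine (hP2 w hw).congr fun k => eLpNorm_congr_ae ?_
    have h1 : h1Val (C1Fun.toH1 hΩ ⟨P k w, hP1 k w hw⟩) =ᵐ[bulk Ω] P k w :=
      h1Val_C1Fun_toH1 hΩ _
    filter_upwards [h1, hpw] with x h1 h2
    simp [h1, h2]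
  · rw [Lp.tendsto_Lp_iff_tendsto_eLpNorm']
    refine tendsto_eLpNorm_euclidean
      (fun k => (Lp.aestronglyMeasurable _).sub (Lp.aestronglyMeasurable _)) fun j => ?_
    have hG : MemLp (fun x => h1Grad p x j) 2 (bulk Ω) :=
      (EuclideanSpace.proj (𝕜 := ℝ) j).comp_memLp' (Lp.memLp (h1Grad p))
    -- A single weak derivative is the weak divergence of the field having `w` in slot `j` and zero
    -- elsewhere.
    have hdiv : IsWeakDivergence Ω (Pi.single j w : Fin d → Euc d → ℝ)
        (fun x => h1Grad p x j) := by
      intro φ hφ hc hs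
      have h1 := p.2 φ hφ hc hs j
      refine Eq.trans ?_ h1
      refine integral_congr_ae ?_
      filter_upwards [hpw] with x hx
      rw [Finset.sum_eq_single j (fun i _ hi => by simp [hi]) (by simp), Pi.single_eq_same, ← hx]
      rfl
    refine (hPd _ _ (fun i => ?_) hG hdiv).congr fun k => eLpNorm_congr_ae ?_
    · by_cases hi : i = j
      · subst hi
        simpa using hw
      · simp [hi]
    · have h1 : h1Grad (C1Fun.toH1 hΩ ⟨P k w, hP1 k w hw⟩) =ᵐ[bulk Ω] ∇ (P k w) :=
        h1Grad_C1Fun_toH1 hΩ _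
      filter_upwards [h1] with x h1
      -- The empty slots drop out because the smoothing sends `0` to `0`.
      rw [Finset.sum_eq_single j (fun i _ hi => by
        rw [Pi.single_eq_of_ne hi, hP0]; simp) (by simp), Pi.single_eq_same, Pi.sub_apply,
        PiLp.sub_apply, h1, gradient_apply_eq]

theorem denseRange_toH1 (hΩ : IsBoundedLipschitz Ω) : DenseRange (C1Fun.toH1 hΩ) := by
  obtain ⟨P, hP⟩ := exists_approx hΩ
  exact fun p => mem_closure_of_tendsto (hP p (h1Val p) (ae_eq_refl _)).1
    (Eventually.of_forall fun k => mem_range_self _)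

end Sobolev


/-! ### The trace operator -/

section Trace

variable {d : ℕ} {Ω : Set (Euc d)}

/-- Near each boundary point some constant field `v x` has normal component at least 1. So `φ²` is
at most the sum of `ζ x * φ² * ⟪v x, n⟫`, whose surface integral the divergence theorem converts
into a bulk integral. The product rule and
$|\varphi|\,|\nabla\varphi|\le\varphi^2+|\nabla\varphi|^2$ conclude. -/
theorem exists_trace_bound (hΩ : IsBoundedLipschitz Ω) :
    ∃ C, 0 ≤ C ∧ ∀ φ : Euc d → ℝ, ContDiff ℝ 1 φ →
      ∫ x, φ x ^ 2 ∂(surface Ω) ≤ C * ((∫ x, φ x ^ 2 ∂(bulk Ω)) + ∫ x, ‖∇ φ x‖ ^ 2 ∂(bulk Ω)) := by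
  choose! e δ r hδ hr hcone using fun x (hx : x ∈ frontier Ω) =>
    hΩ.exists_inwardCone (frontier_subset_closure hx)
  obtain ⟨t, ζ, htK, hζ, hsum⟩ := exists_smooth_partition hΩ.isCompact_frontier r hr
  -- Since `⟪e x, n⟫ ≤ -δ x` on the cone region, dividing by `-δ x` makes the normal component at
  -- least 1.
  let v : Euc d → Euc d := fun x => (-(δ x)⁻¹) • e x
  have hζ1 : ∀ x ∈ t, ContDiff ℝ 1 (ζ x) := fun x hx =>
    (hζ x hx).1.of_le (by exact_mod_cast le_top)
  have hb : ∀ x ∈ t, ∃ C, 0 ≤ C ∧ ∀ y, |fderiv ℝ (ζ x) y (v x)| + 2 * |ζ x y| * ‖v x‖ ≤ C := by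
    intro x hx
    obtain ⟨A, hA⟩ := ((hζ x hx).2.1.fderiv_apply ℝ (v x)).exists_bound_of_continuous
      (((hζ1 x hx).continuous_fderiv one_ne_zero).clm_apply continuous_const)
    obtain ⟨B, hB⟩ := (hζ x hx).2.1.exists_bound_of_continuous (hζ x hx).1.continuous
    have h1 : ∀ y, |fderiv ℝ (ζ x) y (v x)| + 2 * |ζ x y| * ‖v x‖ ≤ A + 2 * B * ‖v x‖ := by
      intro y
      have := hA y
      have := hB y
      simp only [Real.norm_eq_abs] at *
      gcongr
    exact ⟨_, le_trans (by positivity) (h1 0), h1⟩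
  choose! C hC0 hC using hb
  refine ⟨∑ x ∈ t, C x, Finset.sum_nonneg hC0, fun φ hφ => ?_⟩
  have hφ2 : ContDiff ℝ 1 fun y => φ y ^ 2 := hφ.pow 2
  have hi1 : Integrable (fun x => φ x ^ 2) (bulk Ω) :=
    (memLp_bulk_of_continuousOn_closure hΩ hφ.continuous.continuousOn).integrable_sq
  have hi2 : Integrable (fun x => ‖∇ φ x‖ ^ 2) (bulk Ω) :=
    (memLp_gradient hΩ hφ.contDiffOn).norm.integrable_sq
  have hψ : ∀ x ∈ t, ContDiff ℝ 1 fun y => ζ x y * φ y ^ 2 := fun x hx => (hζ1 x hx).mul hφ2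
  have hint : ∀ x ∈ t, Integrable (fun y => ζ x y * φ y ^ 2 * inner ℝ (v x) (outwardNormal Ω y))
      (surface Ω) := fun x hx =>
    integrable_mul_inner_outwardNormal hΩ (hψ x hx).continuous.continuousOn (v x)
  have hdint : ∀ x ∈ t, Integrable (fun y => fderiv ℝ (fun y => ζ x y * φ y ^ 2) y (v x))
      (bulk Ω) := fun x hx => memLp_one_iff_integrable.1
    (memLp_bulk_of_continuousOn_closure hΩ
      (((hψ x hx).continuous_fderiv one_ne_zero).clm_apply continuous_const).continuousOn)
  have hae : ∀ᵐ y ∂(surface Ω), φ y ^ 2 ≤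
      ∑ x ∈ t, ζ x y * φ y ^ 2 * inner ℝ (v x) (outwardNormal Ω y) := by
    filter_upwards [ae_isOutwardNormal hΩ, ae_restrict_mem isClosed_frontier.measurableSet]
      with y hy hyf
    calc φ y ^ 2 = ∑ x ∈ t, ζ x y * φ y ^ 2 := by rw [← Finset.sum_mul, hsum y hyf, one_mul]
      _ ≤ _ := Finset.sum_le_sum fun x hx => ?_
    by_cases hζy : ζ x y = 0
    · simp [hζy]
    have hyb : y ∈ Metric.ball x (r x) :=
      (hζ x hx).2.2.1 (subset_tsupport _ (Function.mem_support.2 hζy))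
    have hδx := hδ x (htK x hx)
    have h1 := (hcone x (htK x hx)).inner_le (hr x (htK x hx)) (frontier_subset_closure hyf) hyb
      hδx.le hy
    have h2 : 1 ≤ inner ℝ (v x) (outwardNormal Ω y) := by
      simp only [v, inner_smul_left, map_neg, map_inv₀, conj_trivial]
      rw [neg_mul, le_neg, inv_mul_le_iff₀ hδx]
      linarith
    exact le_mul_of_one_le_right (mul_nonneg ((hζ x hx).2.2.2 y) (sq_nonneg _)) h2
  calc ∫ x, φ x ^ 2 ∂(surface Ω)
      ≤ ∫ y, ∑ x ∈ t, ζ x y * φ y ^ 2 * inner ℝ (v x) (outwardNormal Ω y) ∂(surface Ω) :=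
        integral_mono_ae (memLp_surface_of_continuousOn_closure hΩ
          hφ.continuous.continuousOn).integrable_sq (integrable_finsetSum _ hint) hae
    _ = ∑ x ∈ t, ∫ y, fderiv ℝ (fun y => ζ x y * φ y ^ 2) y (v x) ∂(bulk Ω) := by
        rw [integral_finsetSum _ hint]
        exact Finset.sum_congr rfl fun x hx => (integral_fderiv_eq_surface hΩ (hψ x hx) (v x)).symm
    _ ≤ ∑ x ∈ t, ∫ y, C x * (φ y ^ 2 + ‖∇ φ y‖ ^ 2) ∂(bulk Ω) := by
        refine Finset.sum_le_sum fun x hx => integral_mono (hdint x hx)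
          ((hi1.add hi2).const_mul _) fun y => ?_
        have hd : DifferentiableAt ℝ φ y := hφ.differentiable one_ne_zero y
        simp only
        rw [fderiv_fun_mul ((hζ1 x hx).differentiable one_ne_zero y)
          (hφ2.differentiable one_ne_zero y), fderiv_fun_pow 2 hd]
        have h1 : |fderiv ℝ φ y (v x)| ≤ ‖∇ φ y‖ * ‖v x‖ := by
          rw [norm_gradient]; exact (fderiv ℝ φ y).le_opNorm _
        have h2 := hC x hx y
        have h3 : ζ x y * (2 * φ y * fderiv ℝ φ y (v x)) ≤
            2 * |ζ x y| * ‖v x‖ * (|φ y| * ‖∇ φ y‖) := by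
          calc _ ≤ |ζ x y * (2 * φ y * fderiv ℝ φ y (v x))| := le_abs_self _
            _ = 2 * |ζ x y| * |φ y| * |fderiv ℝ φ y (v x)| := by
              rw [abs_mul, abs_mul, abs_mul, abs_two]; ring
            _ ≤ 2 * |ζ x y| * |φ y| * (‖∇ φ y‖ * ‖v x‖) := by gcongr
            _ = _ := by ring
        have h4 : |φ y| * ‖∇ φ y‖ ≤ φ y ^ 2 + ‖∇ φ y‖ ^ 2 := by
          nlinarith [sq_abs (φ y), sq_nonneg (|φ y| - ‖∇ φ y‖), sq_nonneg ‖∇ φ y‖,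
            sq_nonneg (φ y)]
        have h5 : φ y ^ 2 * fderiv ℝ (ζ x) y (v x) ≤
            |fderiv ℝ (ζ x) y (v x)| * (φ y ^ 2 + ‖∇ φ y‖ ^ 2) := by
          calc _ ≤ φ y ^ 2 * |fderiv ℝ (ζ x) y (v x)| := by gcongr; exact le_abs_self _
            _ ≤ _ := by nlinarith [abs_nonneg (fderiv ℝ (ζ x) y (v x)), sq_nonneg ‖∇ φ y‖]
        have h6 := mul_le_mul_of_nonneg_left h4 (show 0 ≤ 2 * |ζ x y| * ‖v x‖ by positivity)
        have h7 := mul_le_mul_of_nonneg_right h2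
          (show 0 ≤ φ y ^ 2 + ‖∇ φ y‖ ^ 2 by positivity)
        simp only [add_apply, smul_apply, smul_eq_mul,
          nsmul_eq_mul, Nat.cast_ofNat, Nat.add_one_sub_one, pow_one]
        linarith
    _ = _ := by
        simp_rw [integral_const_mul]
        rw [← Finset.sum_mul, integral_add hi1 hi2]

theorem exists_norm_toSurface_le (hΩ : IsBoundedLipschitz Ω) :
    ∃ C, ∀ φ : C1Fun d, ‖C1Fun.toSurface hΩ φ‖ ≤ C * ‖C1Fun.toH1 hΩ φ‖ := by
  obtain ⟨C, hC0, hC⟩ := exists_trace_bound hΩ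
  refine ⟨√C, fun φ => le_of_sq_le_sq ?_ (by positivity)⟩
  rw [mul_pow, Real.sq_sqrt hC0, norm_sq_h1]
  have h1 := norm_toLp_sq (memLp_surface_of_continuousOn_closure (p := 2) hΩ
    (contDiffOn_C1Fun φ _).continuousOn)
  have h2 := norm_toLp_sq (memLp_bulk_of_continuousOn_closure (p := 2) hΩ
    (contDiffOn_C1Fun φ _).continuousOn)
  have h3 := norm_toLp_sq (memLp_gradient (p := 2) hΩ (contDiffOn_C1Fun φ _))
  simp only [Real.norm_eq_abs, sq_abs] at h1 h2
  exact h1.trans_le ((hC φ φ.2).trans_eq (congrArg (C * ·) (congrArg₂ (· + ·) h2.symm h3.symm)))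

theorem tendsto_toLp_surface (hΩ : IsBoundedLipschitz Ω) {w : Euc d → ℝ}
    (hw : ContinuousOn w (closure Ω)) {F : ℕ → Euc d → ℝ} (hF : ∀ k, MemLp (F k) 2 (surface Ω))
    (h : TendstoUniformlyOn F w atTop (closure Ω)) :
    Tendsto (fun k => (hF k).toLp) atTop
      (𝓝 (memLp_surface_of_continuousOn_closure hΩ hw).toLp) := by
  have := hΩ.isFiniteMeasure_surface
  set W := (memLp_surface_of_continuousOn_closure (p := 2) hΩ hw).toLp with hW
  refine Metric.tendsto_nhds.2 fun η hη => ?_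
  set M := (surface Ω).real univ ^ (2 : ℝ≥0∞).toReal⁻¹ with hM
  have hM0 : 0 ≤ M := by positivity
  filter_upwards [Metric.tendstoUniformlyOn_iff.1 h (η / (M + 1)) (by positivity)] with k hk
  rw [dist_eq_norm]
  have h1 : ‖(hF k).toLp - W‖ ≤ M * (η / (M + 1)) := by
    refine Lp.norm_le_of_ae_bound (by positivity) ?_
    filter_upwards [Lp.coeFn_sub (hF k).toLp W, (hF k).coeFn_toLp, MemLp.coeFn_toLp
      (memLp_surface_of_continuousOn_closure (p := 2) hΩ hw),
      ae_restrict_mem isClosed_frontier.measurableSet] with x h1 h2 h3 hx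
    rw [h1, Pi.sub_apply, h2, hW, h3, ← dist_eq_norm, dist_comm]
    exact (hk x (frontier_subset_closure hx)).le
  refine h1.trans_lt ?_
  rw [mul_div_assoc', div_lt_iff₀ (by positivity)]
  nlinarith

theorem toSurface_ae_eq (hΩ : IsBoundedLipschitz Ω) (φ : C1Fun d) :
    C1Fun.toSurface hΩ φ =ᵐ[surface Ω] (φ : Euc d → ℝ) :=
  (memLp_surface_of_continuousOn_closure hΩ (contDiffOn_C1Fun φ _).continuousOn).coeFn_toLp

/-- The trace inequality extends restriction from the dense $C^1$ functions. For continuous `w`, the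
same approximants converge in $H^1$ and uniformly on the closure, so the extension agrees with
restriction. The $C^1$ functions already determine any trace operator. -/
theorem existsUnique_trace (hΩ : IsBoundedLipschitz Ω) :
    ∃! T : H1 Ω →L[ℝ] Lp ℝ 2 (surface Ω), IsTraceOperator Ω T := by
  obtain ⟨P, hP⟩ := exists_approx hΩ
  have hdense := denseRange_toH1 hΩ
  have hbound := exists_norm_toSurface_le hΩ
  have hT := LinearMap.extendOfNorm_eq hdense hbound
  refine ⟨(C1Fun.toSurface hΩ).extendOfNorm (C1Fun.toH1 hΩ), fun p w hw hpw => ?_,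
    fun T hT' => ?_⟩
  · obtain ⟨h1, h2⟩ := hP p w hpw
    have h3 := (((C1Fun.toSurface hΩ).extendOfNorm (C1Fun.toH1 hΩ)).continuous.tendsto p).comp h1
    have h4 := tendsto_toLp_surface hΩ hw (fun k => memLp_surface_of_continuousOn_closure hΩ
      (contDiffOn_C1Fun (P k p w) _).continuousOn) (h2 hw)
    simp only [Function.comp_def, hT] at h3
    rw [tendsto_nhds_unique h3 h4]
    exact MemLp.coeFn_toLp _
  · refine DFunLike.coe_injective (hdense.equalizer T.continuous (ContinuousLinearMap.continuous _)
      (funext fun φ => ?_))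
    refine Lp.ext ?_
    simp only [Function.comp_apply, hT]
    exact (hT' _ φ (contDiffOn_C1Fun φ _).continuousOn (h1Val_C1Fun_toH1 hΩ φ)).trans
      (toSurface_ae_eq hΩ φ).symm

end Trace


/-! ### Green's formula -/

section Green

variable {d : ℕ} {Ω : Set (Euc d)} {w z : Euc d → ℝ}

theorem integrable_mul_of_memLp {α : Type*} [MeasurableSpace α] {μ : Measure α} {a b : α → ℝ}
    (ha : MemLp a 2 μ) (hb : MemLp b 2 μ) : Integrable (fun x => a x * b x) μ :=
  ha.integrable_mul hb

theorem integral_mul_eq_inner {α : Type*} [MeasurableSpace α] {μ : Measure α} {a b : α → ℝ}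
    (ha : MemLp a 2 μ) (hb : MemLp b 2 μ) : ∫ x, a x * b x ∂μ = inner ℝ ha.toLp hb.toLp := by
  rw [L2.inner_def]
  refine integral_congr_ae ?_
  filter_upwards [ha.coeFn_toLp, hb.coeFn_toLp] with x h1 h2
  rw [h1, h2, real_inner_eq_re_inner, mul_comm]
  simp

theorem tendsto_integral_mul {α : Type*} [MeasurableSpace α] {μ : Measure α} {a b : α → ℝ}
    {X : ℕ → α → ℝ} (ha : MemLp a 2 μ) (hX : ∀ k, MemLp (X k) 2 μ) (hb : MemLp b 2 μ)
    (h : Tendsto (fun k => (hX k).toLp) atTop (𝓝 hb.toLp)) :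
    Tendsto (fun k => ∫ x, a x * X k x ∂μ) atTop (𝓝 (∫ x, a x * b x ∂μ)) := by
  simp_rw [integral_mul_eq_inner ha hb, fun k => integral_mul_eq_inner ha (hX k)]
  exact tendsto_const_nhds.inner h

theorem fderivWithin_apply_eq_sum (w : Euc d → ℝ) (x v : Euc d) :
    fderivWithin ℝ w (closure Ω) x v =
      ∑ j, fderivWithin ℝ w (closure Ω) x (EuclideanSpace.single j 1) * v j := by
  conv_lhs => rw [show v = ∑ j, v j • EuclideanSpace.single j (1 : ℝ) by
    ext i; simp [Pi.single_apply]]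
  rw [map_sum]
  exact Finset.sum_congr rfl fun j _ => by rw [map_smul, smul_eq_mul, mul_comm]

theorem continuousOn_fderivWithin_apply (hΩ : IsBoundedLipschitz Ω)
    (hw : ContDiffOn ℝ 1 w (closure Ω)) (v : Euc d) :
    ContinuousOn (fun y => fderivWithin ℝ w (closure Ω) y v) (closure Ω) :=
  (continuousOn_fderivWithin_closure hΩ hw).clm_apply continuousOn_const

theorem memLp_top_mul_outwardNormal (hΩ : IsBoundedLipschitz Ω) {φ : Euc d → ℝ}
    (hφ : ContinuousOn φ (closure Ω)) (v : Euc d) :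
    MemLp (fun y => φ y * inner ℝ v (outwardNormal Ω y)) ⊤ (surface Ω) := by
  have := hΩ.isFiniteMeasure_surface
  have h1 : MemLp (fun y => inner ℝ v (outwardNormal Ω y)) ⊤ (surface Ω) := by
    refine MemLp.of_bound (aestronglyMeasurable_const.inner (aestronglyMeasurable_outwardNormal hΩ))
      ‖v‖ (Eventually.of_forall fun y => (norm_inner_le_norm _ _).trans ?_)
    exact mul_le_of_le_one_right (norm_nonneg _) (norm_outwardNormal_le Ω y)
  exact h1.mul (memLp_surface_of_continuousOn_closure (p := ⊤) hΩ hφ)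

theorem normalDeriv_eq_sum (w : Euc d → ℝ) (x : Euc d) :
    normalDeriv Ω w x = ∑ j, fderivWithin ℝ w (closure Ω) x (EuclideanSpace.single j 1) *
      inner ℝ (EuclideanSpace.single j 1) (outwardNormal Ω x) := by
  rw [normalDeriv, fderivWithin_apply_eq_sum]
  simp [EuclideanSpace.inner_single_left]

theorem memLp_top_normalDeriv (hΩ : IsBoundedLipschitz Ω) (hw : ContDiffOn ℝ 1 w (closure Ω)) :
    MemLp (normalDeriv Ω w) ⊤ (surface Ω) := by
  simp only [funext (normalDeriv_eq_sum (Ω := Ω) w)]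
  exact memLp_finsetSum _ fun j _ =>
    memLp_top_mul_outwardNormal hΩ (continuousOn_fderivWithin_apply hΩ hw _) _

theorem laplacian_eq_sum (z : Euc d → ℝ) {x : Euc d} (hz : ContDiffAt ℝ 2 z x) :
    Δ z x = ∑ j, fderiv ℝ (fun y => fderiv ℝ z y (EuclideanSpace.single j 1)) x
      (EuclideanSpace.single j 1) := by
  rw [InnerProductSpace.laplacian_eq_iteratedFDeriv_orthonormalBasis z
    (EuclideanSpace.basisFun (Fin d) ℝ)]
  refine Finset.sum_congr rfl fun j _ => ?_
  have h1 : DifferentiableAt ℝ (fderiv ℝ z) x :=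
    (hz.fderiv_right (m := 1) (by norm_num)).differentiableAt one_ne_zero
  rw [iteratedFDeriv_two_apply, fderiv_clm_apply h1 (differentiableAt_const _)]
  simp

theorem contDiffOn_fderiv_apply (hΩ : IsOpen Ω) (hz : ContDiffOn ℝ 2 z Ω) (v : Euc d) :
    ContDiffOn ℝ 1 (fun y => fderiv ℝ z y v) Ω :=
  (hz.fderiv_of_isOpen hΩ (by norm_num)).clm_apply contDiffOn_const

/-- Inside `Ω` this is integration by parts in each coordinate. The components are derivatives
within the closure so that they are continuous up to the boundary, as uniform smoothing requires. -/
theorem isWeakDivergence_gradient (hΩ : IsOpen Ω) (hz : ContDiffOn ℝ 2 z Ω) :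
    IsWeakDivergence Ω
      (fun j y => fderivWithin ℝ z (closure Ω) y (EuclideanSpace.single j 1)) (Δ z) := by
  intro φ hφ hc hs
  have hφ1 : ContDiff ℝ 1 φ := hφ.of_le (by exact_mod_cast le_top)
  have hd := fun j : Fin d => contDiffOn_fderiv_apply hΩ hz (EuclideanSpace.single j 1)
  have h1 : ∀ j : Fin d, Integrable (fun x => fderiv ℝ z x (EuclideanSpace.single j 1) *
      fderiv ℝ φ x (EuclideanSpace.single j 1)) (bulk Ω) := fun j =>
    integrable_mul_of_tsupport_subset hΩ (hd j).continuousOn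
      ((hφ1.continuous_fderiv one_ne_zero).clm_apply continuous_const) (hc.fderiv_apply ℝ _)
      ((tsupport_fderiv_apply_subset ℝ _).trans hs)
  have h2 : ∀ j : Fin d, Integrable (fun x => φ x * fderiv ℝ (fun y =>
      fderiv ℝ z y (EuclideanSpace.single j 1)) x (EuclideanSpace.single j 1)) (bulk Ω) := by
    intro j
    simp only [mul_comm (φ _)]
    exact integrable_mul_of_tsupport_subset hΩ
      (((hd j).continuousOn_fderiv_of_isOpen hΩ le_rfl).clm_apply continuousOn_const)
      hφ.continuous hc hs
  have e1 : ∫ x, ∑ j, fderivWithin ℝ z (closure Ω) x (EuclideanSpace.single j 1) *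
      fderiv ℝ φ x (EuclideanSpace.single j 1) ∂(bulk Ω) =
      ∫ x, ∑ j, fderiv ℝ z x (EuclideanSpace.single j 1) *
      fderiv ℝ φ x (EuclideanSpace.single j 1) ∂(bulk Ω) := by
    refine integral_congr_ae ?_
    filter_upwards [ae_restrict_mem hΩ.measurableSet] with x hx
    simp only [fderivWithin_closure_of_mem hΩ hx]
  have e2 : ∫ x, φ x * Δ z x ∂(bulk Ω) = ∫ x, ∑ j, φ x * fderiv ℝ (fun y =>
      fderiv ℝ z y (EuclideanSpace.single j 1)) x (EuclideanSpace.single j 1) ∂(bulk Ω) := by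
    refine integral_congr_ae ?_
    filter_upwards [ae_restrict_mem hΩ.measurableSet] with x hx
    rw [laplacian_eq_sum z (hz.contDiffAt (hΩ.mem_nhds hx)), Finset.mul_sum]
  rw [e1, e2, integral_finsetSum _ fun j _ => h1 j, integral_finsetSum _ fun j _ => h2 j,
    ← Finset.sum_neg_distrib]
  exact Finset.sum_congr rfl fun j _ => integral_mul_fderiv_eq_neg hΩ (hd j) hφ1 hc hs _

/-- Green's formula for a continuously differentiable test function. -/
theorem green_C1 (hΩ : IsBoundedLipschitz Ω) (hz : IsC2C1 Ω z) (hΔ : MemLp (Δ z) 2 (bulk Ω))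
    {φ : Euc d → ℝ} (hφ : ContDiff ℝ 1 φ) :
    ∫ x, inner ℝ (∇ z x) (∇ φ x) ∂(bulk Ω) =
      -∫ x, Δ z x * φ x ∂(bulk Ω) + ∫ x, normalDeriv Ω z x * φ x ∂(surface Ω) := by
  obtain ⟨P, -, hP1, hP2, hPu, hPd⟩ := exists_smoothing hΩ
  let E : Fin d → Euc d := fun j => EuclideanSpace.single j 1
  let X : Fin d → Euc d → ℝ := fun j y => fderivWithin ℝ z (closure Ω) y (E j)
  have hXc : ∀ j, ContinuousOn (X j) (closure Ω) := fun j =>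
    continuousOn_fderivWithin_apply hΩ hz.2 _
  have hXb : ∀ j, MemLp (X j) 2 (bulk Ω) := fun j =>
    memLp_bulk_of_continuousOn_closure hΩ (hXc j)
  have hXk : ∀ k j, ContDiff ℝ 1 (P k (X j)) := fun k j => hP1 k _ (hXb j)
  have hφ' : ∀ j, Continuous fun y => fderiv ℝ φ y (E j) := fun j =>
    (hφ.continuous_fderiv one_ne_zero).clm_apply continuous_const
  have hXk' : ∀ k j, Continuous fun y => fderiv ℝ (P k (X j)) y (E j) := fun k j =>
    ((hXk k j).continuous_fderiv one_ne_zero).clm_apply continuous_const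
  have hcb : ∀ {f : Euc d → ℝ}, Continuous f → MemLp f 2 (bulk Ω) := fun hf =>
    memLp_bulk_of_continuousOn_closure hΩ hf.continuousOn
  have hcs : ∀ {f : Euc d → ℝ}, Continuous f → MemLp f 2 (surface Ω) := fun hf =>
    memLp_surface_of_continuousOn_closure hΩ hf.continuousOn
  have := hΩ.isFiniteMeasure_surface
  have hψ : ∀ j, MemLp (fun y => φ y * inner ℝ (E j) (outwardNormal Ω y)) 2 (surface Ω) :=
    fun j => (memLp_top_mul_outwardNormal hΩ hφ.continuous.continuousOn (E j)).mono_exponent le_top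
  -- The divergence theorem for `φ` times the smoothed field. Green's formula is the limit of this
  -- identity.
  have hid : ∀ k, (∑ j, ∫ y, fderiv ℝ φ y (E j) * P k (X j) y ∂(bulk Ω)) +
      ∫ y, φ y * ∑ j, fderiv ℝ (P k (X j)) y (E j) ∂(bulk Ω) =
      ∑ j, ∫ y, φ y * inner ℝ (E j) (outwardNormal Ω y) * P k (X j) y ∂(surface Ω) := by
    intro k
    have h1 : ∀ j, ∫ y, φ y * inner ℝ (E j) (outwardNormal Ω y) * P k (X j) y ∂(surface Ω) =
        (∫ y, fderiv ℝ φ y (E j) * P k (X j) y ∂(bulk Ω)) +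
        ∫ y, φ y * fderiv ℝ (P k (X j)) y (E j) ∂(bulk Ω) := by
      intro j
      have h2 := integral_fderiv_eq_surface hΩ (hφ.mul (hXk k j)) (E j)
      rw [← integral_add (integrable_mul_of_memLp (hcb (hφ' j)) (hcb (hXk k j).continuous))
        (integrable_mul_of_memLp (hcb hφ.continuous) (hcb (hXk' k j)))]
      refine Eq.trans ?_ (h2.symm.trans ?_)
      · exact integral_congr_ae (Eventually.of_forall fun y => by simp only; ring)
      · refine integral_congr_ae (Eventually.of_forall fun y => ?_)
        simp only
        rw [fderiv_fun_mul (hφ.differentiable one_ne_zero y)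
          ((hXk k j).differentiable one_ne_zero y)]
        simp only [add_apply, smul_apply, smul_eq_mul]
        ring
    simp_rw [h1, Finset.sum_add_distrib, Finset.mul_sum]
    rw [integral_finsetSum _ fun j _ => integrable_mul_of_memLp (hcb hφ.continuous) (hcb (hXk' k j))]
  have hl1 : Tendsto (fun k => ∑ j, ∫ y, fderiv ℝ φ y (E j) * P k (X j) y ∂(bulk Ω)) atTop
      (𝓝 (∑ j, ∫ y, fderiv ℝ φ y (E j) * X j y ∂(bulk Ω))) :=
    tendsto_finsetSum _ fun j _ => tendsto_integral_mul (hcb (hφ' j))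
      (fun k => hcb (hXk k j).continuous) (hXb j)
      ((Lp.tendsto_Lp_iff_tendsto_eLpNorm'' _ _ _ _).2 (hP2 _ (hXb j)))
  -- Only the full divergence is known to converge in $L^2$; the individual $\partial_j\partial_j z$
  -- may fail to be square integrable.
  have hl2 : Tendsto (fun k => ∫ y, φ y * ∑ j, fderiv ℝ (P k (X j)) y (E j) ∂(bulk Ω)) atTop
      (𝓝 (∫ y, φ y * Δ z y ∂(bulk Ω))) :=
    tendsto_integral_mul (hcb hφ.continuous)
      (fun k => hcb (continuous_finsetSum _ fun j _ => hXk' k j)) hΔ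
      ((Lp.tendsto_Lp_iff_tendsto_eLpNorm'' _ _ _ _).2
        (hPd X _ hXb hΔ (isWeakDivergence_gradient hΩ.isOpen hz.1)))
  have hl3 : Tendsto (fun k => ∑ j, ∫ y, φ y * inner ℝ (E j) (outwardNormal Ω y) *
      P k (X j) y ∂(surface Ω)) atTop
      (𝓝 (∑ j, ∫ y, φ y * inner ℝ (E j) (outwardNormal Ω y) * X j y ∂(surface Ω))) :=
    tendsto_finsetSum _ fun j _ => tendsto_integral_mul (hψ j)
      (fun k => hcs (hXk k j).continuous) _ (tendsto_toLp_surface hΩ (hXc j) _ (hPu _ (hXc j)))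
  have hlim := tendsto_nhds_unique (hl1.add hl2) (hl3.congr fun k => (hid k).symm)
  have e1 : ∫ x, inner ℝ (∇ z x) (∇ φ x) ∂(bulk Ω) =
      ∑ j, ∫ y, fderiv ℝ φ y (E j) * X j y ∂(bulk Ω) := by
    rw [← integral_finsetSum _ fun j _ => integrable_mul_of_memLp (hcb (hφ' j)) (hXb j)]
    refine integral_congr_ae ?_
    filter_upwards [ae_restrict_mem hΩ.isOpen.measurableSet] with x hx
    simp only [X, E, fderivWithin_closure_of_mem hΩ.isOpen hx, ← gradient_apply_eq]
    rw [PiLp.inner_apply]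
    simp
  have e2 : ∫ x, normalDeriv Ω z x * φ x ∂(surface Ω) =
      ∑ j, ∫ y, φ y * inner ℝ (E j) (outwardNormal Ω y) * X j y ∂(surface Ω) := by
    rw [← integral_finsetSum _ fun j _ => integrable_mul_of_memLp (hψ j)
      (memLp_surface_of_continuousOn_closure hΩ (hXc j))]
    refine integral_congr_ae (Eventually.of_forall fun x => ?_)
    simp only
    rw [normalDeriv_eq_sum, Finset.sum_mul]
    exact Finset.sum_congr rfl fun j _ => by simp only [X, E]; ring
  simp only [mul_comm (Δ z _)]
  rw [e1, e2, ← hlim]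
  ring

/-- Green's formula in `H¹(Ω)`. -/
theorem green (hΩ : IsBoundedLipschitz Ω) {T : H1 Ω →L[ℝ] Lp ℝ 2 (surface Ω)}
    (hT : IsTraceOperator Ω T) (hz : IsC2C1 Ω z) (hΔ : MemLp (Δ z) 2 (bulk Ω)) (p : H1 Ω) :
    ∫ x, inner ℝ (∇ z x) (h1Grad p x) ∂(bulk Ω) =
      -∫ x, Δ z x * h1Val p x ∂(bulk Ω) + ∫ x, normalDeriv Ω z x * T p x ∂(surface Ω) := by
  have := hΩ.isFiniteMeasure_surface
  have hG : MemLp (∇ z) 2 (bulk Ω) := memLp_gradient hΩ hz.2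
  have hn : MemLp (normalDeriv Ω z) 2 (surface Ω) :=
    (memLp_top_normalDeriv hΩ hz.2).mono_exponent le_top
  have e1 : ∀ p : H1 Ω, ∫ x, inner ℝ (∇ z x) (h1Grad p x) ∂(bulk Ω) =
      inner ℝ hG.toLp (gradCLM Ω p) := by
    intro p
    rw [L2.inner_def]
    refine integral_congr_ae ?_
    filter_upwards [hG.coeFn_toLp] with x h1
    rw [h1]
    rfl
  have e2 : ∀ p : H1 Ω, ∫ x, Δ z x * h1Val p x ∂(bulk Ω) = inner ℝ hΔ.toLp (valCLM Ω p) := by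
    intro p
    rw [integral_mul_eq_inner hΔ (Lp.memLp _), Lp.toLp_coeFn]
    rfl
  have e3 : ∀ p : H1 Ω, ∫ x, normalDeriv Ω z x * T p x ∂(surface Ω) =
      inner ℝ hn.toLp (T p) := by
    intro p
    rw [integral_mul_eq_inner hn (Lp.memLp _), Lp.toLp_coeFn]
  -- Both sides are continuous in `p`, so it is enough to treat the dense range of $C^1$ functions,
  -- where the trace is restriction and `green_C1` applies.
  refine (denseRange_toH1 hΩ).induction_on (p := fun p => ∫ x, inner ℝ (∇ z x) (h1Grad p x)
    ∂(bulk Ω) = -∫ x, Δ z x * h1Val p x ∂(bulk Ω) + ∫ x, normalDeriv Ω z x * T p x ∂(surface Ω)) p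
    ?_ fun φ => ?_
  · simp only [e1, e2, e3]
    exact isClosed_eq (by fun_prop) (by fun_prop)
  · have h1 := green_C1 hΩ hz hΔ (contDiff_C1Fun φ)
    have g1 := h1Val_C1Fun_toH1 hΩ φ
    have g2 := h1Grad_C1Fun_toH1 hΩ φ
    have g3 := hT _ φ (contDiffOn_C1Fun φ _).continuousOn g1
    refine Eq.trans (integral_congr_ae (g2.mono fun x hx => ?_)) (h1.trans (congrArg₂ _
      (congrArg _ (integral_congr_ae (g1.mono fun x hx => ?_)))
      (integral_congr_ae (g3.mono fun x hx => ?_))))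
    all_goals simp only [hx]

end Green


/-! ### The change of variable -/

section ChangeOfVariable

variable {d : ℕ} {Ω : Set (Euc d)} {V u z f g : Euc d → ℝ} {F : Euc d → Euc d} {ε α κ : ℝ}

theorem IsC2C1.of_eq_exp_mul (hV : ContDiffOn ℝ 2 V (closure Ω))
    (hu : ∀ x ∈ closure Ω, u x = Real.exp (V x / (2 * ε)) * z x) (hz : IsC2C1 Ω z) :
    IsC2C1 Ω u := by
  have hE : ContDiffOn ℝ 2 (fun x => Real.exp (V x / (2 * ε))) (closure Ω) :=
    (hV.div_const _).exp
  exact ⟨((hE.mono subset_closure).mul hz.1).congr fun x hx => hu x (subset_closure hx),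
    ((hE.of_le (by norm_num)).mul hz.2).congr hu⟩

/-- The relation inverts to `z = exp (-V / (2ε)) * u`, so the converse is the same lemma with `-V`
for `V`. -/
theorem isC2C1_exp_mul_iff (hV : ContDiffOn ℝ 2 V (closure Ω))
    (hu : ∀ x ∈ closure Ω, u x = Real.exp (V x / (2 * ε)) * z x) :
    IsC2C1 Ω u ↔ IsC2C1 Ω z := by
  refine ⟨fun h => h.of_eq_exp_mul (V := fun x => -V x) (ε := ε) hV.neg fun x hx => ?_,
    fun h => h.of_eq_exp_mul hV hu⟩
  rw [hu x hx, neg_div, Real.exp_neg, inv_mul_cancel_left₀ (Real.exp_ne_zero _)]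

/-- The derivative of `e^{V/(2ε)} z`, within an arbitrary set. -/
theorem hasFDerivWithinAt_exp_mul {s : Set (Euc d)} {x : Euc d} {V' z' : Euc d →L[ℝ] ℝ}
    (hV : HasFDerivWithinAt V V' s x) (hz : HasFDerivWithinAt z z' s x)
    (hu : ∀ y ∈ s, u y = Real.exp (V y / (2 * ε)) * z y) (hx : x ∈ s) :
    HasFDerivWithinAt u (Real.exp (V x / (2 * ε)) • (z' + ((2 * ε)⁻¹ * z x) • V')) s x := by
  have h1 := ((hV.const_mul (2 * ε)⁻¹).exp.mul hz).congr (f₁ := u)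
    (fun y hy => by simp only [hu y hy, div_eq_inv_mul, Pi.mul_apply])
    (by simp only [hu x hx, div_eq_inv_mul, Pi.mul_apply])
  refine h1.congr_fderiv ?_
  ext v
  simp only [add_apply, smul_apply, smul_eq_mul, div_eq_inv_mul]
  ring

theorem divergence_eq_sum {X : Euc d → Euc d} {x : Euc d} (hX : DifferentiableAt ℝ X x) :
    divergence X x = ∑ i, fderiv ℝ (fun y => X y i) x (EuclideanSpace.single i 1) := by
  refine Finset.sum_congr rfl fun i _ => ?_
  have h1 := ((EuclideanSpace.proj i : Euc d →L[ℝ] ℝ).hasFDerivAt.comp x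
    hX.hasFDerivAt).fderiv
  have h2 : (fun y => X y i) = (EuclideanSpace.proj i : Euc d →L[ℝ] ℝ) ∘ X := rfl
  rw [h2, h1]
  rfl

/-- In `-εΔu` the exponential contributes `-∇V·∇z`, which cancels the drift of the divergence term.
The zero-order terms are `ΔV (1 - 1/2)` and `|∇V|² (1/(2ε) - 1/(4ε))`, that is `ε` times the
coefficient. -/
theorem convDiff_operator_eq (hΩ : IsOpen Ω) (hε : 0 < ε) (hV : ContDiffOn ℝ 2 V Ω)
    (hF : ∀ x ∈ Ω, F x = ∇ V x) (hz : ContDiffOn ℝ 2 z Ω)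
    (hu : ∀ x ∈ Ω, u x = Real.exp (V x / (2 * ε)) * z x) {x : Euc d} (hx : x ∈ Ω) :
    -ε * Δ u x + divergence (fun y => u y • F y) x =
      ε * Real.exp (V x / (2 * ε)) * (-Δ z x + bulkCoeff ε V x * z x) := by
  let E : Euc d → ℝ := fun y => Real.exp (V y / (2 * ε))
  have hnx := hΩ.mem_nhds hx
  have hdV : ∀ y ∈ Ω, HasFDerivAt V (fderiv ℝ V y) y := fun y hy =>
    ((hV.contDiffAt (hΩ.mem_nhds hy)).differentiableAt two_ne_zero).hasFDerivAt
  have hdz : ∀ y ∈ Ω, HasFDerivAt z (fderiv ℝ z y) y := fun y hy =>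
    ((hz.contDiffAt (hΩ.mem_nhds hy)).differentiableAt two_ne_zero).hasFDerivAt
  have hu2 : ContDiffOn ℝ 2 u Ω := ((hV.div_const (2 * ε)).exp.mul hz).congr hu
  have hdE : HasFDerivAt E (E x • (2 * ε)⁻¹ • fderiv ℝ V x) x := by
    have := ((hdV x hx).const_mul (2 * ε)⁻¹).exp
    simpa only [E, div_eq_inv_mul] using this
  have hdu : ∀ y ∈ Ω, ∀ v, fderiv ℝ u y v =
      E y * (fderiv ℝ z y v + (2 * ε)⁻¹ * (z y * fderiv ℝ V y v)) := by
    intro y hy v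
    have h1 := (hasFDerivWithinAt_exp_mul (hdV y hy).hasFDerivWithinAt
      (hdz y hy).hasFDerivWithinAt hu hy).hasFDerivAt (hΩ.mem_nhds hy)
    rw [h1.fderiv]
    simp only [add_apply, smul_apply, smul_eq_mul, E]
    ring
  have hdd : ∀ {w : Euc d → ℝ}, ContDiffOn ℝ 2 w Ω → ∀ v, HasFDerivAt (fun y => fderiv ℝ w y v)
      (fderiv ℝ (fun y => fderiv ℝ w y v) x) x := fun hw v =>
    (((contDiffOn_fderiv_apply hΩ hw v).contDiffAt hnx).differentiableAt one_ne_zero).hasFDerivAt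
  have hdux : DifferentiableAt ℝ u x := (hu2.contDiffAt hnx).differentiableAt two_ne_zero
  have hgV : DifferentiableAt ℝ (∇ V) x :=
    (InnerProductSpace.toDual ℝ (Euc d)).symm.toContinuousLinearEquiv.toContinuousLinearMap
      |>.differentiableAt.comp x (((hV.fderiv_of_isOpen (m := 1) hΩ (by norm_num)).contDiffAt
        hnx).differentiableAt one_ne_zero)
  have hFV : (fun y => u y • F y) =ᶠ[𝓝 x] fun y => u y • ∇ V y := by
    filter_upwards [hnx] with y hy
    rw [hF y hy]
  have e1 : divergence (fun y => u y • F y) x = ∑ j : Fin d,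
      fderiv ℝ (fun y => u y * fderiv ℝ V y (EuclideanSpace.single j 1)) x
        (EuclideanSpace.single j 1) := by
    rw [divergence, hFV.fderiv_eq]
    refine (divergence_eq_sum (hdux.smul hgV)).trans ?_
    simp only [Pi.smul_apply', PiLp.smul_apply, smul_eq_mul, gradient_apply_eq]
  have e2 : ‖∇ V x‖ ^ 2 = ∑ j : Fin d, fderiv ℝ V x (EuclideanSpace.single j 1) ^ 2 := by
    rw [EuclideanSpace.norm_sq_eq]
    simp only [gradient_apply_eq, Real.norm_eq_abs, sq_abs]
  rw [e1, bulkCoeff, e2, laplacian_eq_sum u (hu2.contDiffAt hnx),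
    laplacian_eq_sum z (hz.contDiffAt hnx), laplacian_eq_sum V (hV.contDiffAt hnx)]
  simp only [Finset.mul_sum, Finset.sum_mul, Finset.sum_div, ← Finset.sum_neg_distrib,
    ← Finset.sum_add_distrib]
  -- The identity holds separately in each coordinate direction, so only one-variable product rules
  -- remain.
  refine Finset.sum_congr rfl fun j _ => ?_
  set e : Euc d := EuclideanSpace.single j 1
  have h1 : (fun y => fderiv ℝ u y e) =ᶠ[𝓝 x] fun y =>
      E y * (fderiv ℝ z y e + (2 * ε)⁻¹ * (z y * fderiv ℝ V y e)) := by
    filter_upwards [hnx] with y hy using hdu y hy e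
  have h2 := hdE.mul ((hdd hz e).add (((hdz x hx).mul (hdd hV e)).const_mul (2 * ε)⁻¹))
  have h3 := hdux.hasFDerivAt.mul (hdd hV e)
  rw [h1.fderiv_eq]
  have h2' := congrArg (fun L : Euc d →L[ℝ] ℝ => L e) h2.fderiv
  have h3' := congrArg (fun L : Euc d →L[ℝ] ℝ => L e) h3.fderiv
  simp only [add_apply, smul_apply, smul_eq_mul, Pi.add_apply, Pi.mul_apply] at h2' h3'
  refine (congrArg₂ (fun a b => -ε * a + b) h2' h3').trans ?_
  rw [hdu x hx e, hu x hx]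
  simp only [E]
  field_simp
  ring

theorem convDiffAt_iff (hΩ : IsOpen Ω) (hε : 0 < ε) (hV : ContDiffOn ℝ 2 V Ω)
    (hF : ∀ x ∈ Ω, F x = ∇ V x) (hz : ContDiffOn ℝ 2 z Ω)
    (hu : ∀ x ∈ Ω, u x = Real.exp (V x / (2 * ε)) * z x) {x : Euc d} (hx : x ∈ Ω) :
    ConvDiffAt ε F f u x ↔ SchrodingerAt ε V f z x := by
  rw [ConvDiffAt, SchrodingerAt, convDiff_operator_eq hΩ hε hV hF hz hu hx, neg_div, Real.exp_neg]
  have := Real.exp_pos (V x / (2 * ε))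
  constructor
  · intro h
    rw [← h]
    field_simp
  · intro h
    rw [h]
    field_simp

/-- Differentiation within the closure gives the common factor $E$ for whatever vector the normal is
evaluated at, so points without a normal need no separate treatment. -/
theorem robinAt_iff (hΩ : IsBoundedLipschitz Ω) (hV : ContDiffOn ℝ 2 V (closure Ω))
    (hz : IsC2C1 Ω z) (hu : ∀ x ∈ closure Ω, u x = Real.exp (V x / (2 * ε)) * z x) {x : Euc d}
    (hx : x ∈ closure Ω) : RobinAt Ω α κ g u x ↔ ModifiedRobinAt Ω ε V α κ g z x := by
  have h1 := (hasFDerivWithinAt_exp_mul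
    ((hV.differentiableOn two_ne_zero) x hx).hasFDerivWithinAt
    ((hz.2.differentiableOn one_ne_zero) x hx).hasFDerivWithinAt hu hx).fderivWithin
    (hΩ.uniqueDiffOn_closure x hx)
  have hpos := Real.exp_pos (V x / (2 * ε))
  have h2 : α * normalDeriv Ω u x + κ * u x = Real.exp (V x / (2 * ε)) *
      (α * normalDeriv Ω z x + (κ + α / (2 * ε) * normalDeriv Ω V x) * z x) := by
    rw [normalDeriv, h1, hu x hx]
    simp only [normalDeriv, add_apply, smul_apply, smul_eq_mul]
    ring
  rw [RobinAt, ModifiedRobinAt, h2, neg_div, Real.exp_neg, eq_inv_mul_iff_mul_eq₀ hpos.ne']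

theorem solvesConvDiff_iff (hΩ : IsBoundedLipschitz Ω) (hε : 0 < ε)
    (hV : ContDiffOn ℝ 2 V (closure Ω)) (hF : ∀ x ∈ Ω, F x = ∇ V x)
    (hu : ∀ x ∈ closure Ω, u x = Real.exp (V x / (2 * ε)) * z x) :
    SolvesConvDiff Ω ε F α κ f g u ↔ SolvesSchrodinger Ω ε V α κ f g z := by
  have hreg := isC2C1_exp_mul_iff hV hu
  have h1 : IsC2C1 Ω z → ∀ x ∈ Ω, ConvDiffAt ε F f u x ↔ SchrodingerAt ε V f z x :=
    fun hz x hx => convDiffAt_iff hΩ.isOpen hε (hV.mono subset_closure) hF hz.1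
      (fun y hy => hu y (subset_closure hy)) hx
  have h2 : IsC2C1 Ω z → ∀ᵐ x ∂(surface Ω),
      RobinAt Ω α κ g u x ↔ ModifiedRobinAt Ω ε V α κ g z x := by
    intro hz
    filter_upwards [ae_restrict_mem isClosed_frontier.measurableSet] with x hx
    exact robinAt_iff hΩ hV hz hu (frontier_subset_closure hx)
  constructor
  · rintro ⟨r, e, b⟩
    have hz := hreg.1 r
    exact ⟨hz, fun x hx => (h1 hz x hx).1 (e x hx), by
      filter_upwards [b, h2 hz] with x hb h using h.1 hb⟩
  · rintro ⟨hz, e, b⟩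
    exact ⟨hreg.2 hz, fun x hx => (h1 hz x hx).2 (e x hx), by
      filter_upwards [b, h2 hz] with x hb h using h.2 hb⟩

end ChangeOfVariable


/-! ### The weak formulation -/

section WeakFormulation

variable {d : ℕ} {Ω : Set (Euc d)} {V z f g : Euc d → ℝ} {ε α κ : ℝ}

/-- Weak gradients are unique: two of them have the same integrals against all test functions, hence
agree almost everywhere. -/
theorem h1_eq_of_val_eq (hΩ : IsBoundedLipschitz Ω) {p q : H1 Ω} (h : h1Val p = h1Val q) : p = q := by
  refine h1_ext h (Lp.ext ?_)
  have hcomp : ∀ (r : H1 Ω) (i : Fin d), MemLp (fun x => h1Grad r x i) 2 (bulk Ω) := fun r i =>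
    (EuclideanSpace.proj (𝕜 := ℝ) i).comp_memLp' (Lp.memLp (h1Grad r))
  have := isFiniteMeasure_bulk hΩ
  have key : ∀ i : Fin d, ∀ᵐ x ∂(bulk Ω), h1Grad p x i - h1Grad q x i = 0 := by
    intro i
    have h1 : ∀ᵐ x ∂(volume : Measure (Euc d)), x ∈ Ω → h1Grad p x i - h1Grad q x i = 0 := by
      refine hΩ.isOpen.ae_eq_zero_of_integral_contDiff_smul_eq_zero ?_ fun φ hφ hc hs => ?_
      · have h2 := ((hcomp p i).sub (hcomp q i)).integrable (by norm_num)
        exact IntegrableOn.locallyIntegrableOn h2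
      · have e1 := p.2 φ hφ hc hs i
        have e2 := q.2 φ hφ hc hs i
        have e3 : ∫ x, φ x * h1Grad p x i ∂(bulk Ω) = ∫ x, φ x * h1Grad q x i ∂(bulk Ω) := by
          refine neg_injective (e1.symm.trans (Eq.trans ?_ e2))
          exact congrArg (fun v : Lp ℝ 2 (bulk Ω) =>
            ∫ x, v x * fderiv ℝ φ x (EuclideanSpace.single i 1) ∂(bulk Ω)) h
        have e4 : ∫ x, φ x • (h1Grad p x i - h1Grad q x i) ∂(bulk Ω) = 0 := by
          simp only [smul_eq_mul, mul_sub]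
          rw [integral_sub (integrable_mul_grad _ hφ hc i) (integrable_mul_grad _ hφ hc i), e3,
            sub_self]
        refine Eq.trans (setIntegral_eq_integral_of_forall_compl_eq_zero fun x hx => ?_).symm e4
        rw [image_eq_zero_of_notMem_tsupport fun hx' => hx (hs hx'), zero_smul]
    exact (ae_restrict_iff' hΩ.isOpen.measurableSet).2 h1
  filter_upwards [ae_all_iff.2 key] with x hx
  ext i
  exact sub_eq_zero.1 (hx i)

theorem represents_classH1 (hΩ : IsBoundedLipschitz Ω) (hz : ContDiffOn ℝ 1 z (closure Ω)) :
    Represents (classH1 hΩ hz) z :=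
  (memLp_bulk_of_continuousOn_closure hΩ hz.continuousOn).coeFn_toLp

theorem Represents.unique (hΩ : IsBoundedLipschitz Ω) {p q : H1 Ω} (hp : Represents p z)
    (hq : Represents q z) : p = q :=
  h1_eq_of_val_eq hΩ (Lp.ext (hp.trans hq.symm))

theorem existsUnique_represents (hΩ : IsBoundedLipschitz Ω) (hz : IsC2C1 Ω z) :
    ∃! p : H1 Ω, Represents p z :=
  ⟨_, represents_classH1 hΩ hz.2, fun _ h => h.unique hΩ (represents_classH1 hΩ hz.2)⟩

theorem Represents.h1Grad_ae_eq (hΩ : IsBoundedLipschitz Ω) (hz : ContDiffOn ℝ 1 z (closure Ω))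
    {p : H1 Ω} (hp : Represents p z) : h1Grad p =ᵐ[bulk Ω] ∇ z := by
  rw [hp.unique hΩ (represents_classH1 hΩ hz)]
  exact (memLp_gradient hΩ hz).coeFn_toLp

/-- `Δ V` is built from unrestricted derivatives and is not controlled on the boundary. The second
derivative within the closure agrees with it inside and is continuous up to the boundary, which
makes `bulkCoeff` bounded on `Ω`. -/
theorem exists_laplacian_eqOn (hΩ : IsBoundedLipschitz Ω) (hV : ContDiffOn ℝ 2 V (closure Ω)) :
    ∃ D : Euc d → ℝ, ContinuousOn D (closure Ω) ∧ EqOn (Δ V) D Ω := by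
  let b : Fin d → Euc d := fun j => EuclideanSpace.basisFun (Fin d) ℝ j
  refine ⟨fun x => ∑ j, iteratedFDerivWithin ℝ 2 V (closure Ω) x ![b j, b j], ?_, fun x hx => ?_⟩
  · refine continuousOn_finsetSum _ fun j _ => ?_
    have h1 := hV.continuousOn_iteratedFDerivWithin (m := 2) le_rfl hΩ.uniqueDiffOn_closure
    exact (ContinuousMultilinearMap.apply ℝ (fun _ : Fin 2 => Euc d) ℝ
      ![b j, b j]).continuous.comp_continuousOn h1
  · have hV' : ContDiffAt ℝ 2 V x :=
      hV.contDiffAt (mem_of_superset (hΩ.isOpen.mem_nhds hx) subset_closure)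
    rw [InnerProductSpace.laplacian_eq_iteratedFDeriv_orthonormalBasis V
      (EuclideanSpace.basisFun (Fin d) ℝ)]
    simp only [b, iteratedFDerivWithin_eq_iteratedFDeriv (n := 2) hΩ.uniqueDiffOn_closure hV'
      (subset_closure hx)]

theorem exists_bulkCoeff_eqOn (hΩ : IsBoundedLipschitz Ω) (hV : ContDiffOn ℝ 2 V (closure Ω)) :
    ∃ c : Euc d → ℝ, ContinuousOn c (closure Ω) ∧ EqOn (bulkCoeff ε V) c Ω := by
  obtain ⟨D, hD, hDV⟩ := exists_laplacian_eqOn hΩ hV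
  refine ⟨fun x => D x / (2 * ε) + ‖fderivWithin ℝ V (closure Ω) x‖ ^ 2 / (4 * ε ^ 2),
    (hD.div_const _).add (((continuousOn_fderivWithin_closure hΩ
      (hV.of_le (by norm_num))).norm.pow 2).div_const _), fun x hx => ?_⟩
  simp only [bulkCoeff, hDV hx, norm_gradient, fderivWithin_closure_of_mem hΩ.isOpen hx]

theorem continuousOn_bulkCoeff (hΩ : IsBoundedLipschitz Ω) (hV : ContDiffOn ℝ 2 V (closure Ω)) :
    ContinuousOn (bulkCoeff ε V) Ω := by
  obtain ⟨c, hc, h⟩ := exists_bulkCoeff_eqOn (ε := ε) hΩ hV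
  exact (hc.mono subset_closure).congr h

theorem memLp_bulkCoeff (hΩ : IsBoundedLipschitz Ω) (hV : ContDiffOn ℝ 2 V (closure Ω)) :
    MemLp (bulkCoeff ε V) ⊤ (bulk Ω) := by
  obtain ⟨c, hc, h⟩ := exists_bulkCoeff_eqOn (ε := ε) hΩ hV
  refine (memLp_congr_ae ?_).1 (memLp_bulk_of_continuousOn_closure hΩ hc)
  filter_upwards [ae_restrict_mem hΩ.isOpen.measurableSet] with x hx using (h hx).symm

theorem memLp_boundaryCoeff (hΩ : IsBoundedLipschitz Ω) (hV : ContDiffOn ℝ 2 V (closure Ω)) :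
    MemLp (boundaryCoeff Ω ε V α κ) ⊤ (surface Ω) := by
  have := hΩ.isFiniteMeasure_surface
  exact (memLp_const (κ / α)).add
    ((memLp_top_normalDeriv hΩ (hV.of_le (by norm_num))).const_mul (1 / (2 * ε)))

theorem continuousOn_exp_neg (hV : ContDiffOn ℝ 2 V (closure Ω)) :
    ContinuousOn (fun x => Real.exp (-V x / (2 * ε))) (closure Ω) :=
  (hV.continuousOn.neg.div_const _).rexp

theorem memLp_bulkLoad (hΩ : IsBoundedLipschitz Ω) (hV : ContDiffOn ℝ 2 V (closure Ω))
    (hf : MemLp f 2 (bulk Ω)) :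
    MemLp (fun x => f x * (Real.exp (-V x / (2 * ε)) / ε)) 2 (bulk Ω) :=
  (memLp_bulk_of_continuousOn_closure (p := ⊤) hΩ ((continuousOn_exp_neg hV).div_const ε)).mul hf

theorem memLp_boundaryLoad (hΩ : IsBoundedLipschitz Ω) (hV : ContDiffOn ℝ 2 V (closure Ω))
    (hg : MemLp g 2 (surface Ω)) :
    MemLp (fun x => 1 / α * Real.exp (-V x / (2 * ε)) * g x) 2 (surface Ω) :=
  hg.mul (memLp_surface_of_continuousOn_closure (p := ⊤) hΩ
    (continuousOn_const.mul (continuousOn_exp_neg hV)))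

theorem integral_inner_gradient_test (hΩ : IsOpen Ω) (hz : ContDiffOn ℝ 2 z Ω) {φ : Euc d → ℝ}
    (hφ : ContDiff ℝ ∞ φ) (hc : HasCompactSupport φ) (hs : tsupport φ ⊆ Ω) :
    ∫ x, inner ℝ (∇ z x) (∇ φ x) ∂(bulk Ω) = -∫ x, φ x * Δ z x ∂(bulk Ω) := by
  rw [← isWeakDivergence_gradient hΩ hz φ hφ hc hs]
  refine integral_congr_ae ?_
  filter_upwards [ae_restrict_mem hΩ.measurableSet] with x hx
  simp only [fderivWithin_closure_of_mem hΩ hx, ← gradient_apply_eq]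
  rw [PiLp.inner_apply]
  simp [mul_comm]

theorem integral_add_sub {β : Type*} [MeasurableSpace β] {μ : Measure β} {a b c : β → ℝ}
    (ha : Integrable a μ) (hb : Integrable b μ) (hc : Integrable c μ) :
    ∫ x, (a x + b x - c x) ∂μ = ∫ x, a x ∂μ + ∫ x, b x ∂μ - ∫ x, c x ∂μ :=
  (integral_sub (ha.add hb) hc).trans (congrArg (· - _) (integral_add ha hb))

theorem integral_neg_add_sub {β : Type*} [MeasurableSpace β] {μ : Measure β} {a b c : β → ℝ}
    (ha : Integrable a μ) (hb : Integrable b μ) (hc : Integrable c μ) :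
    ∫ x, (-a x + b x - c x) ∂μ = -∫ x, a x ∂μ + ∫ x, b x ∂μ - ∫ x, c x ∂μ :=
  (integral_add_sub ha.neg hb hc).trans
    (congrArg (fun t => t + ∫ x, b x ∂μ - ∫ x, c x ∂μ) (integral_neg a))

/-- The defect of a regular function in the weak formulation. -/
theorem bilin_sub_load_eq (hΩ : IsBoundedLipschitz Ω) {T : H1 Ω →L[ℝ] Lp ℝ 2 (surface Ω)}
    (hT : IsTraceOperator Ω T) (hV : ContDiffOn ℝ 2 V (closure Ω)) (hf : MemLp f 2 (bulk Ω))
    (hg : MemLp g 2 (surface Ω)) (hz : IsC2C1 Ω z) (hΔ : MemLp (Δ z) 2 (bulk Ω)) {p : H1 Ω}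
    (hp : Represents p z) (q : H1 Ω) :
    bilin T ε V α κ p q - load T ε V α f g q =
      (∫ x, (-Δ z x + bulkCoeff ε V x * z x - f x * (Real.exp (-V x / (2 * ε)) / ε)) * h1Val q x
        ∂(bulk Ω)) +
      ∫ x, (normalDeriv Ω z x + boundaryCoeff Ω ε V α κ x * z x -
        1 / α * Real.exp (-V x / (2 * ε)) * g x) * T q x ∂(surface Ω) := by
  have := hΩ.isFiniteMeasure_surface
  have hzc := hz.2.continuousOn
  have hTp : T p =ᵐ[surface Ω] z := hT p z hzc hp
  have hq : MemLp (h1Val q) 2 (bulk Ω) := Lp.memLp _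
  have hTq : MemLp (T q) 2 (surface Ω) := Lp.memLp _
  have i1 := integrable_mul_of_memLp hΔ hq
  have i2 := integrable_mul_of_memLp ((memLp_bulk_of_continuousOn_closure (p := 2) hΩ hzc).mul
    (memLp_bulkCoeff (ε := ε) hΩ hV) (r := 2)) hq
  have i3 := integrable_mul_of_memLp (memLp_bulkLoad (ε := ε) hΩ hV hf) hq
  have i4 := integrable_mul_of_memLp
    ((memLp_top_normalDeriv hΩ hz.2).mono_exponent (p := 2) le_top) hTq
  have i5 := integrable_mul_of_memLp ((memLp_surface_of_continuousOn_closure (p := 2) hΩ hzc).mul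
    (memLp_boundaryCoeff (ε := ε) (α := α) (κ := κ) hΩ hV) (r := 2)) hTq
  have i6 := integrable_mul_of_memLp (memLp_boundaryLoad (ε := ε) (α := α) hΩ hV hg) hTq
  simp only [Pi.mul_apply] at i2 i5
  simp only [sub_mul, add_mul, neg_mul]
  rw [integral_neg_add_sub i1 i2 i3, integral_add_sub i4 i5 i6, bilin, load]
  have e1 : ∫ x, inner ℝ (h1Grad p x) (h1Grad q x) ∂(bulk Ω) =
      ∫ x, inner ℝ (∇ z x) (h1Grad q x) ∂(bulk Ω) :=
    integral_congr_ae ((hp.h1Grad_ae_eq hΩ hz.2).mono fun x hx => by simp only [hx])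
  have e2 : ∫ x, bulkCoeff ε V x * h1Val p x * h1Val q x ∂(bulk Ω) =
      ∫ x, bulkCoeff ε V x * z x * h1Val q x ∂(bulk Ω) :=
    integral_congr_ae (hp.mono fun x hx => by simp only [hx])
  have e3 : ∫ x, boundaryCoeff Ω ε V α κ x * T p x * T q x ∂(surface Ω) =
      ∫ x, boundaryCoeff Ω ε V α κ x * z x * T q x ∂(surface Ω) :=
    integral_congr_ae (hTp.mono fun x hx => by simp only [hx])
  rw [e1, e2, e3, green hΩ hT hz hΔ q]
  ring

/-- Regularity alone does not make `Δ z` square integrable, but the equation expresses it through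
`z` and `f`. This is what admits Green's formula. -/
theorem memLp_laplacian_of_schrodinger (hΩ : IsBoundedLipschitz Ω)
    (hV : ContDiffOn ℝ 2 V (closure Ω)) (hf : MemLp f 2 (bulk Ω)) (hz : IsC2C1 Ω z)
    (h : ∀ x ∈ Ω, SchrodingerAt ε V f z x) : MemLp (Δ z) 2 (bulk Ω) := by
  have h1 := ((memLp_bulk_of_continuousOn_closure (p := 2) hΩ hz.2.continuousOn).mul
    (memLp_bulkCoeff (ε := ε) hΩ hV) (r := 2)).sub (memLp_bulkLoad (ε := ε) hΩ hV hf)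
  refine (memLp_congr_ae ?_).1 h1
  filter_upwards [ae_restrict_mem hΩ.isOpen.measurableSet] with x hx
  have h2 := h x hx
  rw [SchrodingerAt] at h2
  simp only [Pi.sub_apply, Pi.mul_apply]
  linarith

theorem modifiedRobinAt_iff (hα : 0 < α) {x : Euc d} : ModifiedRobinAt Ω ε V α κ g z x ↔
    normalDeriv Ω z x + boundaryCoeff Ω ε V α κ x * z x -
      1 / α * Real.exp (-V x / (2 * ε)) * g x = 0 := by
  rw [ModifiedRobinAt, boundaryCoeff, sub_eq_zero,
    ← mul_right_inj' (a := α) hα.ne' (b := normalDeriv Ω z x + _)]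
  have h1 : α * (normalDeriv Ω z x + (κ / α + 1 / (2 * ε) * normalDeriv Ω V x) * z x) =
      α * normalDeriv Ω z x + (κ + α / (2 * ε) * normalDeriv Ω V x) * z x := by
    field_simp
  have h2 : α * (1 / α * Real.exp (-V x / (2 * ε)) * g x) = Real.exp (-V x / (2 * ε)) * g x := by
    field_simp
  rw [h1, h2]

theorem SolvesSchrodinger.isWeakSolution (hΩ : IsBoundedLipschitz Ω)
    {T : H1 Ω →L[ℝ] Lp ℝ 2 (surface Ω)} (hT : IsTraceOperator Ω T)
    (hV : ContDiffOn ℝ 2 V (closure Ω)) (hα : 0 < α) (hf : MemLp f 2 (bulk Ω))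
    (hg : MemLp g 2 (surface Ω)) {p : H1 Ω} (hp : Represents p z)
    (h : SolvesSchrodinger Ω ε V α κ f g z) : IsWeakSolution T ε V α κ f g p := by
  intro q
  have hΔ := memLp_laplacian_of_schrodinger hΩ hV hf h.regular h.equation
  rw [← sub_eq_zero, bilin_sub_load_eq hΩ hT hV hf hg h.regular hΔ hp q,
    integral_eq_zero_of_ae, integral_eq_zero_of_ae, add_zero]
  · filter_upwards [h.boundary] with x hx
    rw [(modifiedRobinAt_iff hα).1 hx, zero_mul, Pi.zero_apply]
  · filter_upwards [ae_restrict_mem hΩ.isOpen.measurableSet] with x hx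
    rw [sub_eq_zero.2 (h.equation x hx), zero_mul, Pi.zero_apply]

/-- Green's formula is not yet available, as `Δ z` is not known to be in $L^2$. Test functions with
compact support in `Ω` have zero trace and need only interior integration by parts. The residual
then vanishes almost everywhere, and everywhere in `Ω` by continuity. -/
theorem IsWeakSolution.schrodingerAt (hΩ : IsBoundedLipschitz Ω)
    {T : H1 Ω →L[ℝ] Lp ℝ 2 (surface Ω)} (hT : IsTraceOperator Ω T)
    (hV : ContDiffOn ℝ 2 V (closure Ω)) (hfc : ContinuousOn f Ω) (hz : IsC2C1 Ω z) {p : H1 Ω}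
    (hp : Represents p z) (h : IsWeakSolution T ε V α κ f g p) :
    ∀ x ∈ Ω, SchrodingerAt ε V f z x := by
  have hO := hΩ.isOpen
  let S : Euc d → ℝ := fun x =>
    -Δ z x + bulkCoeff ε V x * z x - f x * (Real.exp (-V x / (2 * ε)) / ε)
  have hΔc : ContinuousOn (Δ z) Ω := by
    refine ContinuousOn.congr (f := fun x => ∑ j, fderiv ℝ (fun y =>
      fderiv ℝ z y (EuclideanSpace.single j 1)) x (EuclideanSpace.single j 1))
      (continuousOn_finsetSum _ fun j _ => ?_)
      fun x hx => laplacian_eq_sum z (hz.1.contDiffAt (hO.mem_nhds hx))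
    exact ((contDiffOn_fderiv_apply hO hz.1 _).continuousOn_fderiv_of_isOpen hO le_rfl).clm_apply
      continuousOn_const
  have hcz : ContinuousOn (fun x => bulkCoeff ε V x * z x) Ω :=
    (continuousOn_bulkCoeff hΩ hV).mul hz.1.continuousOn
  have hfe : ContinuousOn (fun x => f x * (Real.exp (-V x / (2 * ε)) / ε)) Ω :=
    hfc.mul (((continuousOn_exp_neg hV).mono subset_closure).div_const ε)
  have hS : ContinuousOn S Ω := (hΔc.neg.add hcz).sub hfe
  have h0 : ∀ᵐ x ∂(volume : Measure (Euc d)), x ∈ Ω → S x = 0 := by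
    refine hO.ae_eq_zero_of_integral_contDiff_smul_eq_zero
      (hS.locallyIntegrableOn hO.measurableSet) fun φ hφ hc hs => ?_
    have hφ1 : ContDiff ℝ 1 φ := hφ.of_le (by exact_mod_cast le_top)
    have hφr := represents_classH1 hΩ (hφ1.contDiffOn (s := closure Ω))
    set q := classH1 hΩ (hφ1.contDiffOn (s := closure Ω))
    have hqg := hφr.h1Grad_ae_eq hΩ hφ1.contDiffOn
    have hTq := hT q φ hφ.continuous.continuousOn hφr
    have hφ0 : ∀ᵐ x ∂(surface Ω), T q x = 0 := by
      filter_upwards [hTq, ae_restrict_mem isClosed_frontier.measurableSet] with x h1 hx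
      rw [h1]
      refine image_eq_zero_of_notMem_tsupport fun hx' => ?_
      rw [hO.frontier_eq] at hx
      exact hx.2 (hs hx')
    have h1 := h q
    rw [bilin, load, integral_eq_zero_of_ae (μ := surface Ω)
      (hφ0.mono fun x hx => by simp [hx]), integral_eq_zero_of_ae (μ := surface Ω)
      (hφ0.mono fun x hx => by simp [hx]), add_zero, add_zero] at h1
    have e1 : ∫ x, inner ℝ (h1Grad p x) (h1Grad q x) ∂(bulk Ω) = -∫ x, φ x * Δ z x ∂(bulk Ω) := by
      rw [← integral_inner_gradient_test hO hz.1 hφ hc hs]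
      refine integral_congr_ae ?_
      filter_upwards [hqg, hp.h1Grad_ae_eq hΩ hz.2] with x h2 h3
      rw [h2, h3]
    have e2 : ∫ x, bulkCoeff ε V x * h1Val p x * h1Val q x ∂(bulk Ω) =
        ∫ x, bulkCoeff ε V x * z x * φ x ∂(bulk Ω) := by
      refine integral_congr_ae ?_
      filter_upwards [hp, hφr] with x h2 h3
      rw [h2, h3]
    have e3 : ∫ x, f x * (Real.exp (-V x / (2 * ε)) / ε) * h1Val q x ∂(bulk Ω) =
        ∫ x, f x * (Real.exp (-V x / (2 * ε)) / ε) * φ x ∂(bulk Ω) := by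
      refine integral_congr_ae ?_
      filter_upwards [hφr] with x h2
      rw [h2]
    rw [e1, e2, e3] at h1
    have i1 := integrable_mul_of_tsupport_subset hO hΔc hφ.continuous hc hs
    have i2 := integrable_mul_of_tsupport_subset hO hcz hφ.continuous hc hs
    have i3 := integrable_mul_of_tsupport_subset hO hfe hφ.continuous hc hs
    have e4 : ∫ x, φ x • S x ∂(bulk Ω) = 0 := by
      simp only [S, smul_eq_mul, mul_comm (φ _), sub_mul, add_mul, neg_mul]
      rw [integral_neg_add_sub i1 i2 i3, ← h1]
      simp only [mul_comm (φ _)]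
      ring
    refine Eq.trans (setIntegral_eq_integral_of_forall_compl_eq_zero fun x hx => ?_).symm e4
    rw [image_eq_zero_of_notMem_tsupport fun hx' => hx (hs hx'), zero_smul]
  have h1 := Measure.eqOn_open_of_ae_eq (μ := volume) (f := S) (g := fun _ => 0)
    ((ae_restrict_iff' hO.measurableSet).2 h0) hO hS continuousOn_const
  exact fun x hx => sub_eq_zero.1 (h1 hx)

/-- Once the equation holds, Green's formula applies and the bulk residual drops out. The boundary
residual is then orthogonal to the restriction of every test function on `ℝ^d`, hence zero almost
everywhere for the surface measure. -/
theorem IsWeakSolution.solvesSchrodinger (hΩ : IsBoundedLipschitz Ω)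
    {T : H1 Ω →L[ℝ] Lp ℝ 2 (surface Ω)} (hT : IsTraceOperator Ω T)
    (hV : ContDiffOn ℝ 2 V (closure Ω)) (hα : 0 < α) (hf : MemLp f 2 (bulk Ω))
    (hg : MemLp g 2 (surface Ω)) (hfc : ContinuousOn f Ω) (hz : IsC2C1 Ω z) {p : H1 Ω}
    (hp : Represents p z) (h : IsWeakSolution T ε V α κ f g p) :
    SolvesSchrodinger Ω ε V α κ f g z := by
  have := hΩ.isFiniteMeasure_surface
  have heq := h.schrodingerAt hΩ hT hV hfc hz hp
  refine ⟨hz, heq, ?_⟩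
  have hΔ := memLp_laplacian_of_schrodinger hΩ hV hf hz heq
  have hB : MemLp (fun x => normalDeriv Ω z x + boundaryCoeff Ω ε V α κ x * z x -
      1 / α * Real.exp (-V x / (2 * ε)) * g x) 2 (surface Ω) :=
    (((memLp_top_normalDeriv hΩ hz.2).mono_exponent le_top).add
      ((memLp_surface_of_continuousOn_closure (p := 2) hΩ hz.2.continuousOn).mul
        (memLp_boundaryCoeff hΩ hV))).sub (memLp_boundaryLoad hΩ hV hg)
  have h0 := ae_eq_zero_of_integral_contDiff_smul_eq_zero (hB.locallyIntegrable (by norm_num))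
    fun φ hφ hc => ?_
  · filter_upwards [h0] with x hx using (modifiedRobinAt_iff hα).2 hx
  have hφ1 : ContDiff ℝ 1 φ := hφ.of_le (by exact_mod_cast le_top)
  have hφr := represents_classH1 hΩ (hφ1.contDiffOn (s := closure Ω))
  set q := classH1 hΩ (hφ1.contDiffOn (s := closure Ω))
  have h1 := bilin_sub_load_eq (ε := ε) (α := α) (κ := κ) hΩ hT hV hf hg hz hΔ hp q
  rw [h q, sub_self, integral_eq_zero_of_ae (μ := bulk Ω), zero_add] at h1
  · rw [h1]
    refine integral_congr_ae ?_
    filter_upwards [hT q φ hφ.continuous.continuousOn hφr] with x hx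
    rw [hx, smul_eq_mul, mul_comm]
  · filter_upwards [ae_restrict_mem hΩ.isOpen.measurableSet] with x hx
    rw [sub_eq_zero.2 (heq x hx), zero_mul, Pi.zero_apply]

end WeakFormulation


/-! ### The energy formulation -/

section Variational

variable {H : Type*} [NormedAddCommGroup H] [InnerProductSpace ℝ H] [CompleteSpace H]

/-- The solution of a symmetric coercive variational problem exists, is unique, and is the unique
minimizer of the energy. -/
theorem exists_variational_solution {A : H →L[ℝ] H →L[ℝ] ℝ} (hs : ∀ p q, A p q = A q p)
    (hA : IsCoercive A) (L : H →L[ℝ] ℝ) :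
    ∃ p, (∀ q, (∀ v, A q v = L v) ↔ q = p) ∧
      ∀ q, IsMinOn (fun v => 1 / 2 * A v v - L v) univ q ↔ q = p := by
  let p := hA.continuousLinearEquivOfBilin.symm ((InnerProductSpace.toDual ℝ H).symm L)
  have hp : ∀ v, A p v = L v := fun v => by
    rw [← hA.continuousLinearEquivOfBilin_apply, ContinuousLinearEquiv.apply_symm_apply,
      InnerProductSpace.toDual_symm_apply]
  obtain ⟨C, hC, hCA⟩ := hA
  have hzero : ∀ v, A v v ≤ 0 → v = 0 := by
    intro v hv
    have h1 := (hCA v).trans hv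
    have h2 : ‖v‖ * ‖v‖ ≤ 0 := by nlinarith
    exact norm_eq_zero.1 (mul_self_eq_zero.1 (le_antisymm h2 (mul_self_nonneg _)))
  -- Completing the square at `p`, using `L = A p` and symmetry: the excess energy is half the form
  -- at `q - p`.
  have hE : ∀ q, 1 / 2 * A q q - L q = 1 / 2 * A p p - L p + 1 / 2 * A (q - p) (q - p) := by
    intro q
    rw [← hp q, ← hp p]
    simp only [map_sub, sub_apply]
    rw [hs q p]
    ring
  refine ⟨p, fun q => ⟨fun h => ?_, fun h => h ▸ hp⟩, fun q => ⟨fun h => ?_, fun h => ?_⟩⟩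
  · refine sub_eq_zero.1 (hzero _ (le_of_eq ?_))
    simp only [map_sub, sub_apply, h, hp]
    ring
  · have h1 := h (mem_univ p)
    simp only [mem_ofPred_eq] at h1
    rw [hE q] at h1
    exact sub_eq_zero.1 (hzero _ (by linarith))
  · intro v _
    simp only [mem_ofPred_eq, h]
    rw [hE v]
    have h1 := hCA (v - p)
    have h2 : 0 ≤ C * ‖v - p‖ * ‖v - p‖ := by positivity
    linarith

end Variational

/-! ### Completeness of $H^1$, continuity and coercivity of the form. -/

section Energy

variable {d : ℕ} {Ω : Set (Euc d)} {V f g : Euc d → ℝ} {ε α κ : ℝ}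

/-- For each test function the defining identity equates two $L^2$ inner products with fixed
elements, hence is a closed condition. The resulting completeness is what Lax–Milgram needs. -/
theorem isClosed_H1 (Ω : Set (Euc d)) : IsClosed (H1 Ω : Set (L2Pairs Ω)) := by
  have h0 : (H1 Ω : Set (L2Pairs Ω)) = ⋂ (φ : Euc d → ℝ) (_ : ContDiff ℝ ∞ φ)
      (_ : HasCompactSupport φ) (_ : tsupport φ ⊆ Ω) (i : Fin d), {p : L2Pairs Ω |
        ∫ x, p.fst x * fderiv ℝ φ x (EuclideanSpace.single i 1) ∂(bulk Ω) =
          -∫ x, φ x * p.snd x i ∂(bulk Ω)} := by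
    ext p
    simp only [mem_iInter]
    rfl
  rw [h0]
  refine isClosed_iInter fun φ => isClosed_iInter fun hφ => isClosed_iInter fun hc =>
    isClosed_iInter fun _ => isClosed_iInter fun i => ?_
  have h1 : MemLp (fun x => fderiv ℝ φ x (EuclideanSpace.single i 1)) 2 (bulk Ω) :=
    ((((hφ.continuous_fderiv (by simp)).clm_apply continuous_const)).memLp_of_hasCompactSupport
      (hc.fderiv_apply ℝ _) (μ := volume)).restrict Ω
  have h2 : MemLp (fun x => φ x • EuclideanSpace.single i (1 : ℝ)) 2 (bulk Ω) :=
    ((hφ.continuous.smul continuous_const).memLp_of_hasCompactSupport hc.smul_right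
      (μ := volume)).restrict Ω
  have e1 : ∀ p : L2Pairs Ω, ∫ x, p.fst x * fderiv ℝ φ x (EuclideanSpace.single i 1) ∂(bulk Ω) =
      inner ℝ p.fst h1.toLp := fun p => by
    rw [integral_mul_eq_inner (Lp.memLp _) h1, Lp.toLp_coeFn]
  have e2 : ∀ p : L2Pairs Ω, ∫ x, φ x * p.snd x i ∂(bulk Ω) = inner ℝ h2.toLp p.snd := by
    intro p
    rw [L2.inner_def]
    refine integral_congr_ae ?_
    filter_upwards [h2.coeFn_toLp] with x hx
    rw [hx, inner_smul_left, EuclideanSpace.inner_single_left]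
    simp
  simp only [e1, e2]
  exact isClosed_eq ((WithLp.continuous_fst 2 _ _).inner continuous_const)
    (continuous_const.inner (WithLp.continuous_snd 2 _ _)).neg

instance (Ω : Set (Euc d)) : CompleteSpace (H1 Ω) :=
  (isClosed_H1 Ω).completeSpace_coe

/-- The real inner product as a continuous bilinear form. -/
def innerForm (H : Type*) [NormedAddCommGroup H] [InnerProductSpace ℝ H] : H →L[ℝ] H →L[ℝ] ℝ :=
  (isBoundedBilinearMap_inner (𝕜 := ℝ) (E := H)).toContinuousLinearMap

theorem innerForm_apply {H : Type*} [NormedAddCommGroup H] [InnerProductSpace ℝ H] (u v : H) :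
    innerForm H u v = inner ℝ u v := rfl

theorem exists_mul_clm {β : Type*} [MeasurableSpace β] {μ : Measure β} {c : β → ℝ}
    (hc : MemLp c ⊤ μ) : ∃ M : Lp ℝ 2 μ →L[ℝ] Lp ℝ 2 μ, ∀ u, M u =ᵐ[μ] fun x => c x * u x := by
  refine ⟨(ContinuousLinearMap.mul ℝ ℝ).holderL μ ⊤ 2 2 hc.toLp, fun u => ?_⟩
  have h1 := (ContinuousLinearMap.mul ℝ ℝ).coeFn_holder (r := 2) hc.toLp u
  filter_upwards [h1, hc.coeFn_toLp] with x h1 h2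
  refine h1.trans ?_
  rw [h2]
  rfl

/-- The form `∫ c u v` as a continuous bilinear form on `L²`. -/
theorem exists_mul_form {β : Type*} [MeasurableSpace β] {μ : Measure β} {c : β → ℝ}
    (hc : MemLp c ⊤ μ) :
    ∃ B : Lp ℝ 2 μ →L[ℝ] Lp ℝ 2 μ →L[ℝ] ℝ, ∀ u v, B u v = ∫ x, c x * u x * v x ∂μ := by
  obtain ⟨M, hM⟩ := exists_mul_clm hc
  refine ⟨(innerForm _).comp M, fun u v => ?_⟩
  rw [ContinuousLinearMap.comp_apply, innerForm_apply, L2.inner_def]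
  refine integral_congr_ae ?_
  filter_upwards [hM u] with x hx
  rw [hx]
  simp only [RCLike.inner_apply, conj_trivial]
  ring

theorem exists_bilin_clm (hΩ : IsBoundedLipschitz Ω) (hV : ContDiffOn ℝ 2 V (closure Ω))
    (T : H1 Ω →L[ℝ] Lp ℝ 2 (surface Ω)) :
    ∃ A : H1 Ω →L[ℝ] H1 Ω →L[ℝ] ℝ, ∀ p q, A p q = bilin T ε V α κ p q := by
  obtain ⟨B, hB⟩ := exists_mul_form (memLp_bulkCoeff (ε := ε) hΩ hV)
  obtain ⟨S, hS⟩ := exists_mul_form (memLp_boundaryCoeff (ε := ε) (α := α) (κ := κ) hΩ hV)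
  refine ⟨(innerForm _).bilinearComp (gradCLM Ω) (gradCLM Ω) +
    B.bilinearComp (valCLM Ω) (valCLM Ω) + S.bilinearComp T T, fun p q => ?_⟩
  simp only [add_apply, ContinuousLinearMap.bilinearComp_apply, hB, hS, innerForm_apply,
    L2.inner_def]
  rfl

theorem bilin_comm (T : H1 Ω →L[ℝ] Lp ℝ 2 (surface Ω)) (p q : H1 Ω) :
    bilin T ε V α κ p q = bilin T ε V α κ q p := by
  refine congrArg₂ (· + ·) (congrArg₂ (· + ·) ?_ ?_) ?_
  · exact integral_congr_ae (Eventually.of_forall fun x => real_inner_comm _ _)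
  · exact integral_congr_ae (Eventually.of_forall fun x => mul_right_comm _ _ _)
  · exact integral_congr_ae (Eventually.of_forall fun x => mul_right_comm _ _ _)

theorem exists_load_clm (hΩ : IsBoundedLipschitz Ω) (hV : ContDiffOn ℝ 2 V (closure Ω))
    (T : H1 Ω →L[ℝ] Lp ℝ 2 (surface Ω)) (hf : MemLp f 2 (bulk Ω)) (hg : MemLp g 2 (surface Ω)) :
    ∃ L : H1 Ω →L[ℝ] ℝ, ∀ q, L q = load T ε V α f g q := by
  have h1 := memLp_bulkLoad (ε := ε) hΩ hV hf
  have h2 := memLp_boundaryLoad (ε := ε) (α := α) hΩ hV hg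
  refine ⟨(innerForm _ h1.toLp).comp (valCLM Ω) + (innerForm _ h2.toLp).comp T, fun q => ?_⟩
  rw [load, integral_mul_eq_inner h1 (Lp.memLp _), integral_mul_eq_inner h2 (Lp.memLp _),
    Lp.toLp_coeFn, Lp.toLp_coeFn]
  rfl

/-- The boundary term is nonnegative and is dropped. The gradient term has weight 1 and the value
term at least `a₀`, whence the constant `min 1 a₀`. -/
theorem isCoercive_of_bilin (hΩ : IsBoundedLipschitz Ω) (hV : ContDiffOn ℝ 2 V (closure Ω))
    {T : H1 Ω →L[ℝ] Lp ℝ 2 (surface Ω)} {A : H1 Ω →L[ℝ] H1 Ω →L[ℝ] ℝ}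
    (hA : ∀ p q, A p q = bilin T ε V α κ p q) {a₀ : ℝ} (ha₀ : 0 < a₀)
    (hc : ∀ x ∈ Ω, a₀ ≤ bulkCoeff ε V x)
    (hβ : ∀ᵐ x ∂(surface Ω), 0 ≤ boundaryCoeff Ω ε V α κ x) : IsCoercive A := by
  refine ⟨min 1 a₀, by positivity, fun p => ?_⟩
  rw [hA, bilin, mul_assoc, ← sq, norm_sq_h1]
  have h1 : ∫ x, inner ℝ (h1Grad p x) (h1Grad p x) ∂(bulk Ω) = ‖h1Grad p‖ ^ 2 := by
    rw [← real_inner_self_eq_norm_sq, L2.inner_def]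
  have h2 : a₀ * ‖h1Val p‖ ^ 2 ≤ ∫ x, bulkCoeff ε V x * h1Val p x * h1Val p x ∂(bulk Ω) := by
    have h3 : ‖h1Val p‖ ^ 2 = ∫ x, h1Val p x * h1Val p x ∂(bulk Ω) := by
      rw [← real_inner_self_eq_norm_sq, integral_mul_eq_inner (Lp.memLp _) (Lp.memLp _),
        Lp.toLp_coeFn]
    rw [h3, ← integral_const_mul]
    refine integral_mono_ae ((integrable_mul_of_memLp (Lp.memLp _) (Lp.memLp _)).const_mul _)
      (integrable_mul_of_memLp ((Lp.memLp (h1Val p)).mul (memLp_bulkCoeff (ε := ε) hΩ hV) (r := 2))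
        (Lp.memLp _)) ?_
    filter_upwards [ae_restrict_mem hΩ.isOpen.measurableSet] with x hx
    simp only [mul_assoc]
    exact mul_le_mul_of_nonneg_right (hc x hx) (mul_self_nonneg _)
  have h3 : 0 ≤ ∫ x, boundaryCoeff Ω ε V α κ x * T p x * T p x ∂(surface Ω) := by
    refine integral_nonneg_of_ae ?_
    filter_upwards [hβ] with x hx
    rw [mul_assoc]
    exact mul_nonneg hx (mul_self_nonneg _)
  rw [h1]
  have h4 := mul_le_mul_of_nonneg_right (min_le_right 1 a₀) (sq_nonneg ‖h1Val p‖)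
  have h5 := mul_le_mul_of_nonneg_right (min_le_left 1 a₀) (sq_nonneg ‖h1Grad p‖)
  linarith

/-- Unique solvability and the energy principle for a coercive form. -/
theorem exists_weakSolution_minimizer {T : H1 Ω →L[ℝ] Lp ℝ 2 (surface Ω)}
    {A : H1 Ω →L[ℝ] H1 Ω →L[ℝ] ℝ} (hA : ∀ p q, A p q = bilin T ε V α κ p q) (hAc : IsCoercive A)
    {L : H1 Ω →L[ℝ] ℝ} (hL : ∀ q, L q = load T ε V α f g q) :
    ∃ p : H1 Ω, (∀ q, IsWeakSolution T ε V α κ f g q ↔ q = p) ∧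
      ∀ q, IsMinOn (energy T ε V α κ f g) univ q ↔ q = p := by
  obtain ⟨p, h1, h2⟩ := exists_variational_solution
    (fun p q => by rw [hA, hA, bilin_comm]) hAc L
  refine ⟨p, fun q => ?_, fun q => ?_⟩
  · rw [← h1 q]
    simp only [hA, hL]
    rfl
  · rw [← h2 q]
    simp only [hA, hL]
    rfl

end Energy

end RobinProblem

end

theorem mainTheorem1 {d : ℕ} (hd : 1 ≤ d) (Ω : Set (Euc d)) (hΩ : IsBoundedLipschitz Ω)
    (ε : ℝ) (hε : 0 < ε) (α κ : ℝ) (hα : 0 ≤ α) (hκ : 0 ≤ κ)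
    (V : Euc d → ℝ) (hV : ContDiffOn ℝ 2 V (closure Ω))
    (F : Euc d → Euc d) (hF : ∀ x ∈ Ω, F x = ∇ V x)
    (f g : Euc d → ℝ) :
    -- the change of variable
    (∀ u z : Euc d → ℝ, (∀ x ∈ closure Ω, u x = Real.exp (V x / (2 * ε)) * z x) →
      (IsC2C1 Ω u ↔ IsC2C1 Ω z) ∧
      (IsC2C1 Ω z →
        (∀ x ∈ Ω, ConvDiffAt ε F f u x ↔ SchrodingerAt ε V f z x) ∧
        (∀ x ∈ frontier Ω, RobinAt Ω α κ g u x ↔ ModifiedRobinAt Ω ε V α κ g z x)) ∧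
      (SolvesConvDiff Ω ε F α κ f g u ↔ SolvesSchrodinger Ω ε V α κ f g z)) ∧
    -- the trace operator exists and is unique
    (∃! T : H1 Ω →L[ℝ] Lp ℝ 2 (surface Ω), IsTraceOperator Ω T) ∧
    ∀ T : H1 Ω →L[ℝ] Lp ℝ 2 (surface Ω), IsTraceOperator Ω T →
      0 < α → MemLp f 2 (bulk Ω) → MemLp g 2 (surface Ω) →
      -- the weak formulation
      (∀ z : Euc d → ℝ, IsC2C1 Ω z →
        (∃! p : H1 Ω, Represents p z) ∧
        ∀ p : H1 Ω, Represents p z →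
          (SolvesSchrodinger Ω ε V α κ f g z → IsWeakSolution T ε V α κ f g p) ∧
          (ContinuousOn f Ω → IsWeakSolution T ε V α κ f g p →
            SolvesSchrodinger Ω ε V α κ f g z)) ∧
      -- the energy formulation under the positivity conditions
      ((∃ a₀ > 0, ∀ x ∈ Ω, a₀ ≤ bulkCoeff ε V x) →
        (∀ᵐ x ∂(surface Ω), 0 ≤ boundaryCoeff Ω ε V α κ x) →
        (∃ A : H1 Ω →L[ℝ] H1 Ω →L[ℝ] ℝ,
          (∀ p q, A p q = bilin T ε V α κ p q) ∧ (∀ p q, A p q = A q p) ∧ IsCoercive A) ∧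
        (∃ L : H1 Ω →L[ℝ] ℝ, ∀ q, L q = load T ε V α f g q) ∧
        (∃ p : H1 Ω, (∀ q, IsWeakSolution T ε V α κ f g q ↔ q = p) ∧
          (∀ q, IsMinOn (energy T ε V α κ f g) Set.univ q ↔ q = p)) ∧
        (∀ (z : Euc d → ℝ) (p : H1 Ω), Represents p z → SolvesSchrodinger Ω ε V α κ f g z →
          ∀ q, IsMinOn (energy T ε V α κ f g) Set.univ q ↔ q = p)) := by

  refine ⟨fun u z hu => ⟨isC2C1_exp_mul_iff hV hu, fun hz => ⟨fun x hx => ?_, fun x hx => ?_⟩, ?_⟩,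
    existsUnique_trace hΩ, fun T hT hα0 hf hg => ⟨fun z hz => ⟨existsUnique_represents hΩ hz,
    fun p hp => ⟨fun h => ?_, fun hfc h => ?_⟩⟩, ?_⟩⟩
  · exact convDiffAt_iff hΩ.isOpen hε (hV.mono subset_closure) hF hz.1
      (fun y hy => hu y (subset_closure hy)) hx
  · exact robinAt_iff hΩ hV hz hu (frontier_subset_closure hx)
  · exact solvesConvDiff_iff hΩ hε hV hF hu
  · exact h.isWeakSolution hΩ hT hV hα0 hf hg hp
  · exact h.solvesSchrodinger hΩ hT hV hα0 hf hg hfc hz hp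
  · rintro ⟨a₀, ha₀, hc⟩ hβ
    obtain ⟨A, hA⟩ := exists_bilin_clm (ε := ε) (α := α) (κ := κ) hΩ hV T
    obtain ⟨L, hL⟩ := exists_load_clm (ε := ε) (α := α) hΩ hV T hf hg
    have hAc := isCoercive_of_bilin hΩ hV hA ha₀ hc hβ
    obtain ⟨p, hp, hmin⟩ := exists_weakSolution_minimizer hA hAc hL
    refine ⟨⟨A, hA, fun p q => by rw [hA, hA, bilin_comm], hAc⟩, ⟨L, hL⟩, ⟨p, hp, hmin⟩,
      fun z q hq hz r => ?_⟩
    -- The class of a classical solution is a weak solution, so by uniqueness it is the minimizer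
    -- `p`.
    rw [(hp q).1 (hz.isWeakSolution hΩ hT hV hα0 hf hg hq)]
    exact hmin r
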